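/- Theorem. Let $N\ge 2$ be an integer, let $d\in(0,1)$ or $d\in\{1,2,3,\dots\}$, let $p>1$ and $0<-\alpha<\min(2d,N)$, and put $p_c=\frac{N(p-1)}{2d+\alpha}$. Let $1<q<\infty$ with $q>\max\big\{p_c,\frac{Np}{N+\alpha}\big\}$. Let $\zeta:(0,\infty)\to(0,\infty)$ be continuous with $\zeta(t)\sim t^{\sigma}$ as $t\to 0$ and $\zeta(t)\sim t^{m}$ as $t\to\infty$, for some $\sigma>-1$ and $m\in\mathbb{R}$, and let $u_0,\mathbf{w}\in L^q(\mathbb{R}^N)$ be real-valued. Let $e^{-t(-\Delta)^d}$ ($t>0$) be convolution with the kernel $E_d(\cdot,t)=\mathcal F^{-1}\big(e^{-t|\xi|^{2d}}\big)$, and the identity for $t=0$. For a time interval $I=[0,T]$ or $I=[0,T)$, a mild solution on $I$ of $$u_t+(-\Delta)^d u=|x|^{\alpha}|u|^p+\zeta(t)\mathbf{w}(x),\qquad u(0)=u_0,$$ is a function $u\in C(I;L^q(\mathbb{R}^N))$ such that for all $t\in I$ $$u(t)=e^{-t(-\Delta)^{d}}u_0+\int_0^t e^{-(t-s)(-\Delta)^{d}}\big(|\cdot|^{\alpha}|u(s)|^p\big)\,ds+\int_0^t\zeta(s)\,e^{-(t-s)(-\Delta)^{d}}\mathbf{w}\,ds,$$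 with convergent Bochner integrals in $L^q(\mathbb{R}^N)$. Then: (i) There exist $T>0$ and a unique mild solution $u\in C([0,T];L^q(\mathbb{R}^N))$. (ii) Let $T_{\max}\in(0,\infty]$ be the maximal time of existence, i.e. the supremum of all $T>0$ for which there is a mild solution on $[0,T]$. There is a mild solution $u$ on $[0,T_{\max})$, which is maximal: if $v$ is a mild solution on $[0,T]$ for some $T>0$, then $T<T_{\max}$ and $v=u$ on $[0,T]$. If $T_{\max}<\infty$, then $$\lim_{t\to T_{\max}^-}\|u(t)\|_{L^q(\mathbb{R}^N)}=\infty .$$ -/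

import Mathlib

open MeasureTheory Set Filter Topology Asymptotics
open scoped ENNReal FourierTransform Convolution

noncomputable section

/-- The kernel `E_d(·, t)` of `e^{-t(-Δ)^d}` on `ℝ^N`: the inverse Fourier transform of the symbol
`exp (-t |ξ|^{2d})`. In Mathlib's normalisation of the Fourier transform (`e^{2πi⟨x,ξ⟩}`), the symbol of
`-Δ` is `(2π‖ξ‖)^2`. The inverse transform is real, since the symbol is real and even. -/
def polyHeatKernel (N : ℕ) (d t : ℝ) (x : EuclideanSpace ℝ (Fin N)) : ℝ :=
  (𝓕⁻ (fun ξ : EuclideanSpace ℝ (Fin N) =>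
    ((Real.exp (-t * (2 * Real.pi * ‖ξ‖) ^ (2 * d)) : ℝ) : ℂ)) x).re

/-- The semigroup `e^{-t(-Δ)^d}` acting on functions: convolution with the kernel for `t > 0`,
the identity for `t = 0`. -/
def polyHeat {N : ℕ} (d t : ℝ) (f : EuclideanSpace ℝ (Fin N) → ℝ) : EuclideanSpace ℝ (Fin N) → ℝ :=
  if 0 < t then polyHeatKernel N d t ⋆[ContinuousLinearMap.mul ℝ ℝ, volume] f else f

/-- `e^{-t(-Δ)^d} f` as an element of `L^q` (with value `0` if it is not in `L^q`; the definition of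
mild solution below demands that it is in `L^q` wherever it is used). -/
def polyHeatLp {N : ℕ} (q : ℝ≥0∞) (d t : ℝ) (f : EuclideanSpace ℝ (Fin N) → ℝ) :
    Lp ℝ q (volume : Measure (EuclideanSpace ℝ (Fin N))) :=
  open Classical in
  if h : MemLp (polyHeat d t f) q volume then h.toLp _ else 0

/-- The nonlinearity `x ↦ |x|^α |v(x)|^p`. -/
def hardyHenon {N : ℕ} (α p : ℝ) (v : EuclideanSpace ℝ (Fin N) → ℝ) :
    EuclideanSpace ℝ (Fin N) → ℝ :=
  fun x => ‖x‖ ^ α * |v x| ^ p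

/-- The hypothesis on `ζ : (0,∞) → (0,∞)`: it is continuous, `ζ(t) ∼ t^σ` as `t → 0` and
`ζ(t) ∼ t^m` as `t → ∞`, for some `σ > -1` and `m ∈ ℝ`. -/
structure ForcingCoefficient (ζ : ℝ → ℝ) : Prop where
  continuousOn : ContinuousOn ζ (Ioi 0)
  pos : ∀ t, 0 < t → 0 < ζ t
  equiv_zero : ∃ σ : ℝ, -1 < σ ∧ ζ ~[𝓝[>] 0] (fun t => t ^ σ)
  equiv_top : ∃ m : ℝ, ζ ~[atTop] (fun t => t ^ m)

/-- `u ∈ C(I; L^q)` is a mild solution on the time interval `I` (which is `[0,T]` or `[0,T)`): for every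
`t ∈ I`,
`u(t) = e^{-t(-Δ)^d} u₀ + ∫₀ᵗ e^{-(t-s)(-Δ)^d} (|·|^α |u(s)|^p) ds + ∫₀ᵗ ζ(s) e^{-(t-s)(-Δ)^d} w ds`,
where the time integrals are (convergent) Bochner integrals in `L^q`. -/
structure IsMildSolution {N : ℕ} {q : ℝ≥0∞} [Fact (1 ≤ q)] (d α p : ℝ) (ζ : ℝ → ℝ)
    (w u₀ : Lp ℝ q (volume : Measure (EuclideanSpace ℝ (Fin N)))) (I : Set ℝ)
    (u : ℝ → Lp ℝ q (volume : Measure (EuclideanSpace ℝ (Fin N)))) : Prop where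
  continuousOn : ContinuousOn u I
  memLp_init : ∀ t ∈ I, MemLp (polyHeat d t u₀) q volume
  memLp_nonlin : ∀ t ∈ I, ∀ s ∈ Ioo 0 t, MemLp (polyHeat d (t - s) (hardyHenon α p (u s))) q volume
  memLp_forcing : ∀ t ∈ I, ∀ s ∈ Ioo 0 t, MemLp (polyHeat d (t - s) w) q volume
  integrable_nonlin : ∀ t ∈ I,
    IntervalIntegrable (fun s => polyHeatLp q d (t - s) (hardyHenon α p (u s))) volume 0 t
  integrable_forcing : ∀ t ∈ I,
    IntervalIntegrable (fun s => ζ s • polyHeatLp q d (t - s) w) volume 0 t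
  duhamel : ∀ t ∈ I,
    u t = polyHeatLp q d t u₀
      + (∫ s in (0 : ℝ)..t, polyHeatLp q d (t - s) (hardyHenon α p (u s)))
      + ∫ s in (0 : ℝ)..t, ζ s • polyHeatLp q d (t - s) w

/-- The maximal time of existence `T_max`: the supremum in `[-∞, ∞]` of all `T > 0` for which there is a
mild solution in `C([0,T]; L^q)`. -/
def maximalTime {N : ℕ} {q : ℝ≥0∞} [Fact (1 ≤ q)] (d α p : ℝ) (ζ : ℝ → ℝ)
    (w u₀ : Lp ℝ q (volume : Measure (EuclideanSpace ℝ (Fin N)))) : EReal :=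
  sSup {τ : EReal | ∃ T : ℝ, 0 < T ∧ τ = (T : EReal) ∧
    ∃ v, IsMildSolution d α p ζ w u₀ (Icc 0 T) v}

end

/-!
The mild formulation is a Volterra equation `u t = h t + ∫₀ᵗ Nl (t - s) (u s) ds` in `L^q`, with
`Nl t u = e^{-t(-Δ)^d} (|x|^α |u|^p)` and with `h` collecting the initial value and the forcing.

The abstract part (`VolterraKernel`) assumes that `Nl t` is Lipschitz on balls with a constant that is
integrable in `t` up to `t = 0`. Contraction in `C([0, δ])` gives a solution on an interval whose length
depends only on bounds for `h` and on the size of the data; a maximum argument with an exponential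
weight gives uniqueness. Because the semigroup shifts the kernel (`IsShiftSemigroup`), the equation can
be restarted at any time from the value of the solution there, with a step that is bounded below as long
as the solution stays in a ball and the time in a bounded interval. Hence the solutions extend to a
maximal one, whose maximal interval is half open, and whose norm must tend to infinity (not merely be
unbounded) at a finite maximal time: `VolterraKernel.maximal_solution`.

What remains is to show that `Nl` is such a kernel.

* The heat kernel is integrable. For a positive integer `d` its symbol is a Schwartz function. For
  `0 < d < 1` the symbol is, by the formula `c y^d = ∫₀^∞ (1 - e^{-λy}) λ^{-1-d} dλ`, a pointwise limit of
  exponentials of mixtures of Gaussians, so the kernel is nonnegative, and a nonnegative continuous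
  function with integrable Fourier transform is integrable (`integrable_polyHeatKernel`).
* Scaling, Young's inequality and interpolation between `‖E‖_1` and `‖E‖_∞` give the smoothing estimate
  `L^r → L^q` with constant `C t^{-(N/2d)(1/r - 1/q)}` (`exists_eLpNorm_polyHeat_le`).
* The weight `|x|^α` is split at `|x| = 1` into a part in `L^{1/s}`, with `s` slightly above `-α/N`, and a
  bounded part. Hölder's inequality makes `u ↦ |x|^α |u|^p` locally Lipschitz from `L^q` into
  `L^r + L^{r'}`, where `1/r = s + p/q` and `1/r' = p/q`. The condition `q > Np/(N+α)` allows `r ≥ 1`,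
  and `q > N(p-1)/(2d+α)` makes the resulting singularities in `t` integrable
  (`exists_weight_exponent`, `exists_volterraKernel_hardyHenon`).
* Strong continuity of the semigroup at `t = 0` reduces by Jensen's inequality to the continuity of
  translations in `L^q` (`tendsto_polyHeatLp_zero`).

The forcing coefficient is integrable at `0` since `σ > -1`, so the inhomogeneity is continuous on
`[0, ∞)`.
-/

/-! ### Volterra equations with a singular locally Lipschitz kernel -/

/-- A nonlinear Volterra kernel `Nl s x` on a Banach space: jointly continuous for `s > 0`, zero at
`x = 0`, and Lipschitz on each ball with a constant that is locally integrable in `s` up to `s = 0`. -/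
structure VolterraKernel {X : Type*} [NormedAddCommGroup X] (Nl : ℝ → X → X) (κ L : ℝ → ℝ) :
    Prop where
  continuousOn : ContinuousOn (Function.uncurry Nl) (Ioi 0 ×ˢ univ)
  intervalIntegrable : ∀ T, 0 ≤ T → IntervalIntegrable κ volume 0 T
  nonneg : ∀ s, 0 < s → 0 ≤ κ s
  lip_nonneg : ∀ R, 0 ≤ R → 0 ≤ L R
  lipschitz : ∀ R s u v, 0 < s → ‖u‖ ≤ R → ‖v‖ ≤ R → ‖Nl s u - Nl s v‖ ≤ L R * κ s * ‖u - v‖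
  map_zero : ∀ s, 0 < s → Nl s 0 = 0

/-- `v` is a continuous solution on the time interval `I` of `v t = h t + ∫₀ᵗ Nl (t - s) (v s) ds`. -/
def IsVolterraSolution {X : Type*} [NormedAddCommGroup X] [NormedSpace ℝ X] (Nl : ℝ → X → X)
    (h : ℝ → X) (I : Set ℝ) (v : ℝ → X) : Prop :=
  ContinuousOn v I ∧ ∀ t ∈ I, v t = h t + ∫ s in (0 : ℝ)..t, Nl (t - s) (v s)

namespace VolterraKernel

variable {X : Type*} [NormedAddCommGroup X] {Nl : ℝ → X → X} {κ L : ℝ → ℝ}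

lemma norm_le (hN : VolterraKernel Nl κ L) {R s : ℝ} {u : X} (hs : 0 < s) (hu : ‖u‖ ≤ R) :
    ‖Nl s u‖ ≤ L R * κ s * R := by
  have hR : 0 ≤ R := (norm_nonneg u).trans hu
  have := hN.lipschitz R s u 0 hs hu (by simpa using hR)
  rw [hN.map_zero s hs, sub_zero, sub_zero] at this
  exact this.trans (mul_le_mul_of_nonneg_left hu
    (mul_nonneg (hN.lip_nonneg R hR) (hN.nonneg s hs)))

lemma exists_norm_le {v : ℝ → X} {a b : ℝ} (hv : ContinuousOn v (Icc a b)) :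
    ∃ R, 0 ≤ R ∧ ∀ s ∈ Icc a b, ‖v s‖ ≤ R := by
  obtain ⟨R, hR⟩ := isCompact_Icc.exists_bound_of_continuousOn hv
  exact ⟨max R 0, le_max_right _ _, fun s hs => (hR s hs).trans (le_max_left _ _)⟩

lemma exists_pos_integral_le (hN : VolterraKernel Nl κ L) {ε δ₀ : ℝ} (hε : 0 < ε) (hδ₀ : 0 < δ₀) :
    ∃ δ, 0 < δ ∧ δ ≤ δ₀ ∧ ∀ t ∈ Icc 0 δ, ∫ s in (0 : ℝ)..t, κ s ≤ ε := by
  have hc : ContinuousWithinAt (fun t => ∫ s in (0 : ℝ)..t, κ s) (Icc 0 δ₀) 0 := by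
    have := intervalIntegral.continuousOn_primitive_interval (μ := volume) (f := κ)
      (a := 0) (b := δ₀) (by
        have := hN.intervalIntegrable δ₀ hδ₀.le
        rw [intervalIntegrable_iff_integrableOn_Icc_of_le hδ₀.le] at this
        rwa [uIcc_of_le hδ₀.le])
    rw [uIcc_of_le hδ₀.le] at this
    exact this 0 ⟨le_rfl, hδ₀.le⟩
  have h1 : ∀ᶠ t in 𝓝[Icc 0 δ₀] (0 : ℝ), ∫ s in (0 : ℝ)..t, κ s < ε := by
    refine hc.tendsto.eventually (gt_mem_nhds ?_)
    simpa using hε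
  rw [eventually_nhdsWithin_iff, Metric.eventually_nhds_iff] at h1
  obtain ⟨η, hη, h1⟩ := h1
  refine ⟨min (η / 2) δ₀, by positivity, min_le_right _ _, fun t ht => (h1 ?_ ?_).le⟩
  · rw [Real.dist_eq, sub_zero, abs_of_nonneg ht.1]
    linarith [ht.2.trans (min_le_left _ _)]
  · exact ⟨ht.1, ht.2.trans (min_le_right _ _)⟩

lemma intervalIntegrable_duhamel (hN : VolterraKernel Nl κ L) {v : ℝ → X} {t a b : ℝ}
    (h0 : 0 ≤ a) (hab : a ≤ b) (hb : b ≤ t) (hv : ContinuousOn v (Icc a b)) :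
    IntervalIntegrable (fun s => Nl (t - s) (v s)) volume a b := by
  obtain ⟨R, hR0, hR⟩ := exists_norm_le hv
  have hκ : IntervalIntegrable (fun s => κ (t - s)) volume a b := by
    have h1 := (hN.intervalIntegrable t (h0.trans (hab.trans hb))).comp_sub_left (c := t)
    simp only [sub_zero, sub_self] at h1
    refine h1.symm.mono_set ?_
    rw [uIcc_of_le hab, uIcc_of_le (by linarith)]
    exact Icc_subset_Icc h0 hb
  rw [intervalIntegrable_iff_integrableOn_Ioo_of_le hab] at hκ ⊢
  refine Integrable.mono' (((hκ.const_mul (L R)).mul_const R)) ?_ ?_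
  · refine ContinuousOn.aestronglyMeasurable ?_ measurableSet_Ioo
    refine hN.continuousOn.comp (f := fun s => (t - s, v s)) ?_ ?_
    · exact (continuousOn_const.sub continuousOn_id).prodMk (hv.mono Ioo_subset_Icc_self)
    · intro s hs
      exact ⟨by simp only [mem_Ioi]; linarith [hs.2], mem_univ _⟩
  · filter_upwards [ae_restrict_mem measurableSet_Ioo] with s hs
    exact hN.norm_le (by linarith [hs.2]) (hR s (Ioo_subset_Icc_self hs))

/-- Exponential weights make the total mass of the singular factor arbitrarily small. -/
lemma exists_weight (hN : VolterraKernel Nl κ L) {T ε : ℝ} (hT : 0 ≤ T) (hε : 0 < ε) :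
    ∃ l : ℝ, ∀ t ∈ Icc 0 T, ∫ s in (0 : ℝ)..t, κ s * Real.exp (-l * s) ≤ ε := by
  have hint := hN.intervalIntegrable T hT
  have h0 : Tendsto (fun l : ℝ => ∫ s in (0 : ℝ)..T, κ s * Real.exp (-l * s)) atTop
      (𝓝 (∫ s in (0 : ℝ)..T, (0 : ℝ))) := by
    refine intervalIntegral.tendsto_integral_filter_of_dominated_convergence κ ?_ ?_ hint ?_
    · refine Eventually.of_forall fun l => ?_
      have h1 : IntervalIntegrable (fun s => κ s * Real.exp (-l * s)) volume 0 T :=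
        hint.mul_continuousOn (by fun_prop)
      exact h1.def'.aestronglyMeasurable
    · filter_upwards [eventually_ge_atTop 0] with l hl
      refine Eventually.of_forall fun s hs => ?_
      rw [uIoc_of_le hT] at hs
      rw [norm_mul, Real.norm_of_nonneg (hN.nonneg s hs.1), Real.norm_of_nonneg (Real.exp_nonneg _)]
      refine mul_le_of_le_one_right (hN.nonneg s hs.1) (Real.exp_le_one_iff.2 ?_)
      nlinarith [hs.1]
    · refine Eventually.of_forall fun s hs => ?_
      rw [uIoc_of_le hT] at hs
      have h1 : Tendsto (fun l : ℝ => Real.exp (-l * s)) atTop (𝓝 0) := by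
        refine Real.tendsto_exp_atBot.comp ?_
        simp only [neg_mul]
        exact tendsto_neg_atTop_atBot.comp (tendsto_id.atTop_mul_const hs.1)
      simpa using h1.const_mul (κ s)
  rw [intervalIntegral.integral_zero] at h0
  obtain ⟨l, hl⟩ := (h0.eventually (gt_mem_nhds hε)).exists
  refine ⟨l, fun t ht => le_trans ?_ hl.le⟩
  refine intervalIntegral.integral_mono_interval le_rfl ht.1 ht.2 ?_
    (hint.mul_continuousOn (by fun_prop))
  filter_upwards [ae_restrict_mem measurableSet_Ioc] with s hs
  exact mul_nonneg (hN.nonneg s hs.1) (Real.exp_nonneg _)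

variable [NormedSpace ℝ X]

/-- The Duhamel integral of a continuous function is continuous: substitute `s ↦ t - s` and use
dominated convergence. -/
lemma continuousOn_duhamel (hN : VolterraKernel Nl κ L) {v : ℝ → X} {T : ℝ}
    (hv : ContinuousOn v (Icc 0 T)) :
    ContinuousOn (fun t => ∫ s in (0 : ℝ)..t, Nl (t - s) (v s)) (Icc 0 T) := by
  rcases lt_or_ge T 0 with hT | hT
  · rw [Icc_eq_empty (by linarith)]; exact continuousOn_empty _
  obtain ⟨R, hR0, hR⟩ := exists_norm_le hv
  set V : ℝ → X := IccExtend hT (domRestrict (Icc 0 T) v) with hV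
  have hVc : Continuous V := (continuousOn_iff_continuous_domRestrict.1 hv).Icc_extend'
  have hVR : ∀ r, ‖V r‖ ≤ R := fun r => hR _ (projIcc 0 T hT r).2
  have hVv : ∀ r ∈ Icc 0 T, V r = v r := fun r hr => IccExtend_of_mem hT _ hr
  have hcont : Continuous fun t => ∫ s in Ioc 0 T, (Iio t).indicator (fun s => Nl s (V (t - s))) s := by
    refine continuous_iff_continuousAt.2 fun t₀ => ?_
    refine continuousAt_of_dominated (bound := fun s => L R * κ s * R) ?_ ?_ ?_ ?_
    · refine Eventually.of_forall fun t => AEStronglyMeasurable.indicator ?_ measurableSet_Iio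
      refine ContinuousOn.aestronglyMeasurable ?_ measurableSet_Ioc
      refine hN.continuousOn.comp (f := fun s => (s, V (t - s))) ?_ ?_
      · exact (continuous_id.prodMk (hVc.comp (continuous_const.sub continuous_id))).continuousOn
      · exact fun s hs => ⟨hs.1, mem_univ _⟩
    · refine Eventually.of_forall fun t => ?_
      filter_upwards [ae_restrict_mem measurableSet_Ioc] with s hs
      refine (norm_indicator_le_norm_self _ _).trans ?_
      exact hN.norm_le hs.1 (hVR _)
    · have := hN.intervalIntegrable T hT
      rw [intervalIntegrable_iff_integrableOn_Ioc_of_le hT] at this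
      exact (this.const_mul (L R)).mul_const R
    · have hne : ∀ᵐ s ∂(volume.restrict (Ioc 0 T)), s ≠ t₀ :=
        ae_restrict_of_ae (Measure.ae_ne volume t₀)
      filter_upwards [ae_restrict_mem measurableSet_Ioc, hne] with s hs hst
      rcases lt_or_gt_of_ne hst with h | h
      · have : ContinuousAt (fun t => Nl s (V (t - s))) t₀ := by
          have h1 : ContinuousAt (Function.uncurry Nl) (s, V (t₀ - s)) :=
            hN.continuousOn.continuousAt ((isOpen_Ioi.prod isOpen_univ).mem_nhds ⟨hs.1, mem_univ _⟩)
          exact ContinuousAt.comp (f := fun t => (s, V (t - s))) h1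
            (continuous_const.prodMk (hVc.comp (continuous_id.sub continuous_const))).continuousAt
        refine this.congr ?_
        filter_upwards [lt_mem_nhds h] with t ht
        rw [indicator_of_mem (show s ∈ Iio t from ht)]
      · refine (continuousAt_const (y := (0 : X))).congr ?_
        filter_upwards [gt_mem_nhds h] with t ht
        rw [indicator_of_notMem (show s ∉ Iio t from not_lt.2 ht.le)]
  refine hcont.continuousOn.congr fun t ht => ?_
  have h1 : ∫ s in (0 : ℝ)..t, Nl (t - s) (v s) = ∫ s in (0 : ℝ)..t, Nl s (V (t - s)) := by
    have := intervalIntegral.integral_comp_sub_left (fun s => Nl s (V (t - s))) t (a := 0) (b := t)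
    simp only [sub_sub_cancel, sub_self, sub_zero] at this
    rw [← this]
    refine intervalIntegral.integral_congr fun s hs => ?_
    rw [uIcc_of_le ht.1] at hs
    rw [hVv s ⟨hs.1, hs.2.trans ht.2⟩]
  simp only
  rw [h1, intervalIntegral.integral_of_le ht.1, integral_Ioc_eq_integral_Ioo,
    setIntegral_indicator measurableSet_Iio]
  congr 2
  ext s
  simp only [mem_Ioo, mem_inter_iff, mem_Ioc, mem_Iio]
  exact ⟨fun h => ⟨⟨h.1, h.2.le.trans ht.2⟩, h.2⟩, fun h => ⟨h.1.1, h.2⟩⟩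

/-- Exponentially weighted Lipschitz estimate for the Duhamel integral. -/
lemma norm_duhamel_sub_le (hN : VolterraKernel Nl κ L) {u v : ℝ → X} {t R m l : ℝ} (ht : 0 ≤ t)
    (hu : ContinuousOn u (Icc 0 t)) (hv : ContinuousOn v (Icc 0 t))
    (huR : ∀ s ∈ Icc 0 t, ‖u s‖ ≤ R) (hvR : ∀ s ∈ Icc 0 t, ‖v s‖ ≤ R)
    (huv : ∀ s ∈ Icc 0 t, ‖u s - v s‖ ≤ m * Real.exp (l * s)) :
    ‖(∫ s in (0 : ℝ)..t, Nl (t - s) (u s)) - ∫ s in (0 : ℝ)..t, Nl (t - s) (v s)‖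
      ≤ L R * m * Real.exp (l * t) * ∫ s in (0 : ℝ)..t, κ s * Real.exp (-l * s) := by
  have hR : 0 ≤ R := (norm_nonneg _).trans (huR 0 ⟨le_rfl, ht⟩)
  rw [← intervalIntegral.integral_sub (hN.intervalIntegrable_duhamel le_rfl ht le_rfl hu)
    (hN.intervalIntegrable_duhamel le_rfl ht le_rfl hv)]
  have e1 : ∫ s in (0 : ℝ)..t, κ s * Real.exp (-l * s)
      = ∫ s in (0 : ℝ)..t, κ (t - s) * Real.exp (-l * (t - s)) := by
    have := intervalIntegral.integral_comp_sub_left (fun s => κ s * Real.exp (-l * s)) t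
      (a := 0) (b := t)
    simp only [sub_self, sub_zero] at this
    exact this.symm
  rw [e1, ← intervalIntegral.integral_const_mul]
  have hint : IntervalIntegrable (fun s => κ (t - s) * Real.exp (-l * (t - s))) volume 0 t := by
    have h1 := (hN.intervalIntegrable t ht).comp_sub_left (c := t)
    simp only [sub_zero, sub_self] at h1
    exact h1.symm.mul_continuousOn (by fun_prop)
  refine intervalIntegral.norm_integral_le_of_norm_le ht ?_ (hint.const_mul _)
  filter_upwards [Measure.ae_ne volume t] with s hst hs
  have hs0 : 0 < t - s := sub_pos.2 (lt_of_le_of_ne hs.2 hst)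
  have hs' : s ∈ Icc 0 t := Ioc_subset_Icc_self hs
  calc ‖Nl (t - s) (u s) - Nl (t - s) (v s)‖ ≤ L R * κ (t - s) * ‖u s - v s‖ :=
        hN.lipschitz R _ _ _ hs0 (huR s hs') (hvR s hs')
    _ ≤ L R * κ (t - s) * (m * Real.exp (l * s)) :=
        mul_le_mul_of_nonneg_left (huv s hs')
          (mul_nonneg (hN.lip_nonneg R hR) (hN.nonneg _ hs0))
    _ = L R * m * Real.exp (l * t) * (κ (t - s) * Real.exp (-l * (t - s))) := by
        have : Real.exp (l * s) = Real.exp (l * t) * Real.exp (-l * (t - s)) := by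
          rw [← Real.exp_add]; ring_nf
        rw [this]; ring

/-- Local existence by contraction, on a time interval that depends on the inhomogeneity `h` only
through a bound for its norm. -/
lemma exists_solution [CompleteSpace X] (hN : VolterraKernel Nl κ L) {M δ₀ : ℝ} (hM : 0 ≤ M)
    (hδ₀ : 0 < δ₀) :
    ∃ δ, 0 < δ ∧ δ ≤ δ₀ ∧ ∀ h : ℝ → X, ContinuousOn h (Icc 0 δ) → (∀ t ∈ Icc 0 δ, ‖h t‖ ≤ M) →
      ∃ v, IsVolterraSolution Nl h (Icc 0 δ) v := by
  set R := M + 1 with hR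
  have hR1 : 1 ≤ R := by linarith
  have hL := hN.lip_nonneg R (by linarith)
  -- `2 L(R) R ∫ κ ≤ 1` gives invariance of the ball of radius `R` and the contraction constant `1/2`.
  obtain ⟨δ, hδ, hδδ, hκ⟩ := hN.exists_pos_integral_le
    (ε := 1 / (2 * (L R + 1) * R)) (by positivity) hδ₀
  refine ⟨δ, hδ, hδδ, fun h hh hhM => ?_⟩
  have hsmall : ∀ t ∈ Icc 0 δ, L R * (∫ s in (0 : ℝ)..t, κ s) * R ≤ 1 / 2 := by
    intro t ht
    calc L R * (∫ s in (0 : ℝ)..t, κ s) * R ≤ L R * (1 / (2 * (L R + 1) * R)) * R := by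
          gcongr; exact hκ t ht
      _ = (L R / (L R + 1)) / 2 := by field_simp
      _ ≤ 1 / 2 := by
          gcongr; rw [div_le_one (by linarith)]; linarith
  have key : ∀ (u v : ℝ → X) (m : ℝ), ContinuousOn u (Icc 0 δ) → ContinuousOn v (Icc 0 δ) →
      (∀ s ∈ Icc 0 δ, ‖u s‖ ≤ R) → (∀ s ∈ Icc 0 δ, ‖v s‖ ≤ R) →
      (∀ s ∈ Icc 0 δ, ‖u s - v s‖ ≤ m) → ∀ t ∈ Icc 0 δ,
      ‖(∫ s in (0 : ℝ)..t, Nl (t - s) (u s)) - ∫ s in (0 : ℝ)..t, Nl (t - s) (v s)‖ * R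
        ≤ m / 2 := by
    intro u v m hu hv huR hvR huv t ht
    have hsub : Icc 0 t ⊆ Icc 0 δ := Icc_subset_Icc_right ht.2
    have h1 := hN.norm_duhamel_sub_le (l := 0) (m := m) ht.1 (hu.mono hsub) (hv.mono hsub)
      (fun s hs => huR s (hsub hs)) (fun s hs => hvR s (hsub hs))
      (fun s hs => by simpa using huv s (hsub hs))
    simp only [zero_mul, Real.exp_zero, neg_zero, mul_one] at h1
    have hm : 0 ≤ m := (norm_nonneg _).trans (huv t ht)
    calc _ ≤ L R * m * (∫ s in (0 : ℝ)..t, κ s) * R := by gcongr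
      _ = (L R * (∫ s in (0 : ℝ)..t, κ s) * R) * m := by ring
      _ ≤ 1 / 2 * m := by gcongr; exact hsmall t ht
      _ = m / 2 := by ring
  let E := C(Icc (0 : ℝ) δ, X)
  have hext : ∀ f : E, Continuous (IccExtend hδ.le f) := fun f => f.continuous.Icc_extend'
  have hcont : ∀ f : E, ContinuousOn
      (fun t => h t + ∫ s in (0 : ℝ)..t, Nl (t - s) (IccExtend hδ.le f s)) (Icc 0 δ) :=
    fun f => hh.add (hN.continuousOn_duhamel (hext f).continuousOn)
  let Φ : E → E := fun f => ⟨_, continuousOn_iff_continuous_domRestrict.1 (hcont f)⟩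
  have hΦ : ∀ (f : E) (t : Icc (0 : ℝ) δ), Φ f t
      = h t + ∫ s in (0 : ℝ)..t, Nl (t - s) (IccExtend hδ.le f s) := fun f t => rfl
  have hball : ∀ f : E, f ∈ Metric.closedBall (0 : E) R → ∀ s, ‖IccExtend hδ.le f s‖ ≤ R := by
    intro f hf s
    rw [mem_closedBall_zero_iff] at hf
    exact (f.norm_coe_le_norm _).trans hf
  have hmaps : MapsTo Φ (Metric.closedBall 0 R) (Metric.closedBall 0 R) := by
    intro f hf
    rw [mem_closedBall_zero_iff, ContinuousMap.norm_le _ (by linarith)]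
    intro t
    rw [hΦ]
    have h2 := key (IccExtend hδ.le f) (fun _ => 0) R (hext f).continuousOn continuousOn_const
      (fun s _ => hball f hf s) (fun s _ => by simp; linarith)
      (fun s _ => by simpa using hball f hf s) t t.2
    have h3 : ∫ s in (0 : ℝ)..t, Nl (t - s) (0 : X) = 0 := by
      refine intervalIntegral.integral_zero_ae ?_
      filter_upwards [Measure.ae_ne volume (t : ℝ)] with s hst hs
      rw [uIoc_of_le t.2.1] at hs
      exact hN.map_zero _ (sub_pos.2 (lt_of_le_of_ne hs.2 hst))
    rw [h3, sub_zero] at h2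
    have h4 : ‖∫ s in (0 : ℝ)..t, Nl (t - s) (IccExtend hδ.le f s)‖ ≤ 1 := by nlinarith
    exact (norm_add_le _ _).trans (add_le_add (hhM t t.2) h4)
  have hlip : ContractingWith (1 / 2) (hmaps.restrict Φ _ _) := by
    refine ⟨by rw [← NNReal.coe_lt_coe]; norm_num, LipschitzWith.of_dist_le_mul fun f g => ?_⟩
    rw [Subtype.dist_eq, Subtype.dist_eq, MapsTo.val_restrict_apply, MapsTo.val_restrict_apply,
      ContinuousMap.dist_le (by positivity)]
    intro t
    have h2 := key (IccExtend hδ.le f.1) (IccExtend hδ.le g.1) (dist f.1 g.1)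
      (hext _).continuousOn (hext _).continuousOn (fun s _ => hball _ f.2 s)
      (fun s _ => hball _ g.2 s) (fun s _ => by
        rw [← dist_eq_norm]; exact ContinuousMap.dist_apply_le_dist _) t t.2
    rw [hΦ, hΦ, dist_add_left, dist_eq_norm]
    have h5 : ((1 / 2 : NNReal) : ℝ) = 1 / 2 := by norm_num
    rw [h5]
    have h6 := norm_nonneg ((∫ s in (0 : ℝ)..t, Nl (t - s) (IccExtend hδ.le f.1 s))
      - ∫ s in (0 : ℝ)..t, Nl (t - s) (IccExtend hδ.le g.1 s))
    nlinarith
  obtain ⟨f, -, hf, -⟩ := hlip.exists_fixedPoint' Metric.isClosed_closedBall.isComplete hmaps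
    (x := 0) (by simp; linarith) (edist_ne_top _ _)
  refine ⟨IccExtend hδ.le f, (hext f).continuousOn, fun t ht => ?_⟩
  rw [IccExtend_of_mem hδ.le _ ht]
  exact (DFunLike.congr_fun hf.symm ⟨t, ht⟩).trans (hΦ f ⟨t, ht⟩)

lemma solution_unique (hN : VolterraKernel Nl κ L) {h u v : ℝ → X} {T : ℝ}
    (hu : IsVolterraSolution Nl h (Icc 0 T) u) (hv : IsVolterraSolution Nl h (Icc 0 T) v) :
    EqOn u v (Icc 0 T) := by
  rcases lt_or_ge T 0 with hT | hT
  · rw [Icc_eq_empty (by linarith)]; exact fun _ hx => hx.elim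
  obtain ⟨R₁, h10, hR₁⟩ := exists_norm_le hu.1
  obtain ⟨R₂, -, hR₂⟩ := exists_norm_le hv.1
  set R := max R₁ R₂
  have hL := hN.lip_nonneg R (h10.trans (le_max_left _ _))
  obtain ⟨l, hl⟩ := hN.exists_weight hT (ε := 1 / (2 * (L R + 1))) (by positivity)
  have hc : ContinuousOn (fun t => ‖u t - v t‖ * Real.exp (-l * t)) (Icc 0 T) :=
    (hu.1.sub hv.1).norm.mul (by fun_prop)
  obtain ⟨t, ht, hmax⟩ := isCompact_Icc.exists_isMaxOn ⟨0, le_rfl, hT⟩ hc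
  set m := ‖u t - v t‖ * Real.exp (-l * t) with hm
  have hexp : ∀ s : ℝ, Real.exp (-l * s) * Real.exp (l * s) = 1 := fun s => by
    rw [← Real.exp_add]; simp
  have hbd : ∀ s ∈ Icc 0 T, ‖u s - v s‖ ≤ m * Real.exp (l * s) := by
    intro s hs
    have h1 : ‖u s - v s‖ * Real.exp (-l * s) ≤ m := hmax hs
    calc ‖u s - v s‖ = ‖u s - v s‖ * Real.exp (-l * s) * Real.exp (l * s) := by
          rw [mul_assoc, hexp, mul_one]
      _ ≤ _ := by gcongr
  have hsub : Icc 0 t ⊆ Icc 0 T := Icc_subset_Icc_right ht.2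
  have h1 := hN.norm_duhamel_sub_le ht.1 (hu.1.mono hsub) (hv.1.mono hsub)
    (fun s hs => (hR₁ s (hsub hs)).trans (le_max_left R₁ R₂))
    (fun s hs => (hR₂ s (hsub hs)).trans (le_max_right R₁ R₂)) (fun s hs => hbd s (hsub hs))
  have h2 : u t - v t = (∫ s in (0 : ℝ)..t, Nl (t - s) (u s))
      - ∫ s in (0 : ℝ)..t, Nl (t - s) (v s) := by
    rw [hu.2 t ht, hv.2 t ht]; abel
  rw [← h2] at h1
  have hm0 : 0 ≤ m := by positivity
  have hmm : m ≤ m / 2 := by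
    calc m ≤ L R * m * Real.exp (l * t) * (∫ s in (0 : ℝ)..t, κ s * Real.exp (-l * s))
          * Real.exp (-l * t) := by rw [hm]; gcongr
      _ = L R * m * (∫ s in (0 : ℝ)..t, κ s * Real.exp (-l * s))
          * (Real.exp (-l * t) * Real.exp (l * t)) := by ring
      _ ≤ L R * m * (1 / (2 * (L R + 1))) * (Real.exp (-l * t) * Real.exp (l * t)) := by
          gcongr; exact hl t ht
      _ = (L R / (L R + 1)) * (m / 2) := by rw [hexp]; field_simp
      _ ≤ 1 * (m / 2) := by
          gcongr; rw [div_le_one (by linarith)]; linarith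
      _ = m / 2 := one_mul _
  have hm1 : m = 0 := by linarith
  intro s hs
  have := hbd s hs
  rw [hm1, zero_mul] at this
  exact sub_eq_zero.1 (norm_le_zero_iff.1 this)

end VolterraKernel

/-! ### Continuation of solutions and the blow-up alternative -/

/-- A bounded strongly continuous family `S t`, `t ≥ 0`, with `S 0 = 1`, that shifts the time argument
of the kernel: `S t (Nl r x) = Nl (t + r) x`. This is what lets a Volterra equation be restarted. -/
structure IsShiftSemigroup {X : Type*} [NormedAddCommGroup X] [NormedSpace ℝ X] (Nl : ℝ → X → X)
    (S : ℝ → X →L[ℝ] X) (M : ℝ) : Prop where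
  map_zero : S 0 = 1
  norm_le : ∀ t, 0 ≤ t → ‖S t‖ ≤ M
  continuousOn : ∀ x, ContinuousOn (fun t => S t x) (Ici 0)
  map_kernel : ∀ t r x, 0 ≤ t → 0 < r → S t (Nl r x) = Nl (t + r) x

section Continuation

variable {X : Type*} [NormedAddCommGroup X] [NormedSpace ℝ X] {Nl : ℝ → X → X} {κ L : ℝ → ℝ}
  {S : ℝ → X →L[ℝ] X} {M : ℝ} {h : ℝ → X}

lemma IsVolterraSolution.mono {I J : Set ℝ} {v : ℝ → X} (hv : IsVolterraSolution Nl h I v)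
    (hJI : J ⊆ I) : IsVolterraSolution Nl h J v :=
  ⟨hv.1.mono hJI, fun t ht => hv.2 t (hJI ht)⟩

lemma IsVolterraSolution.congr {I : Set ℝ} {u v : ℝ → X} (hv : IsVolterraSolution Nl h I v)
    (hI : ∀ t ∈ I, Icc 0 t ⊆ I) (hI0 : I ⊆ Ici 0) (huv : EqOn u v I) :
    IsVolterraSolution Nl h I u := by
  refine ⟨hv.1.congr huv, fun t ht => ?_⟩
  rw [huv ht, hv.2 t ht]
  congr 1
  refine intervalIntegral.integral_congr fun s hs => ?_
  rw [uIcc_of_le (hI0 ht)] at hs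
  simp only [huv (hI t ht hs)]

/-- Two solutions, on `[0, T₀]` and from `T₀` on, glue to a solution. The inhomogeneity of the restarted
equation carries the history before `T₀` through the semigroup. -/
lemma IsVolterraSolution.glue [CompleteSpace X] (hN : VolterraKernel Nl κ L)
    (hS : IsShiftSemigroup Nl S M)
    {T₀ δ : ℝ} (hT₀ : 0 ≤ T₀) (hδ : 0 ≤ δ) {u v : ℝ → X} (hu : IsVolterraSolution Nl h (Icc 0 T₀) u)
    (hv : IsVolterraSolution Nl (fun t => h (T₀ + t) + S t (u T₀ - h T₀)) (Icc 0 δ) v) :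
    IsVolterraSolution Nl h (Icc 0 (T₀ + δ)) (fun t => if t ≤ T₀ then u t else v (t - T₀)) := by
  set w : ℝ → X := fun t => if t ≤ T₀ then u t else v (t - T₀) with hw
  have hwu : ∀ t, t ≤ T₀ → w t = u t := fun t ht => if_pos ht
  have hv0 : v 0 = u T₀ := by
    rw [hv.2 0 ⟨le_rfl, hδ⟩]
    simp [hS.map_zero]
  have hwv : ∀ t, T₀ ≤ t → w t = v (t - T₀) := by
    intro t ht
    rcases ht.eq_or_lt with rfl | ht
    · rw [hwu _ le_rfl, sub_self, hv0]
    · exact if_neg (not_le.2 ht)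
  have hc2 : ContinuousOn w (Icc T₀ (T₀ + δ)) := by
    refine ContinuousOn.congr (f := fun t => v (t - T₀)) ?_ fun t ht => hwv t ht.1
    refine hv.1.comp (by fun_prop) fun t ht => ⟨by linarith [ht.1], by linarith [ht.2]⟩
  have hc : ContinuousOn w (Icc 0 (T₀ + δ)) := by
    rw [← Icc_union_Icc_eq_Icc hT₀ (by linarith : T₀ ≤ T₀ + δ)]
    exact (hu.1.congr fun t ht => hwu t ht.2).union_of_isClosed hc2 isClosed_Icc isClosed_Icc
  refine ⟨hc, fun t ht => ?_⟩
  rcases le_or_gt t T₀ with htT | htT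
  · rw [hwu t htT, hu.2 t ⟨ht.1, htT⟩]
    congr 1
    refine intervalIntegral.integral_congr fun s hs => ?_
    rw [uIcc_of_le ht.1] at hs
    simp only [hwu s (hs.2.trans htT)]
  · have i1 : IntervalIntegrable (fun s => Nl (t - s) (w s)) volume 0 T₀ :=
      hN.intervalIntegrable_duhamel le_rfl hT₀ htT.le
        (hc.mono (Icc_subset_Icc_right (by linarith)))
    have i2 : IntervalIntegrable (fun s => Nl (t - s) (w s)) volume T₀ t :=
      hN.intervalIntegrable_duhamel hT₀ htT.le le_rfl
        (hc.mono (Icc_subset_Icc hT₀ ht.2))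
    have e1 : ∫ s in (0 : ℝ)..T₀, Nl (t - s) (w s) = S (t - T₀) (u T₀ - h T₀) := by
      have : u T₀ - h T₀ = ∫ s in (0 : ℝ)..T₀, Nl (T₀ - s) (u s) := by
        rw [hu.2 T₀ ⟨hT₀, le_rfl⟩]; abel
      rw [this, ← ContinuousLinearMap.intervalIntegral_comp_comm _
        (hN.intervalIntegrable_duhamel le_rfl hT₀ le_rfl hu.1)]
      refine intervalIntegral.integral_congr_ae ?_
      filter_upwards [Measure.ae_ne volume T₀] with s hsT hs
      rw [uIoc_of_le hT₀] at hs
      rw [hS.map_kernel _ _ _ (by linarith) (sub_pos.2 (lt_of_le_of_ne hs.2 hsT)), hwu s hs.2]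
      congr 1; ring
    have e2 : ∫ s in T₀..t, Nl (t - s) (w s)
        = ∫ s in (0 : ℝ)..(t - T₀), Nl (t - T₀ - s) (v s) := by
      have := intervalIntegral.integral_comp_sub_right (fun s => Nl (t - T₀ - s) (v s)) T₀
        (a := T₀) (b := t)
      rw [sub_self] at this
      rw [← this]
      refine intervalIntegral.integral_congr fun s hs => ?_
      rw [uIcc_of_le htT.le] at hs
      simp only [hwv s hs.1]
      congr 1; ring
    rw [← intervalIntegral.integral_add_adjacent_intervals i1 i2, e1, e2, hwv t htT.le,
      hv.2 (t - T₀) ⟨by linarith, by linarith [ht.2]⟩]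
    simp only [add_sub_cancel, add_assoc]

/-- A solution on `[0, T₀]` extends by a time that depends only on bounds for `T₀` and for the norm
of its final value. -/
lemma VolterraKernel.exists_extension [CompleteSpace X] (hN : VolterraKernel Nl κ L)
    (hS : IsShiftSemigroup Nl S M) (hh : ContinuousOn h (Ici 0)) (A τ : ℝ) :
    ∃ δ, 0 < δ ∧ ∀ T₀ ∈ Icc 0 τ, ∀ u, IsVolterraSolution Nl h (Icc 0 T₀) u → ‖u T₀‖ ≤ A →
      ∃ v, IsVolterraSolution Nl h (Icc 0 (T₀ + δ)) v := by
  obtain ⟨H, hH0, hH⟩ := VolterraKernel.exists_norm_le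
    (hh.mono (Icc_subset_Ici_self : Icc 0 (τ + 1) ⊆ Ici 0))
  have hM : 0 ≤ M := (norm_nonneg _).trans (hS.norm_le 0 le_rfl)
  obtain ⟨δ, hδ, hδ1, hsol⟩ := hN.exists_solution (M := H + M * (|A| + H)) (by positivity) one_pos
  refine ⟨δ, hδ, fun T₀ hT₀ u hu huA => ?_⟩
  suffices H : ∃ v, IsVolterraSolution Nl (fun t => h (T₀ + t) + S t (u T₀ - h T₀)) (Icc 0 δ) v by
    obtain ⟨v, hv⟩ := H
    exact ⟨_, hu.glue hN hS hT₀.1 hδ.le hv⟩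
  refine hsol _ ?_ ?_
  · refine ContinuousOn.add (hh.comp (by fun_prop) fun t ht => add_nonneg hT₀.1 ht.1) ?_
    exact (hS.continuousOn _).mono Icc_subset_Ici_self
  · intro t ht
    refine (norm_add_le _ _).trans (add_le_add (hH _ ⟨add_nonneg hT₀.1 ht.1, ?_⟩) ?_)
    · linarith [hT₀.2, ht.2]
    · refine ((S t).le_opNorm _).trans (mul_le_mul (hS.norm_le t ht.1) ?_ (norm_nonneg _) hM)
      refine (norm_sub_le _ _).trans (add_le_add (huA.trans (le_abs_self A)) (hH _ ⟨hT₀.1, ?_⟩))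
      linarith [hT₀.2]

/-- Well-posedness of the Volterra equation: local existence, a maximal solution that contains every
other one, and blow-up of the norm at a finite maximal time. -/
theorem VolterraKernel.maximal_solution [CompleteSpace X] (hN : VolterraKernel Nl κ L)
    (hS : IsShiftSemigroup Nl S M) (hh : ContinuousOn h (Ici 0)) (Tm : EReal)
    (hTm : Tm = sSup {τ : EReal | ∃ T : ℝ, 0 < T ∧ τ = (T : EReal) ∧
      ∃ v, IsVolterraSolution Nl h (Icc 0 T) v}) :
    (∃ T, 0 < T ∧ ∃ u, IsVolterraSolution Nl h (Icc 0 T) u) ∧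
    ∃ u, IsVolterraSolution Nl h {t : ℝ | 0 ≤ t ∧ (t : EReal) < Tm} u ∧
      (∀ T : ℝ, 0 < T → ∀ v, IsVolterraSolution Nl h (Icc 0 T) v →
        (T : EReal) < Tm ∧ EqOn v u (Icc 0 T)) ∧
      (Tm < ⊤ → Tendsto (fun t => ‖u t‖) (𝓝[<] Tm.toReal) atTop) := by
  have hle : ∀ T : ℝ, 0 < T → ∀ v, IsVolterraSolution Nl h (Icc 0 T) v → (T : EReal) ≤ Tm :=
    fun T hT v hv => hTm ▸ le_sSup ⟨T, hT, rfl, v, hv⟩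
  have hlt : ∀ T : ℝ, 0 < T → ∀ v, IsVolterraSolution Nl h (Icc 0 T) v → (T : EReal) < Tm := by
    intro T hT v hv
    obtain ⟨δ, hδ, hext⟩ := hN.exists_extension hS hh ‖v T‖ T
    obtain ⟨v', hv'⟩ := hext T ⟨hT.le, le_rfl⟩ v hv le_rfl
    exact lt_of_lt_of_le (EReal.coe_lt_coe (by linarith)) (hle _ (by linarith) v' hv')
  have hlocal : ∃ T, 0 < T ∧ ∃ u, IsVolterraSolution Nl h (Icc 0 T) u := by
    obtain ⟨H, hH0, hH⟩ := VolterraKernel.exists_norm_le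
      (hh.mono (Icc_subset_Ici_self : Icc 0 (1 : ℝ) ⊆ Ici 0))
    obtain ⟨δ, hδ, hδ1, hsol⟩ := hN.exists_solution hH0 one_pos
    exact ⟨δ, hδ, hsol h (hh.mono Icc_subset_Ici_self)
      fun t ht => hH t ⟨ht.1, ht.2.trans hδ1⟩⟩
  have hex : ∀ t : ℝ, (t : EReal) < Tm → ∃ T : ℝ, t < T ∧ 0 < T ∧
      ∃ v, IsVolterraSolution Nl h (Icc 0 T) v := by
    intro t ht
    rw [hTm, lt_sSup_iff] at ht
    obtain ⟨_, ⟨T, hT, rfl, v, hv⟩, htT⟩ := ht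
    exact ⟨T, EReal.coe_lt_coe_iff.1 htT, hT, v, hv⟩
  choose! T' htT' hT' V hV using hex
  set u : ℝ → X := fun t => V t t with hu
  have huv : ∀ T : ℝ, 0 < T → ∀ v, IsVolterraSolution Nl h (Icc 0 T) v → EqOn u v (Icc 0 T) := by
    intro T hT v hv t ht
    have htm : (t : EReal) < Tm := lt_of_le_of_lt (EReal.coe_le_coe ht.2) (hlt T hT v hv)
    exact hN.solution_unique ((hV t htm).mono (Icc_subset_Icc_right (htT' t htm).le))
      (hv.mono (Icc_subset_Icc_right ht.2)) ⟨ht.1, le_rfl⟩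
  have husol : IsVolterraSolution Nl h {t : ℝ | 0 ≤ t ∧ (t : EReal) < Tm} u := by
    have hloc : ∀ t : ℝ, 0 ≤ t → (t : EReal) < Tm →
        IsVolterraSolution Nl h (Icc 0 (T' t)) u := fun t _ htm =>
      (hV t htm).congr (fun s hs => Icc_subset_Icc_right hs.2) Icc_subset_Ici_self
        (huv _ (hT' t htm) _ (hV t htm))
    refine ⟨fun t ht => ?_, fun t ht => (hloc t ht.1 ht.2).2 t ⟨ht.1, (htT' t ht.2).le⟩⟩
    refine ((hloc t ht.1 ht.2).1 t ⟨ht.1, (htT' t ht.2).le⟩).mono_of_mem_nhdsWithin ?_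
    filter_upwards [self_mem_nhdsWithin, mem_nhdsWithin_of_mem_nhds (gt_mem_nhds (htT' t ht.2))]
      with s hs hs'
    exact ⟨hs.1, le_of_lt hs'⟩
  refine ⟨hlocal, u, husol, fun T hT v hv => ⟨hlt T hT v hv, (huv T hT v hv).symm⟩, fun htop => ?_⟩
  obtain ⟨T₁, hT₁, v₁, hv₁⟩ := hlocal
  have hTm1 := hlt T₁ hT₁ v₁ hv₁
  have hreal : ((Tm.toReal : ℝ) : EReal) = Tm :=
    EReal.coe_toReal htop.ne (ne_bot_of_gt hTm1)
  set τ := Tm.toReal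
  have hτ : 0 < τ := by
    rw [← hreal, EReal.coe_lt_coe_iff] at hTm1
    linarith
  by_contra hnot
  rw [tendsto_atTop] at hnot
  push Not at hnot
  obtain ⟨A, hA⟩ := hnot
  obtain ⟨δ, hδ, hext⟩ := hN.exists_extension hS hh A τ
  have hnear : ∀ᶠ t in 𝓝[<] τ, max 0 (τ - δ) < t ∧ t < τ := by
    filter_upwards [self_mem_nhdsWithin, mem_nhdsWithin_of_mem_nhds
      (lt_mem_nhds (max_lt hτ (by linarith : τ - δ < τ)))] with t h1 h2
    exact ⟨h2, h1⟩
  obtain ⟨t, htA, ht1, ht2⟩ := (hA.and_eventually hnear).exists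
  have ht0 : 0 < t := (le_max_left _ _).trans_lt ht1
  have htsol : IsVolterraSolution Nl h (Icc 0 t) u := husol.mono fun s hs =>
    ⟨hs.1, by rw [← hreal]; exact EReal.coe_lt_coe (hs.2.trans_lt ht2)⟩
  obtain ⟨v, hv⟩ := hext t ⟨ht0.le, ht2.le⟩ u htsol htA.le
  have := hle (t + δ) (by linarith) v hv
  rw [← hreal, EReal.coe_le_coe_iff] at this
  linarith [(le_max_right 0 (τ - δ)).trans_lt ht1]

end Continuation

/-! ### The symbol of the semigroup -/

/-- The symbol `exp (-t (2π‖ξ‖)^{2d})` of `e^{-t(-Δ)^d}`. -/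
noncomputable def heatSymbol (N : ℕ) (d t : ℝ) (ξ : EuclideanSpace ℝ (Fin N)) : ℝ :=
  Real.exp (-t * (2 * Real.pi * ‖ξ‖) ^ (2 * d))

section Symbol

variable {N : ℕ} {d t : ℝ}

lemma heatSymbol_pos (ξ : EuclideanSpace ℝ (Fin N)) : 0 < heatSymbol N d t ξ := Real.exp_pos _

lemma heatSymbol_le_one (ht : 0 ≤ t) (ξ : EuclideanSpace ℝ (Fin N)) : heatSymbol N d t ξ ≤ 1 := by
  rw [heatSymbol, Real.exp_le_one_iff, neg_mul, neg_nonpos]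
  positivity

lemma heatSymbol_neg (ξ : EuclideanSpace ℝ (Fin N)) :
    heatSymbol N d t (-ξ) = heatSymbol N d t ξ := by
  simp [heatSymbol]

lemma heatSymbol_zero (hd : 0 < d) : heatSymbol N d t 0 = 1 := by
  simp [heatSymbol, Real.zero_rpow (by positivity : 2 * d ≠ 0)]

lemma heatSymbol_mul (a b : ℝ) (ξ : EuclideanSpace ℝ (Fin N)) :
    heatSymbol N d a ξ * heatSymbol N d b ξ = heatSymbol N d (a + b) ξ := by
  rw [heatSymbol, heatSymbol, heatSymbol, ← Real.exp_add]; ring_nf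

lemma continuous_heatSymbol (hd : 0 < d) : Continuous (heatSymbol N d t) := by
  unfold heatSymbol
  refine Real.continuous_exp.comp (continuous_const.mul ?_)
  exact (continuous_const.mul continuous_norm).rpow_const fun _ => Or.inr (by positivity)

lemma integrable_heatSymbol [NeZero N] (hd : 0 < d) (ht : 0 < t) :
    Integrable (heatSymbol N d t) := by
  have h := (integrable_fun_norm_addHaar (volume : Measure (EuclideanSpace ℝ (Fin N)))
    (f := fun r : ℝ => Real.exp (-t * (2 * Real.pi * r) ^ (2 * d)))).2 ?_
  · exact h
  · have h1 := integrableOn_rpow_mul_exp_neg_mul_rpow (p := 2 * d) (s := (N - 1 : ℕ))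
      (b := t * (2 * Real.pi) ^ (2 * d)) (by
        have : (0 : ℝ) ≤ ((N - 1 : ℕ) : ℝ) := Nat.cast_nonneg _
        linarith) (by positivity) (by positivity)
    refine h1.congr_fun (fun r hr => ?_) measurableSet_Ioi
    have hr : (0 : ℝ) < r := hr
    simp only [finrank_euclideanSpace, Fintype.card_fin, smul_eq_mul, Real.rpow_natCast]
    rw [Real.mul_rpow (by positivity) hr.le]
    ring_nf

lemma integrable_heatSymbol_ofReal [NeZero N] (hd : 0 < d) (ht : 0 < t) :
    Integrable (fun ξ => (heatSymbol N d t ξ : ℂ)) :=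
  (integrable_heatSymbol hd ht).ofReal

lemma fourierInv_heatSymbol_conj (x : EuclideanSpace ℝ (Fin N)) :
    (starRingEnd ℂ) (𝓕⁻ (fun ξ => (heatSymbol N d t ξ : ℂ)) x)
      = 𝓕⁻ (fun ξ => (heatSymbol N d t ξ : ℂ)) x := by
  rw [Real.fourierInv_eq', ← integral_conj, ← integral_neg_eq_self]
  refine integral_congr_ae (Eventually.of_forall fun ξ => ?_)
  simp only [smul_eq_mul, map_mul, Complex.conj_ofReal, heatSymbol_neg, ← Complex.exp_conj,
    inner_neg_left, mul_neg, Complex.ofReal_neg, neg_mul]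
  rw [map_neg, map_mul, Complex.conj_ofReal, Complex.conj_I, mul_neg, neg_neg]

/-- The symbol is even, so its inverse Fourier transform is real. -/
lemma ofReal_polyHeatKernel (x : EuclideanSpace ℝ (Fin N)) :
    (polyHeatKernel N d t x : ℂ) = 𝓕⁻ (fun ξ => (heatSymbol N d t ξ : ℂ)) x :=
  Complex.conj_eq_iff_re.1 (fourierInv_heatSymbol_conj x)

lemma polyHeatKernel_eq_integral [NeZero N] (hd : 0 < d) (ht : 0 < t)
    (x : EuclideanSpace ℝ (Fin N)) :
    polyHeatKernel N d t x
      = ∫ ξ, heatSymbol N d t ξ * Real.cos (2 * Real.pi * inner ℝ ξ x) := by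
  have h1 : polyHeatKernel N d t x = (𝓕⁻ (fun ξ => (heatSymbol N d t ξ : ℂ)) x).re := rfl
  have hint : Integrable (fun ξ : EuclideanSpace ℝ (Fin N) =>
      Complex.exp (↑(2 * Real.pi * inner ℝ ξ x) * Complex.I) • (heatSymbol N d t ξ : ℂ)) := by
    refine (integrable_heatSymbol_ofReal hd ht).bdd_mul (c := 1) ?_ ?_
    · exact Continuous.aestronglyMeasurable (by fun_prop)
    · exact Eventually.of_forall fun ξ => (Complex.norm_exp_ofReal_mul_I _).le
  rw [h1, Real.fourierInv_eq', ← RCLike.re_eq_complex_re, ← integral_re hint]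
  refine integral_congr_ae (Eventually.of_forall fun ξ => ?_)
  simp only [smul_eq_mul, RCLike.re_eq_complex_re, Complex.re_mul_ofReal,
    Complex.exp_ofReal_mul_I_re]
  ring

lemma continuous_polyHeatKernel [NeZero N] (hd : 0 < d) (ht : 0 < t) :
    Continuous (polyHeatKernel N d t) := by
  have h := VectorFourier.fourierIntegral_continuous (μ := volume)
    (L := -innerₗ (EuclideanSpace ℝ (Fin N))) Real.continuous_fourierChar
    (by simp only [LinearMap.neg_apply, innerₗ_apply_apply]; fun_prop)
    (integrable_heatSymbol_ofReal (N := N) hd ht)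
  exact Complex.continuous_re.comp h

lemma abs_polyHeatKernel_le [NeZero N] (hd : 0 < d) (ht : 0 < t)
    (x : EuclideanSpace ℝ (Fin N)) :
    |polyHeatKernel N d t x| ≤ ∫ ξ, heatSymbol N d t ξ := by
  rw [polyHeatKernel_eq_integral hd ht, ← Real.norm_eq_abs]
  refine norm_integral_le_of_norm_le (integrable_heatSymbol hd ht)
    (Eventually.of_forall fun ξ => ?_)
  rw [norm_mul, Real.norm_of_nonneg (heatSymbol_pos ξ).le]
  exact mul_le_of_le_one_right (heatSymbol_pos ξ).le (Real.abs_cos_le_one _)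

end Symbol

/-! ### Integrability of the kernel for integer powers -/

section Schwartz

/-- `(1 + r)^k e^{-c r^{2j}}` is bounded for `r ≥ 0`, `j ≥ 1`. -/
lemma exists_one_add_pow_mul_exp_le {c : ℝ} (hc : 0 < c) {j : ℕ} (hj : 1 ≤ j) (k : ℕ) :
    ∃ B, ∀ r : ℝ, 0 ≤ r → (1 + r) ^ k * Real.exp (-c * (r ^ 2) ^ j) ≤ B := by
  refine ⟨k.factorial / c ^ k * Real.exp (2 * c), fun r hr => ?_⟩
  have h1 : r ≤ 1 + (r ^ 2) ^ j := by
    rcases le_total r 1 with h | h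
    · have : 0 ≤ (r ^ 2) ^ j := by positivity
      linarith
    · have : r ^ 2 ≤ (r ^ 2) ^ j := le_self_pow₀ (one_le_pow₀ h) (by lia)
      nlinarith
  have h2 := Real.pow_div_factorial_le_exp (x := c * (1 + r)) (by positivity) k
  rw [div_le_iff₀ (by positivity), mul_pow] at h2
  have h3 : (1 + r) ^ k ≤ k.factorial / c ^ k * Real.exp (c * (1 + r)) := by
    rw [div_mul_eq_mul_div, le_div_iff₀ (by positivity)]
    linarith
  calc (1 + r) ^ k * Real.exp (-c * (r ^ 2) ^ j)
      ≤ (k.factorial / c ^ k * Real.exp (c * (1 + r))) * Real.exp (-c * (r ^ 2) ^ j) := by gcongr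
    _ = k.factorial / c ^ k * Real.exp (c * (1 + r) + -c * (r ^ 2) ^ j) := by
        rw [mul_assoc, ← Real.exp_add]
    _ ≤ _ := by
        gcongr
        nlinarith

/-- `exp (-c‖x‖^{2j})` is a Schwartz function: by the Faà di Bruno bound its derivatives are
polynomially bounded multiples of the function itself. -/
lemma exists_schwartz_exp_neg_norm_pow {V : Type*} [NormedAddCommGroup V] [InnerProductSpace ℝ V]
    {c : ℝ} (hc : 0 < c) {j : ℕ} (hj : 1 ≤ j) :
    ∃ f : SchwartzMap V ℂ, ∀ x, f x = ((Real.exp (-c * (‖x‖ ^ 2) ^ j) : ℝ) : ℂ) := by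
  set g : V → ℝ := fun x => -c * (‖x‖ ^ 2) ^ j with hg
  have hgt : g.HasTemperateGrowth := by
    have h1 := (Function.hasTemperateGrowth_norm_sq V).pow j
    exact (Function.HasTemperateGrowth.const (-c)).mul h1
  have hsmooth : ContDiff ℝ ((⊤ : ℕ∞) : WithTop ℕ∞) (fun x => Real.exp (g x)) := Real.contDiff_exp.comp hgt.1
  refine ⟨⟨fun x => ((Real.exp (g x) : ℝ) : ℂ), ?_, fun k n => ?_⟩, fun x => rfl⟩
  · exact Complex.ofRealCLM.contDiff.comp hsmooth
  · obtain ⟨m, C, hC, hb⟩ := hgt.norm_iteratedFDeriv_le_uniform n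
    obtain ⟨B, hB⟩ := exists_one_add_pow_mul_exp_le hc hj (k + m * n)
    refine ⟨n.factorial * (1 + C) ^ n * B, fun x => ?_⟩
    have e1 : ‖iteratedFDeriv ℝ n (fun x => ((Real.exp (g x) : ℝ) : ℂ)) x‖
        = ‖iteratedFDeriv ℝ n (fun x => Real.exp (g x)) x‖ :=
      Complex.ofRealLI.norm_iteratedFDeriv_comp_left
        (hsmooth.contDiffAt.of_le (by exact_mod_cast le_top)) le_rfl
    have hone : 1 ≤ (1 + ‖x‖) ^ m := one_le_pow₀ (by linarith [norm_nonneg x])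
    have hD : ∀ i, 1 ≤ i → i ≤ n →
        ‖iteratedFDeriv ℝ i g x‖ ≤ ((1 + C) * (1 + ‖x‖) ^ m) ^ i := by
      intro i hi hin
      refine (hb i hin x).trans ?_
      refine le_trans ?_ (le_self_pow₀ (by nlinarith) (by lia))
      gcongr
      linarith
    have e2 := norm_iteratedFDeriv_comp_le (n := n) (N := ((⊤ : ℕ∞) : WithTop ℕ∞)) (g := Real.exp) (f := g) (𝕜 := ℝ)
      Real.contDiff_exp hgt.1 (by exact_mod_cast le_top) x (C := Real.exp (g x)) (fun i _ => by
        rw [norm_iteratedFDeriv_eq_norm_iteratedDeriv, iteratedDeriv_eq_iterate,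
          Real.iter_deriv_exp, Real.norm_of_nonneg (Real.exp_pos _).le]) hD
    rw [e1]
    calc ‖x‖ ^ k * ‖iteratedFDeriv ℝ n (fun x => Real.exp (g x)) x‖
        ≤ (1 + ‖x‖) ^ k * (n.factorial * Real.exp (g x) * ((1 + C) * (1 + ‖x‖) ^ m) ^ n) := by
          gcongr
          · linarith
          · exact e2
      _ = n.factorial * (1 + C) ^ n * ((1 + ‖x‖) ^ (k + m * n) * Real.exp (g x)) := by
          rw [mul_pow, ← pow_mul, pow_add]; ring
      _ ≤ _ := by gcongr; exact hB _ (norm_nonneg x)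

lemma integrable_polyHeatKernel_natCast {N : ℕ} {t : ℝ} (ht : 0 < t) {j : ℕ} (hj : 1 ≤ j) :
    Integrable (polyHeatKernel N j t) := by
  obtain ⟨f, hf⟩ := exists_schwartz_exp_neg_norm_pow (V := EuclideanSpace ℝ (Fin N))
    (c := t * ((2 * Real.pi) ^ 2) ^ j) (by positivity) hj
  have h1 : (fun ξ => (heatSymbol N j t ξ : ℂ)) = f := by
    ext ξ
    rw [hf, heatSymbol]
    congr 2
    rw [show (2 * (j : ℝ)) = ((2 * j : ℕ) : ℝ) by push_cast; ring, Real.rpow_natCast, pow_mul,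
      mul_pow, mul_pow]
    ring
  have h2 : Integrable (𝓕⁻ (f : EuclideanSpace ℝ (Fin N) → ℂ)) := by
    rw [← SchwartzMap.fourierInv_coe]
    exact (𝓕⁻ f).integrable
  rw [← h1] at h2
  exact h2.re

end Schwartz

/-! ### Positivity of the kernel for fractional powers -/

/-- Bounded measurable functions `φ` that are of positive type in the weak sense that, for each Gaussian
`e^{-ε‖ξ‖²}`, the product `φ e^{-ε‖ξ‖²}` has a nonnegative inverse Fourier transform (tested on the
cosine part, which suffices for even functions). -/
structure IsGaussianPositive {V : Type*} [NormedAddCommGroup V] [InnerProductSpace ℝ V]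
    [FiniteDimensional ℝ V] [MeasurableSpace V] [BorelSpace V] (φ : V → ℝ) : Prop where
  measurable : Measurable φ
  bounded : ∃ C, ∀ ξ, |φ ξ| ≤ C
  nonneg : ∀ ε, 0 < ε → ∀ x : V,
    0 ≤ ∫ ξ, φ ξ * (Real.exp (-ε * ‖ξ‖ ^ 2) * Real.cos (2 * Real.pi * inner ℝ ξ x))

namespace IsGaussianPositive

lemma norm_mul_cos_le {V : Type*} [NormedAddCommGroup V] [InnerProductSpace ℝ V] {C ε a : ℝ}
    (x ξ : V) (h : |a| ≤ C) :
    ‖a * (Real.exp (-ε * ‖ξ‖ ^ 2) * Real.cos (2 * Real.pi * inner ℝ ξ x))‖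
      ≤ C * Real.exp (-ε * ‖ξ‖ ^ 2) := by
  rw [norm_mul, norm_mul, Real.norm_of_nonneg (Real.exp_pos _).le, Real.norm_eq_abs, Real.norm_eq_abs]
  exact mul_le_mul h (mul_le_of_le_one_right (Real.exp_pos _).le (Real.abs_cos_le_one _))
    (by positivity) ((abs_nonneg a).trans h)

variable {V : Type*} [NormedAddCommGroup V] [InnerProductSpace ℝ V] [FiniteDimensional ℝ V]
  [MeasurableSpace V] [BorelSpace V] {φ ψ : V → ℝ}

lemma integrable_gaussian {ε : ℝ} (hε : 0 < ε) :
    Integrable (fun ξ : V => Real.exp (-ε * ‖ξ‖ ^ 2)) := by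
  have h := (GaussianFourier.integrable_cexp_neg_mul_sq_norm_add (b := (ε : ℂ))
    (by simpa using hε) 0 (0 : V)).norm
  refine h.congr (Eventually.of_forall fun ξ => ?_)
  simp only [Complex.norm_exp, zero_mul, add_zero]
  congr 1
  rw [← Complex.ofReal_neg, ← Complex.ofReal_pow, ← Complex.ofReal_mul, Complex.ofReal_re]

lemma integrable_mul (hφ : IsGaussianPositive φ) {ε : ℝ} (hε : 0 < ε) (x : V) :
    Integrable fun ξ =>
      φ ξ * (Real.exp (-ε * ‖ξ‖ ^ 2) * Real.cos (2 * Real.pi * inner ℝ ξ x)) := by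
  obtain ⟨C, hC⟩ := hφ.bounded
  refine ((integrable_gaussian hε).const_mul C).mono' ?_
    (Eventually.of_forall fun ξ => norm_mul_cos_le x ξ (hC ξ))
  exact (hφ.measurable.mul (by fun_prop)).aestronglyMeasurable

lemma one : IsGaussianPositive (fun _ : V => (1 : ℝ)) := by
  refine ⟨measurable_const, ⟨1, by simp⟩, fun ε hε x => ?_⟩
  have h := fourier_gaussian_innerProductSpace (V := V) (b := (ε : ℂ)) (by simpa using hε) x
  have hint : Integrable (fun v : V => Complex.exp (↑(-2 * Real.pi * inner ℝ v x) * Complex.I) •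
      Complex.exp (-(ε : ℂ) * ‖v‖ ^ 2)) := by
    have h1 := GaussianFourier.integrable_cexp_neg_mul_sq_norm_add (b := (ε : ℂ))
      (by simpa using hε) 0 (0 : V)
    simp only [zero_mul, add_zero] at h1
    refine h1.bdd_mul (c := 1) (Continuous.aestronglyMeasurable (by fun_prop)) ?_
    exact Eventually.of_forall fun ξ => (Complex.norm_exp_ofReal_mul_I _).le
  have h2 := congrArg Complex.re h
  rw [Real.fourier_eq', ← RCLike.re_eq_complex_re, ← integral_re hint] at h2
  have h3 : ∀ v : V, RCLike.re (Complex.exp (↑(-2 * Real.pi * inner ℝ v x) * Complex.I) •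
      Complex.exp (-(ε : ℂ) * ‖v‖ ^ 2))
      = 1 * (Real.exp (-ε * ‖v‖ ^ 2) * Real.cos (2 * Real.pi * inner ℝ v x)) := by
    intro v
    have : Complex.exp (-(ε : ℂ) * ‖v‖ ^ 2) = ((Real.exp (-ε * ‖v‖ ^ 2) : ℝ) : ℂ) := by
      push_cast; rfl
    rw [this, smul_eq_mul, RCLike.re_eq_complex_re, Complex.re_mul_ofReal,
      Complex.exp_ofReal_mul_I_re, neg_mul, neg_mul, Real.cos_neg]
    ring
  simp only [h3] at h2
  rw [h2, RCLike.re_eq_complex_re]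
  have h4 : ((Real.pi : ℂ) / ε) ^ (Module.finrank ℝ V / 2 : ℂ)
      * Complex.exp (-(Real.pi : ℂ) ^ 2 * ‖x‖ ^ 2 / ε)
      = (((Real.pi / ε) ^ (Module.finrank ℝ V / 2 : ℝ)
        * Real.exp (-Real.pi ^ 2 * ‖x‖ ^ 2 / ε) : ℝ) : ℂ) := by
    rw [Complex.ofReal_mul, Complex.ofReal_cpow (by positivity)]
    push_cast
    rfl
  rw [h4, Complex.ofReal_re]
  positivity

lemma add (hφ : IsGaussianPositive φ) (hψ : IsGaussianPositive ψ) :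
    IsGaussianPositive (fun ξ => φ ξ + ψ ξ) := by
  obtain ⟨C, hC⟩ := hφ.bounded
  obtain ⟨D, hD⟩ := hψ.bounded
  refine ⟨hφ.measurable.add hψ.measurable,
    ⟨C + D, fun ξ => (abs_add_le _ _).trans (add_le_add (hC ξ) (hD ξ))⟩, fun ε hε x => ?_⟩
  simp only [add_mul]
  rw [integral_add (hφ.integrable_mul hε x) (hψ.integrable_mul hε x)]
  exact add_nonneg (hφ.nonneg ε hε x) (hψ.nonneg ε hε x)

lemma const_mul (hφ : IsGaussianPositive φ) {c : ℝ} (hc : 0 ≤ c) :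
    IsGaussianPositive (fun ξ => c * φ ξ) := by
  obtain ⟨C, hC⟩ := hφ.bounded
  refine ⟨hφ.measurable.const_mul c, ⟨c * C, fun ξ => ?_⟩, fun ε hε x => ?_⟩
  · rw [abs_mul, abs_of_nonneg hc]
    exact mul_le_mul_of_nonneg_left (hC ξ) hc
  · simp only [mul_assoc c]
    rw [integral_const_mul]
    exact mul_nonneg hc (hφ.nonneg ε hε x)

lemma of_tendsto {F : ℕ → V → ℝ} {C : ℝ} (hF : ∀ n, IsGaussianPositive (F n))
    (hC : ∀ n ξ, |F n ξ| ≤ C) (hlim : ∀ ξ, Tendsto (fun n => F n ξ) atTop (𝓝 (φ ξ))) :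
    IsGaussianPositive φ := by
  refine ⟨measurable_of_tendsto_metrizable (fun n => (hF n).measurable) (tendsto_pi_nhds.2 hlim),
    ⟨C, fun ξ => le_of_tendsto' (hlim ξ).abs fun n => hC n ξ⟩, fun ε hε x => ?_⟩
  refine ge_of_tendsto' (tendsto_integral_of_dominated_convergence
    (fun ξ => C * Real.exp (-ε * ‖ξ‖ ^ 2)) (fun n => ((hF n).integrable_mul hε x).1)
    ((integrable_gaussian hε).const_mul C)
    (fun n => Eventually.of_forall fun ξ => norm_mul_cos_le x ξ (hC n ξ))
    (Eventually.of_forall fun ξ => (hlim ξ).mul_const _)) fun n => (hF n).nonneg ε hε x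

/-- Multiplication by a positive mixture of Gaussians preserves positive type (Fubini). -/
lemma mul_mixture (hφ : IsGaussianPositive φ) {ρ : ℝ → ℝ} {a : ℝ} (ha : 0 ≤ a)
    (hρm : Measurable ρ) (hρ : IntegrableOn ρ (Ioi a)) (hρ0 : ∀ s ∈ Ioi a, 0 ≤ ρ s) :
    IsGaussianPositive (fun ξ => φ ξ * ∫ s in Ioi a, Real.exp (-s * ‖ξ‖ ^ 2) * ρ s) := by
  obtain ⟨C, hC⟩ := hφ.bounded
  have hbd : ∀ ξ : V, ∀ s ∈ Ioi a, ‖Real.exp (-s * ‖ξ‖ ^ 2) * ρ s‖ ≤ ρ s := by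
    intro ξ s hs
    rw [norm_mul, Real.norm_of_nonneg (Real.exp_pos _).le, Real.norm_of_nonneg (hρ0 s hs)]
    refine mul_le_of_le_one_left (hρ0 s hs) (Real.exp_le_one_iff.2 ?_)
    have : (0 : ℝ) ≤ s := ha.trans (le_of_lt hs)
    nlinarith [sq_nonneg ‖ξ‖]
  have hm : Measurable (fun z : V × ℝ => Real.exp (-z.2 * ‖z.1‖ ^ 2) * ρ z.2) := by fun_prop
  refine ⟨?_, ⟨C * ∫ s in Ioi a, ρ s, fun ξ => ?_⟩, fun ε hε x => ?_⟩
  · exact hφ.measurable.mul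
      (hm.stronglyMeasurable.integral_prod_right (ν := volume.restrict (Ioi a))).measurable
  · rw [abs_mul]
    refine mul_le_mul (hC ξ) ?_ (abs_nonneg _) ((abs_nonneg _).trans (hC ξ))
    exact norm_integral_le_of_norm_le hρ
      ((ae_restrict_mem measurableSet_Ioi).mono fun s hs => hbd ξ s hs)
  · set G : V → ℝ → ℝ := fun ξ s => φ ξ * (Real.exp (-s * ‖ξ‖ ^ 2) * ρ s) *
      (Real.exp (-ε * ‖ξ‖ ^ 2) * Real.cos (2 * Real.pi * inner ℝ ξ x)) with hG
    have hGint : Integrable (Function.uncurry G) (volume.prod (volume.restrict (Ioi a))) := by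
      refine (((integrable_gaussian hε).const_mul C).mul_prod hρ).mono' ?_ ?_
      · refine Measurable.aestronglyMeasurable ?_
        exact ((hφ.measurable.comp measurable_fst).mul hm).mul (by fun_prop)
      · have : ∀ᵐ z : V × ℝ ∂(volume.prod (volume.restrict (Ioi a))), z.2 ∈ Ioi a :=
          (Measure.quasiMeasurePreserving_snd (μ := (volume : Measure V))
            (ν := volume.restrict (Ioi a))).ae (ae_restrict_mem measurableSet_Ioi)
        filter_upwards [this] with z hz
        have h1 : Function.uncurry G z = (φ z.1 *
            (Real.exp (-ε * ‖z.1‖ ^ 2) * Real.cos (2 * Real.pi * inner ℝ z.1 x))) *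
            (Real.exp (-z.2 * ‖z.1‖ ^ 2) * ρ z.2) := by
          simp only [Function.uncurry, hG]; ring
        rw [h1, norm_mul]
        exact mul_le_mul (norm_mul_cos_le x _ (hC _)) (hbd _ _ hz) (norm_nonneg _)
          (mul_nonneg ((abs_nonneg _).trans (hC z.1)) (Real.exp_pos _).le)
    have h1 : ∫ ξ, (φ ξ * ∫ s in Ioi a, Real.exp (-s * ‖ξ‖ ^ 2) * ρ s) *
        (Real.exp (-ε * ‖ξ‖ ^ 2) * Real.cos (2 * Real.pi * inner ℝ ξ x))
        = ∫ ξ, ∫ s in Ioi a, G ξ s := by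
      refine integral_congr_ae (Eventually.of_forall fun ξ => ?_)
      simp only [hG]
      rw [integral_mul_const, integral_const_mul]
    rw [h1, integral_integral_swap hGint]
    refine setIntegral_nonneg measurableSet_Ioi fun s hs => ?_
    have hs0 : 0 < s + ε := add_pos_of_nonneg_of_pos (ha.trans (le_of_lt hs)) hε
    have h2 : ∫ ξ, G ξ s = ρ s * ∫ ξ, φ ξ * (Real.exp (-(s + ε) * ‖ξ‖ ^ 2) *
        Real.cos (2 * Real.pi * inner ℝ ξ x)) := by
      rw [← integral_const_mul]
      refine integral_congr_ae (Eventually.of_forall fun ξ => ?_)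
      simp only [hG]
      rw [show -(s + ε) * ‖ξ‖ ^ 2 = -s * ‖ξ‖ ^ 2 + -ε * ‖ξ‖ ^ 2 by ring, Real.exp_add]
      ring
    rw [h2]
    exact mul_nonneg (hρ0 s hs) (hφ.nonneg _ hs0 x)

/-- Exponentials of positive mixtures of Gaussians are of positive type, as limits of
`(1 + b m / n) ^ n`. -/
lemma exp_mixture {ρ : ℝ → ℝ} {a b : ℝ} (ha : 0 ≤ a) (hb : 0 ≤ b)
    (hρm : Measurable ρ) (hρ : IntegrableOn ρ (Ioi a)) (hρ0 : ∀ s ∈ Ioi a, 0 ≤ ρ s) :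
    IsGaussianPositive
      (fun ξ : V => Real.exp (b * ∫ s in Ioi a, Real.exp (-s * ‖ξ‖ ^ 2) * ρ s)) := by
  set m : V → ℝ := fun ξ => ∫ s in Ioi a, Real.exp (-s * ‖ξ‖ ^ 2) * ρ s with hm
  have hm0 : ∀ ξ, 0 ≤ m ξ := fun ξ => setIntegral_nonneg measurableSet_Ioi fun s hs =>
    mul_nonneg (Real.exp_pos _).le (hρ0 s hs)
  obtain ⟨C, hC⟩ := (one (V := V).mul_mixture ha hρm hρ hρ0).bounded
  have hpow : ∀ c : ℝ, 0 ≤ c → ∀ n : ℕ, IsGaussianPositive (fun ξ => (1 + c * m ξ) ^ n) := by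
    intro c hc n
    induction n with
    | zero => simpa using one
    | succ n ih =>
      have := ih.add ((ih.mul_mixture ha hρm hρ hρ0).const_mul hc)
      convert this using 2 with ξ
      simp only [hm, pow_succ]; ring
  refine of_tendsto (F := fun n ξ => (1 + b / n * m ξ) ^ n) (C := Real.exp (b * C))
    (fun n => hpow _ (by positivity) n) (fun n ξ => ?_) fun ξ => ?_
  · have h0 : 0 ≤ b / n * m ξ := mul_nonneg (by positivity) (hm0 ξ)
    rw [abs_of_nonneg (by positivity)]
    have h1 : (1 + b / n * m ξ) ^ n ≤ Real.exp (b / n * m ξ) ^ n := by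
      gcongr
      linarith [Real.add_one_le_exp (b / n * m ξ)]
    refine h1.trans ?_
    rw [← Real.exp_nat_mul, Real.exp_le_exp]
    have hmC : m ξ ≤ C := by
      have := hC ξ
      simp only [one_mul] at this
      exact (le_abs_self _).trans this
    rcases Nat.eq_zero_or_pos n with rfl | hn
    · simp only [Nat.cast_zero, zero_mul]
      exact mul_nonneg hb ((hm0 ξ).trans hmC)
    · have : (n : ℝ) * (b / n * m ξ) = b * m ξ := by field_simp
      rw [this]
      gcongr
  · have := Real.tendsto_one_add_div_pow_exp (b * m ξ)
    refine this.congr fun n => ?_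
    rw [div_mul_eq_mul_div]

/-- Removing the Gaussian regularization. -/
lemma integral_mul_cos_nonneg (hφ : IsGaussianPositive φ) (hint : Integrable φ) (x : V) :
    0 ≤ ∫ ξ, φ ξ * Real.cos (2 * Real.pi * inner ℝ ξ x) := by
  refine ge_of_tendsto' (x := atTop) (f := fun n : ℕ =>
    ∫ ξ, φ ξ * (Real.exp (-(1 / ((n : ℝ) + 1)) * ‖ξ‖ ^ 2) * Real.cos (2 * Real.pi * inner ℝ ξ x)))
    ?_ fun n => hφ.nonneg _ (by positivity) x
  refine tendsto_integral_of_dominated_convergence (fun ξ => |φ ξ|)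
    (fun n => (hφ.integrable_mul (by positivity) x).1) hint.abs (fun n => ?_) ?_
  · refine Eventually.of_forall fun ξ => (norm_mul_cos_le x ξ le_rfl).trans ?_
    refine mul_le_of_le_one_right (abs_nonneg _) (Real.exp_le_one_iff.2 ?_)
    rw [neg_mul, neg_nonpos]
    positivity
  · refine Eventually.of_forall fun ξ => ?_
    have h1 : Tendsto (fun n : ℕ => Real.exp (-(1 / ((n : ℝ) + 1)) * ‖ξ‖ ^ 2)) atTop (𝓝 1) := by
      have := (tendsto_one_div_add_atTop_nhds_zero_nat (𝕜 := ℝ)).neg.mul_const (‖ξ‖ ^ 2)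
      simp only [neg_zero, zero_mul] at this
      have h2 := (Real.continuous_exp.tendsto 0).comp this
      rwa [Real.exp_zero] at h2
    simpa using (h1.mul_const (Real.cos (2 * Real.pi * inner ℝ ξ x))).const_mul (φ ξ)

end IsGaussianPositive

section Subordination

lemma integrableOn_one_sub_exp_mul_rpow {d : ℝ} (hd0 : 0 < d) (hd1 : d < 1) {y : ℝ} (hy : 0 ≤ y) :
    IntegrableOn (fun s : ℝ => (1 - Real.exp (-s * y)) * s ^ (-1 - d)) (Ioi 0) := by
  have hm : Measurable (fun s : ℝ => (1 - Real.exp (-s * y)) * s ^ (-1 - d)) := by fun_prop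
  rw [← Ioc_union_Ioi_eq_Ioi (zero_le_one' ℝ)]
  refine IntegrableOn.union ?_ ?_
  · have h1 : IntegrableOn (fun s : ℝ => s ^ (-d)) (Ioc 0 1) := by
      rw [← intervalIntegrable_iff_integrableOn_Ioc_of_le zero_le_one]
      exact intervalIntegral.intervalIntegrable_rpow' (by linarith)
    refine (h1.const_mul y).mono' hm.aestronglyMeasurable ?_
    filter_upwards [ae_restrict_mem measurableSet_Ioc] with s hs
    have hs0 : 0 < s := hs.1
    have h2 : 0 ≤ 1 - Real.exp (-s * y) := by
      rw [sub_nonneg, Real.exp_le_one_iff]; nlinarith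
    rw [Real.norm_of_nonneg (mul_nonneg h2 (by positivity))]
    have h3 : 1 - Real.exp (-s * y) ≤ y * s := by
      linarith [Real.add_one_le_exp (-s * y)]
    calc (1 - Real.exp (-s * y)) * s ^ (-1 - d) ≤ y * s * s ^ (-1 - d) := by gcongr
      _ = y * s ^ (-d) := by
          rw [mul_assoc, ← Real.rpow_one_add' hs0.le (by linarith)]; ring_nf
  · have h1 : IntegrableOn (fun s : ℝ => s ^ (-1 - d)) (Ioi 1) :=
      integrableOn_Ioi_rpow_of_lt (by linarith) one_pos
    refine h1.mono' hm.aestronglyMeasurable ?_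
    filter_upwards [ae_restrict_mem measurableSet_Ioi] with s hs
    have hs0 : 0 < s := one_pos.trans hs
    have h2 : 0 ≤ 1 - Real.exp (-s * y) := by
      rw [sub_nonneg, Real.exp_le_one_iff]; nlinarith
    rw [Real.norm_of_nonneg (mul_nonneg h2 (by positivity))]
    exact mul_le_of_le_one_left (by positivity) (by linarith [Real.exp_pos (-s * y)])

/-- The Lévy representation of `y ↦ y ^ d` for `0 < d < 1`. -/
lemma exists_rpow_eq_integral {d : ℝ} (hd0 : 0 < d) (hd1 : d < 1) :
    ∃ c : ℝ, 0 < c ∧ ∀ y : ℝ, 0 ≤ y →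
      y ^ d = c * ∫ s in Ioi (0 : ℝ), (1 - Real.exp (-s * y)) * s ^ (-1 - d) := by
  set I := ∫ s in Ioi (0 : ℝ), (1 - Real.exp (-s * 1)) * s ^ (-1 - d) with hI
  have hIpos : 0 < I := by
    rw [hI, setIntegral_pos_iff_support_of_nonneg_ae]
    · refine lt_of_lt_of_le ?_ (measure_mono (s := Ioi (0 : ℝ)) fun s hs => ⟨?_, hs⟩)
      · simp
      · have hs : (0 : ℝ) < s := hs
        have : Real.exp (-s * 1) < 1 := by rw [Real.exp_lt_one_iff]; linarith
        exact (mul_pos (by linarith) (by positivity)).ne'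
    · filter_upwards [ae_restrict_mem measurableSet_Ioi] with s hs
      have hs : (0 : ℝ) < s := hs
      have : Real.exp (-s * 1) < 1 := by rw [Real.exp_lt_one_iff]; linarith
      exact mul_nonneg (by linarith) (by positivity)
    · exact integrableOn_one_sub_exp_mul_rpow hd0 hd1 zero_le_one
  refine ⟨I⁻¹, inv_pos.2 hIpos, fun y hy => ?_⟩
  rcases hy.eq_or_lt with rfl | hy
  · simp [Real.zero_rpow hd0.ne']
  have h1 := integral_comp_mul_left_Ioi (fun s : ℝ => (1 - Real.exp (-s * 1)) * s ^ (-1 - d)) 0 hy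
  rw [mul_zero, ← hI] at h1
  have h2 : ∫ s in Ioi (0 : ℝ), (1 - Real.exp (-(y * s) * 1)) * (y * s) ^ (-1 - d)
      = y ^ (-1 - d) * ∫ s in Ioi (0 : ℝ), (1 - Real.exp (-s * y)) * s ^ (-1 - d) := by
    rw [← integral_const_mul]
    refine setIntegral_congr_fun measurableSet_Ioi fun s hs => ?_
    rw [Real.mul_rpow hy.le (le_of_lt hs), show -(y * s) * 1 = -s * y by ring]
    ring
  rw [h2, smul_eq_mul] at h1
  have h3 : ∫ s in Ioi (0 : ℝ), (1 - Real.exp (-s * y)) * s ^ (-1 - d) = y ^ d * I := by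
    have h4 : y ^ (1 + d) * y ^ (-1 - d) = 1 := by
      rw [← Real.rpow_add hy]; simp
    have h5 : y ^ (1 + d) * y⁻¹ = y ^ d := by
      rw [← Real.rpow_neg_one, ← Real.rpow_add hy]; ring_nf
    calc _ = y ^ (1 + d) * (y ^ (-1 - d)
            * ∫ s in Ioi (0 : ℝ), (1 - Real.exp (-s * y)) * s ^ (-1 - d)) := by
          rw [← mul_assoc, h4, one_mul]
      _ = _ := by rw [h1, ← mul_assoc, h5]
  rw [h3]
  field_simp

/-- For `0 < d < 1` the symbol is a limit of exponentials of Gaussian mixtures: truncate the Lévy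
measure `s^{-1-d} ds` near `s = 0`, where its mass is infinite. -/
lemma isGaussianPositive_exp_neg_rpow {V : Type*} [NormedAddCommGroup V] [InnerProductSpace ℝ V]
    [FiniteDimensional ℝ V] [MeasurableSpace V] [BorelSpace V] {d t : ℝ} (hd0 : 0 < d) (hd1 : d < 1)
    (ht : 0 ≤ t) : IsGaussianPositive (fun ξ : V => Real.exp (-t * (‖ξ‖ ^ 2) ^ d)) := by
  obtain ⟨c, hc, hrep⟩ := exists_rpow_eq_integral hd0 hd1
  set a : ℕ → ℝ := fun n => 1 / ((n : ℝ) + 1) with ha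
  have ha0 : ∀ n, 0 < a n := fun n => by positivity
  have hρ : ∀ n, IntegrableOn (fun s : ℝ => s ^ (-1 - d)) (Ioi (a n)) := fun n =>
    integrableOn_Ioi_rpow_of_lt (by linarith) (ha0 n)
  have hρm : Measurable (fun s : ℝ => s ^ (-1 - d)) := by fun_prop
  have hρ0 : ∀ n, ∀ s ∈ Ioi (a n), (0 : ℝ) ≤ s ^ (-1 - d) := fun n s hs =>
    Real.rpow_nonneg ((ha0 n).le.trans (le_of_lt hs)) _
  have hmono : Monotone fun n => Ioi (a n) := fun m n hmn => Ioi_subset_Ioi (by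
    simp only [ha]; gcongr)
  have hunion : ⋃ n, Ioi (a n) = Ioi 0 := by
    ext s
    simp only [mem_iUnion, mem_Ioi]
    exact ⟨fun ⟨n, hn⟩ => (ha0 n).trans hn, fun hs => exists_nat_one_div_lt hs⟩
  set J : ℕ → V → ℝ := fun n ξ => ∫ s in Ioi (a n), (1 - Real.exp (-s * ‖ξ‖ ^ 2)) * s ^ (-1 - d)
    with hJ
  have hJ0 : ∀ n ξ, 0 ≤ J n ξ := fun n ξ => setIntegral_nonneg measurableSet_Ioi fun s hs => by
    have hs0 : 0 < s := (ha0 n).trans hs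
    refine mul_nonneg ?_ (hρ0 n s hs)
    rw [sub_nonneg, Real.exp_le_one_iff]
    nlinarith [sq_nonneg ‖ξ‖]
  refine IsGaussianPositive.of_tendsto (F := fun n ξ => Real.exp (-t * (c * J n ξ))) (C := 1)
    (fun n => ?_) (fun n ξ => ?_) fun ξ => ?_
  · have h1 := (IsGaussianPositive.exp_mixture (V := V) (ha0 n).le (by positivity : 0 ≤ t * c)
      hρm (hρ n) (hρ0 n)).const_mul
      (Real.exp_pos (-(t * c * ∫ s in Ioi (a n), s ^ (-1 - d)))).le
    convert h1 using 2 with ξ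
    rw [← Real.exp_add]
    congr 1
    have h2 : J n ξ = (∫ s in Ioi (a n), s ^ (-1 - d))
        - ∫ s in Ioi (a n), Real.exp (-s * ‖ξ‖ ^ 2) * s ^ (-1 - d) := by
      rw [← integral_sub (hρ n)]
      · simp only [hJ]
        congr 1
        ext s
        ring
      · refine (hρ n).mono' (by fun_prop) ?_
        filter_upwards [ae_restrict_mem measurableSet_Ioi] with s hs
        rw [norm_mul, Real.norm_of_nonneg (Real.exp_pos _).le, Real.norm_of_nonneg (hρ0 n s hs)]
        refine mul_le_of_le_one_left (hρ0 n s hs) (Real.exp_le_one_iff.2 ?_)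
        have hs0 : 0 < s := (ha0 n).trans hs
        nlinarith [sq_nonneg ‖ξ‖]
    rw [h2]
    ring
  · rw [abs_of_pos (Real.exp_pos _), Real.exp_le_one_iff, neg_mul, neg_nonpos]
    exact mul_nonneg ht (mul_nonneg hc.le (hJ0 n ξ))
  · have h1 := tendsto_setIntegral_of_monotone (μ := volume)
      (f := fun s : ℝ => (1 - Real.exp (-s * ‖ξ‖ ^ 2)) * s ^ (-1 - d))
      (fun n => measurableSet_Ioi (a := a n)) hmono
      (by rw [hunion]; exact integrableOn_one_sub_exp_mul_rpow hd0 hd1 (by positivity))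
    rw [hunion] at h1
    rw [hrep (‖ξ‖ ^ 2) (by positivity)]
    exact (Real.continuous_exp.tendsto _).comp ((h1.const_mul c).const_mul (-t))

/-- If the inverse Fourier transform of a bounded integrable function is nonnegative, then it is
integrable: test it against Gaussians and let them flatten. -/
lemma integrable_of_nonneg_of_eq_fourierInv {V : Type*} [NormedAddCommGroup V]
    [InnerProductSpace ℝ V] [FiniteDimensional ℝ V] [MeasurableSpace V] [BorelSpace V]
    {f : V → ℂ} {k : V → ℝ} {C : ℝ} (hf : Integrable f) (hfC : ∀ ξ, ‖f ξ‖ ≤ C) (hk : Continuous k)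
    (hk0 : ∀ x, 0 ≤ k x) (hkf : ∀ x, (k x : ℂ) = 𝓕⁻ f x) : Integrable k := by
  set b : ℕ → ℝ := fun n => 1 / ((n : ℝ) + 1) with hb
  have hb0 : ∀ n, 0 < b n := fun n => by positivity
  set g : ℕ → V → ℂ := fun n x => Complex.exp (-(b n : ℂ) * ‖x‖ ^ 2) with hg
  have hgi : ∀ n, Integrable (g n) := fun n => by
    have h1 := GaussianFourier.integrable_cexp_neg_mul_sq_norm_add (b := (b n : ℂ))
      (by simpa using hb0 n) 0 (0 : V)
    simpa only [zero_mul, add_zero] using h1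
  have hgr : ∀ n x, g n x = ((Real.exp (-b n * ‖x‖ ^ 2) : ℝ) : ℂ) := fun n x => by
    simp only [hg]; push_cast; rfl
  have hFg : ∀ n ξ, 𝓕 (g n) ξ = (((Real.pi / b n) ^ (Module.finrank ℝ V / 2 : ℝ)
      * Real.exp (-(Real.pi ^ 2 / b n) * ‖ξ‖ ^ 2) : ℝ) : ℂ) := by
    intro n ξ
    rw [hg, fourier_gaussian_innerProductSpace (by simpa using hb0 n), Complex.ofReal_mul,
      Complex.ofReal_cpow (by have := hb0 n; positivity)]
    push_cast
    congr 2
    ring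
  have hFgi : ∀ n, ∫ ξ, ‖𝓕 (g n) ξ‖ = 1 := by
    intro n
    have hbn := hb0 n
    have : ∀ ξ, ‖𝓕 (g n) ξ‖ = (Real.pi / b n) ^ (Module.finrank ℝ V / 2 : ℝ)
        * Real.exp (-(Real.pi ^ 2 / b n) * ‖ξ‖ ^ 2) := fun ξ => by
      rw [hFg, Complex.norm_real, Real.norm_of_nonneg (by positivity)]
    simp only [this]
    rw [integral_const_mul, GaussianFourier.integral_rexp_neg_mul_sq_norm (by positivity),
      ← Real.mul_rpow (by positivity) (by positivity)]
    have : Real.pi / b n * (Real.pi / (Real.pi ^ 2 / b n)) = 1 := by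
      have := Real.pi_pos
      field_simp
    rw [this, Real.one_rpow]
  have hkb : ∀ x, ‖k x‖ ≤ ∫ ξ, ‖f ξ‖ := by
    intro x
    rw [← Complex.norm_real, hkf, Real.fourierInv_eq]
    refine (norm_integral_le_integral_norm _).trans (le_of_eq ?_)
    simp only [Circle.norm_smul]
  have hkg : ∀ n, Integrable (fun x => k x * Real.exp (-b n * ‖x‖ ^ 2)) := fun n =>
    (IsGaussianPositive.integrable_gaussian (hb0 n)).bdd_mul hk.aestronglyMeasurable
      (Eventually.of_forall hkb)
  have hval : ∀ n, ∫ x, k x * Real.exp (-b n * ‖x‖ ^ 2) ≤ C := by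
    intro n
    have h1 := VectorFourier.integral_fourierIntegral_smul_eq_flip (μ := volume) (ν := volume)
      (L := -innerₗ V) (f := f) (g := g n) Real.continuous_fourierChar
      (by simp only [LinearMap.neg_apply, innerₗ_apply_apply]; fun_prop) hf (hgi n)
    have h2 : ((∫ x, k x * Real.exp (-b n * ‖x‖ ^ 2) : ℝ) : ℂ) = ∫ ξ, f ξ * 𝓕 (g n) (-ξ) := by
      rw [← integral_complex_ofReal]
      calc _ = ∫ x, (VectorFourier.fourierIntegral Real.fourierChar volume (-innerₗ V) f x)
              • g n x := by
            refine integral_congr_ae (Eventually.of_forall fun x => ?_)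
            simp only [Complex.ofReal_mul, hkf, hgr, smul_eq_mul]
            rfl
        _ = _ := by
            rw [h1]
            refine integral_congr_ae (Eventually.of_forall fun x => ?_)
            simp only [smul_eq_mul]
            congr 1
            rw [Real.fourier_eq, VectorFourier.fourierIntegral]
            simp [real_inner_comm]
    have h3 : ‖((∫ x, k x * Real.exp (-b n * ‖x‖ ^ 2) : ℝ) : ℂ)‖ ≤ C := by
      rw [h2]
      have h4 : ∫ ξ, C * ‖𝓕 (g n) (-ξ)‖ = C := by
        rw [integral_const_mul, integral_neg_eq_self (fun ξ => ‖𝓕 (g n) ξ‖), hFgi, mul_one]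
      conv_rhs => rw [← h4]
      refine norm_integral_le_of_norm_le (Integrable.const_mul ?_ C)
        (Eventually.of_forall fun ξ => ?_)
      · refine Integrable.comp_neg (f := fun ξ => ‖𝓕 (g n) ξ‖) ?_
        by_contra hni
        have := hFgi n
        rw [integral_undef hni] at this
        exact zero_ne_one this
      · rw [norm_mul]
        exact mul_le_mul_of_nonneg_right (hfC ξ) (norm_nonneg _)
    rw [Complex.norm_real] at h3
    exact (le_abs_self _).trans h3
  refine ⟨hk.aestronglyMeasurable, ?_⟩
  have hlim : ∀ x, Tendsto (fun n => ENNReal.ofReal (k x * Real.exp (-b n * ‖x‖ ^ 2))) atTop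
      (𝓝 ‖k x‖ₑ) := by
    intro x
    have h1 : Tendsto (fun n => -b n * ‖x‖ ^ 2) atTop (𝓝 0) := by
      have := (tendsto_one_div_add_atTop_nhds_zero_nat (𝕜 := ℝ)).neg.mul_const (‖x‖ ^ 2)
      simpa only [neg_zero, zero_mul] using this
    have h2 := ((Real.continuous_exp.tendsto 0).comp h1).const_mul (k x)
    rw [Real.exp_zero, mul_one] at h2
    rw [Real.enorm_of_nonneg (hk0 x)]
    exact (ENNReal.continuous_ofReal.tendsto _).comp h2
  have hfatou := lintegral_liminf_le (μ := (volume : Measure V)) (u := atTop)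
    (f := fun n x => ENNReal.ofReal (k x * Real.exp (-b n * ‖x‖ ^ 2)))
    (fun n => (ENNReal.continuous_ofReal.comp (by fun_prop)).measurable)
  simp only [fun x => (hlim x).liminf_eq] at hfatou
  refine lt_of_le_of_lt (hfatou.trans (liminf_le_of_frequently_le'
    (Eventually.of_forall fun n => ?_).frequently)) (ENNReal.ofReal_lt_top (r := C))
  rw [← ofReal_integral_eq_lintegral_ofReal (hkg n)
    (Eventually.of_forall fun x => mul_nonneg (hk0 x) (Real.exp_pos _).le)]
  exact ENNReal.ofReal_le_ofReal (hval n)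

lemma integrable_polyHeatKernel_of_lt_one {N : ℕ} [NeZero N] {d t : ℝ} (hd0 : 0 < d) (hd1 : d < 1)
    (ht : 0 < t) : Integrable (polyHeatKernel N d t) := by
  have hpos : IsGaussianPositive (heatSymbol N d t) := by
    have h := isGaussianPositive_exp_neg_rpow (V := EuclideanSpace ℝ (Fin N)) hd0 hd1
      (by positivity : 0 ≤ t * (2 * Real.pi) ^ (2 * d))
    convert h using 2 with ξ
    rw [heatSymbol, Real.mul_rpow (by positivity) (norm_nonneg _), Real.rpow_mul (norm_nonneg _),
      Real.rpow_two]
    ring_nf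
  refine integrable_of_nonneg_of_eq_fourierInv (C := 1) (integrable_heatSymbol_ofReal hd0 ht)
    (fun ξ => ?_) (continuous_polyHeatKernel hd0 ht) (fun x => ?_) ofReal_polyHeatKernel
  · rw [Complex.norm_real, Real.norm_of_nonneg (heatSymbol_pos ξ).le]
    exact heatSymbol_le_one ht.le ξ
  · rw [polyHeatKernel_eq_integral hd0 ht]
    exact hpos.integral_mul_cos_nonneg (integrable_heatSymbol hd0 ht) x

lemma integrable_polyHeatKernel {N : ℕ} [NeZero N] {d t : ℝ}
    (hd : (0 < d ∧ d < 1) ∨ ∃ k : ℕ, 1 ≤ k ∧ d = k) (ht : 0 < t) :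
    Integrable (polyHeatKernel N d t) := by
  rcases hd with ⟨h0, h1⟩ | ⟨k, hk, rfl⟩
  · exact integrable_polyHeatKernel_of_lt_one h0 h1 ht
  · exact integrable_polyHeatKernel_natCast ht hk

end Subordination

/-! ### Scaling, mass and semigroup law of the kernel -/

section Kernel

variable {N : ℕ} {d : ℝ}

lemma fourier_heatSymbol {t : ℝ} :
    𝓕 (fun ξ : EuclideanSpace ℝ (Fin N) => (heatSymbol N d t ξ : ℂ))
      = fun x => (polyHeatKernel N d t x : ℂ) := by
  have h := Real.fourierInv_eq_fourier_comp_neg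
    (fun ξ : EuclideanSpace ℝ (Fin N) => (heatSymbol N d t ξ : ℂ))
  simp only [heatSymbol_neg] at h
  rw [← h]
  ext x
  exact (ofReal_polyHeatKernel x).symm

variable [NeZero N]

lemma polyHeatKernel_scaling (hd : 0 < d) {t : ℝ} (ht : 0 < t) (x : EuclideanSpace ℝ (Fin N)) :
    polyHeatKernel N d t x
      = (t ^ (-1 / (2 * d))) ^ N * polyHeatKernel N d 1 (t ^ (-1 / (2 * d)) • x) := by
  set l := t ^ (-1 / (2 * d)) with hl
  have hl0 : 0 < l := by positivity
  have hlt : t * l ^ (2 * d) = 1 := by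
    rw [hl, ← Real.rpow_mul ht.le, show -1 / (2 * d) * (2 * d) = -1 by field_simp,
      Real.rpow_neg_one, mul_inv_cancel₀ ht.ne']
  rw [polyHeatKernel_eq_integral hd ht, polyHeatKernel_eq_integral hd one_pos]
  have h := Measure.integral_comp_smul_of_nonneg (volume : Measure (EuclideanSpace ℝ (Fin N)))
    (fun ξ => heatSymbol N d t ξ * Real.cos (2 * Real.pi * inner ℝ ξ x)) l (hR := hl0.le)
  have h2 : ∀ ξ : EuclideanSpace ℝ (Fin N), heatSymbol N d t (l • ξ) = heatSymbol N d 1 ξ := by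
    intro ξ
    rw [heatSymbol, heatSymbol, norm_smul, Real.norm_of_nonneg hl0.le,
      show 2 * Real.pi * (l * ‖ξ‖) = l * (2 * Real.pi * ‖ξ‖) by ring,
      Real.mul_rpow hl0.le (by positivity)]
    congr 1
    linear_combination (-(2 * Real.pi * ‖ξ‖) ^ (2 * d)) * hlt
  simp only [h2, inner_smul_left, finrank_euclideanSpace, Fintype.card_fin, smul_eq_mul,
    conj_trivial] at h
  simp only [inner_smul_right]
  rw [h, ← mul_assoc, mul_inv_cancel₀ (by positivity), one_mul]

lemma integral_comp_polyHeatKernel (hd : 0 < d) {t : ℝ} (ht : 0 < t)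
    (F : ℝ → EuclideanSpace ℝ (Fin N) → ℝ)
    (hF : ∀ c a x, 0 ≤ c → F (c * a) x = c * F a x) :
    ∫ x, F (polyHeatKernel N d t x) x
      = ∫ z, F (polyHeatKernel N d 1 z) (t ^ (1 / (2 * d)) • z) := by
  set l := t ^ (-1 / (2 * d)) with hl
  have hl0 : 0 < l := by positivity
  have hinv : t ^ (1 / (2 * d)) = l⁻¹ := by
    rw [hl, ← Real.rpow_neg ht.le]; ring_nf
  have h := Measure.integral_comp_smul_of_nonneg (volume : Measure (EuclideanSpace ℝ (Fin N)))
    (fun z => F (polyHeatKernel N d 1 z) (t ^ (1 / (2 * d)) • z)) l (hR := hl0.le)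
  simp only [hinv, smul_smul, inv_mul_cancel₀ hl0.ne', one_smul, finrank_euclideanSpace,
    Fintype.card_fin, smul_eq_mul] at h
  rw [hinv]
  calc ∫ x, F (polyHeatKernel N d t x) x
      = ∫ x, l ^ N * F (polyHeatKernel N d 1 (l • x)) x := by
        refine integral_congr_ae (Eventually.of_forall fun x => ?_)
        simp only
        rw [polyHeatKernel_scaling hd ht, hF _ _ _ (by positivity)]
    _ = _ := by
        rw [integral_const_mul, h, ← mul_assoc, mul_inv_cancel₀ (by positivity), one_mul]

lemma integral_abs_polyHeatKernel (hd : 0 < d) {t : ℝ} (ht : 0 < t) :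
    ∫ x, |polyHeatKernel N d t x| = ∫ x, |polyHeatKernel N d 1 x| :=
  integral_comp_polyHeatKernel hd ht (fun a _ => |a|) fun c a x hc => by
    simp only [abs_mul, abs_of_nonneg hc]

lemma abs_polyHeatKernel_le_rpow (hd : 0 < d) {t : ℝ} (ht : 0 < t)
    (x : EuclideanSpace ℝ (Fin N)) :
    |polyHeatKernel N d t x| ≤ (∫ ξ, heatSymbol N d 1 ξ) * t ^ (-(N / (2 * d))) := by
  have h1 : (t ^ (-1 / (2 * d))) ^ N = t ^ (-(N / (2 * d))) := by
    rw [← Real.rpow_mul_natCast ht.le]; ring_nf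
  rw [polyHeatKernel_scaling hd ht, abs_mul, h1, abs_of_pos (by positivity), mul_comm]
  gcongr
  exact abs_polyHeatKernel_le hd one_pos _

lemma fourier_polyHeatKernel (hd : 0 < d) {t : ℝ} (ht : 0 < t)
    (hK : Integrable (polyHeatKernel N d t)) :
    𝓕 (fun x => (polyHeatKernel N d t x : ℂ)) = fun ξ => (heatSymbol N d t ξ : ℂ) := by
  have h := Continuous.fourier_fourierInv_eq
    (f := fun ξ : EuclideanSpace ℝ (Fin N) => (heatSymbol N d t ξ : ℂ))
    (Complex.continuous_ofReal.comp (continuous_heatSymbol hd)) (integrable_heatSymbol_ofReal hd ht)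
    (by rw [fourier_heatSymbol]; exact hK.ofReal)
  rwa [show 𝓕⁻ (fun ξ : EuclideanSpace ℝ (Fin N) => (heatSymbol N d t ξ : ℂ))
    = fun x => (polyHeatKernel N d t x : ℂ) from funext fun x => (ofReal_polyHeatKernel x).symm] at h

lemma integral_polyHeatKernel (hd : 0 < d) {t : ℝ} (ht : 0 < t)
    (hK : Integrable (polyHeatKernel N d t)) : ∫ x, polyHeatKernel N d t x = 1 := by
  have h := congrFun (fourier_polyHeatKernel hd ht hK) 0
  simp only [Real.fourier_eq', inner_zero_right, mul_zero, Complex.ofReal_zero, zero_mul,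
    Complex.exp_zero, one_smul, heatSymbol_zero hd, Complex.ofReal_one] at h
  rw [integral_complex_ofReal] at h
  exact_mod_cast h

/-- The semigroup law, from multiplicativity of the symbol and Fourier inversion. -/
lemma polyHeatKernel_convolution (hd : 0 < d) {a b : ℝ} (ha : 0 < a) (hb : 0 < b)
    (hKa : Integrable (polyHeatKernel N d a)) (hKb : Integrable (polyHeatKernel N d b)) :
    polyHeatKernel N d a ⋆[ContinuousLinearMap.mul ℝ ℝ, volume] polyHeatKernel N d b
      = polyHeatKernel N d (a + b) := by
  set A : EuclideanSpace ℝ (Fin N) → ℂ := fun x => (polyHeatKernel N d a x : ℂ) with hA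
  set B : EuclideanSpace ℝ (Fin N) → ℂ := fun x => (polyHeatKernel N d b x : ℂ) with hB
  have hAi : Integrable A := hKa.ofReal
  have hBi : Integrable B := hKb.ofReal
  have hBc : Continuous B := Complex.continuous_ofReal.comp (continuous_polyHeatKernel hd hb)
  have hBb : BddAbove (range fun x => ‖B x‖) := by
    refine ⟨∫ ξ, heatSymbol N d b ξ, ?_⟩
    rintro _ ⟨x, rfl⟩
    simp only [hB, Complex.norm_real]
    exact abs_polyHeatKernel_le hd hb x
  have hFC : 𝓕 (A ⋆[ContinuousLinearMap.mul ℂ ℂ] B)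
      = fun ξ => (heatSymbol N d (a + b) ξ : ℂ) := by
    ext ξ
    rw [Real.fourier_mul_convolution_eq hAi hBi, hA, hB, fourier_polyHeatKernel hd ha hKa,
      fourier_polyHeatKernel hd hb hKb, ← Complex.ofReal_mul, heatSymbol_mul]
  have hinv := Continuous.fourierInv_fourier_eq
    (hBb.continuous_convolution_right_of_integrable (ContinuousLinearMap.mul ℂ ℂ) hAi hBc)
    (hAi.integrable_convolution (ContinuousLinearMap.mul ℂ ℂ) hBi)
    (by rw [hFC]; exact integrable_heatSymbol_ofReal hd (by positivity))
  rw [hFC] at hinv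
  ext x
  have h1 := congrFun hinv x
  rw [← ofReal_polyHeatKernel] at h1
  have h2 : (A ⋆[ContinuousLinearMap.mul ℂ ℂ] B) x = (((polyHeatKernel N d a
      ⋆[ContinuousLinearMap.mul ℝ ℝ, volume] polyHeatKernel N d b) x : ℝ) : ℂ) := by
    rw [convolution_def, convolution_def, ← integral_complex_ofReal]
    simp [hA, hB]
  rw [h2] at h1
  exact_mod_cast h1.symm

end Kernel

/-! ### Young's inequality for integrable bounded kernels -/

/-- Jensen's inequality for the weight `k`, which need not be normalized. -/
lemma lintegral_mul_rpow_le {α : Type*} [MeasurableSpace α] {μ : Measure α} {k g : α → ℝ≥0∞}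
    (hk : AEMeasurable k μ) (hg : AEMeasurable g μ) {r : ℝ} (hr : 1 ≤ r) :
    (∫⁻ a, k a * g a ∂μ) ^ r ≤ (∫⁻ a, k a ∂μ) ^ (r - 1) * ∫⁻ a, k a * g a ^ r ∂μ := by
  rcases hr.eq_or_lt with rfl | hr1
  · simp
  have hr0 : 0 < r := by linarith
  have hc := Real.HolderConjugate.conjExponent hr1
  set s := r.conjExponent
  have hs0 : 0 < s := hc.symm.pos
  have hsum : 1 / s + 1 / r = 1 := by
    have := hc.inv_add_inv_eq_one
    rw [one_div, one_div]; linarith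
  have h := ENNReal.lintegral_mul_le_Lp_mul_Lq μ hc.symm (f := fun a => k a ^ (1 / s))
    (g := fun a => k a ^ (1 / r) * g a) (hk.pow_const _) ((hk.pow_const _).mul hg)
  have e1 : ∀ a, ((fun a => k a ^ (1 / s)) * fun a => k a ^ (1 / r) * g a) a = k a * g a := by
    intro a
    simp only [Pi.mul_apply]
    rw [← mul_assoc, ← ENNReal.rpow_add_of_nonneg _ _ (by positivity) (by positivity), hsum,
      ENNReal.rpow_one]
  have e2 : ∀ a, (k a ^ (1 / s)) ^ s = k a := fun a => by
    rw [← ENNReal.rpow_mul, one_div_mul_cancel hs0.ne', ENNReal.rpow_one]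
  have e3 : ∀ a, (k a ^ (1 / r) * g a) ^ r = k a * g a ^ r := fun a => by
    rw [ENNReal.mul_rpow_of_nonneg _ _ hr0.le, ← ENNReal.rpow_mul, one_div_mul_cancel hr0.ne',
      ENNReal.rpow_one]
  simp only [e1, e2, e3] at h
  calc (∫⁻ a, k a * g a ∂μ) ^ r
      ≤ ((∫⁻ a, k a ∂μ) ^ (1 / s) * (∫⁻ a, k a * g a ^ r ∂μ) ^ (1 / r)) ^ r := by gcongr
    _ = _ := by
        rw [ENNReal.mul_rpow_of_nonneg _ _ hr0.le, ← ENNReal.rpow_mul, ← ENNReal.rpow_mul,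
          one_div_mul_cancel hr0.ne', ENNReal.rpow_one]
        congr 2
        have : 1 / s = 1 - 1 / r := by linarith
        rw [this]; field_simp

section Young

variable {G : Type*} [AddCommGroup G] [MeasurableSpace G] {μ : Measure G} {k f : G → ℝ}

lemma enorm_convolution_le (x : G) :
    ‖(k ⋆[ContinuousLinearMap.mul ℝ ℝ, μ] f) x‖ₑ ≤ ∫⁻ y, ‖k y‖ₑ * ‖f (x - y)‖ₑ ∂μ := by
  rw [convolution_def]
  refine (enorm_integral_le_lintegral_enorm _).trans (le_of_eq (lintegral_congr fun y => ?_))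
  simp only [ContinuousLinearMap.mul_apply', enorm_mul]

variable [MeasurableAdd₂ G] [MeasurableNeg G] [SFinite μ] [μ.IsAddLeftInvariant]

lemma aestronglyMeasurable_comp_sub_left (hf : AEStronglyMeasurable f μ) (x : G) :
    AEStronglyMeasurable (fun y => f (x - y)) μ :=
  hf.comp_quasiMeasurePreserving (quasiMeasurePreserving_sub_left μ x)

lemma aestronglyMeasurable_convolution (hk : AEStronglyMeasurable k μ)
    (hf : AEStronglyMeasurable f μ) :
    AEStronglyMeasurable (k ⋆[ContinuousLinearMap.mul ℝ ℝ, μ] f) μ :=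
  (hk.convolution_integrand (ContinuousLinearMap.mul ℝ ℝ) hf).integral_prod_right'

lemma rpow_lintegral_convolution_le (hk : AEStronglyMeasurable k μ) (hf : AEStronglyMeasurable f μ)
    {r : ℝ} (hr : 1 ≤ r) (x : G) :
    (∫⁻ y, ‖k y‖ₑ * ‖f (x - y)‖ₑ ∂μ) ^ r
      ≤ (∫⁻ y, ‖k y‖ₑ ∂μ) ^ (r - 1) * ∫⁻ y, ‖k y‖ₑ * ‖f (x - y)‖ₑ ^ r ∂μ :=
  lintegral_mul_rpow_le hk.enorm (aestronglyMeasurable_comp_sub_left hf x).enorm hr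

lemma lintegral_rpow_convolution_le (hk : AEStronglyMeasurable k μ) (hf : AEStronglyMeasurable f μ)
    {r : ℝ} (hr : 1 ≤ r) :
    ∫⁻ x, (∫⁻ y, ‖k y‖ₑ * ‖f (x - y)‖ₑ ∂μ) ^ r ∂μ
      ≤ (∫⁻ y, ‖k y‖ₑ ∂μ) ^ r * ∫⁻ y, ‖f y‖ₑ ^ r ∂μ := by
  set A := ∫⁻ y, ‖k y‖ₑ ∂μ
  have hm2 : AEStronglyMeasurable (fun p : G × G => f (p.1 - p.2)) (μ.prod μ) :=
    hf.comp_quasiMeasurePreserving (quasiMeasurePreserving_sub_of_right_invariant μ μ)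
  have hm : AEMeasurable (Function.uncurry fun x y => ‖k y‖ₑ * ‖f (x - y)‖ₑ ^ r) (μ.prod μ) :=
    hk.comp_snd.enorm.mul (hm2.enorm.pow_const r)
  calc ∫⁻ x, (∫⁻ y, ‖k y‖ₑ * ‖f (x - y)‖ₑ ∂μ) ^ r ∂μ
      ≤ ∫⁻ x, A ^ (r - 1) * ∫⁻ y, ‖k y‖ₑ * ‖f (x - y)‖ₑ ^ r ∂μ ∂μ :=
        lintegral_mono fun x => rpow_lintegral_convolution_le hk hf hr x
    _ = A ^ (r - 1) * ∫⁻ y, ∫⁻ x, ‖k y‖ₑ * ‖f (x - y)‖ₑ ^ r ∂μ ∂μ := by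
        have hm' : AEMeasurable (fun x => ∫⁻ y, ‖k y‖ₑ * ‖f (x - y)‖ₑ ^ r ∂μ) μ :=
          hm.lintegral_prod_right'
        rw [lintegral_const_mul'' _ hm', lintegral_lintegral_swap hm]
    _ = A ^ (r - 1) * ∫⁻ y, ‖k y‖ₑ * ∫⁻ x, ‖f x‖ₑ ^ r ∂μ ∂μ := by
        congr 1
        refine lintegral_congr fun y => ?_
        rw [lintegral_const_mul' _ _ enorm_ne_top,
          lintegral_sub_right_eq_self (fun x => ‖f x‖ₑ ^ r) y]
    _ = A ^ r * ∫⁻ x, ‖f x‖ₑ ^ r ∂μ := by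
        rw [lintegral_mul_const'' _ hk.enorm, ← mul_assoc]
        congr 1
        conv_lhs => rw [← ENNReal.rpow_one (∫⁻ y, ‖k y‖ₑ ∂μ)]
        rw [← ENNReal.rpow_add_of_nonneg _ _ (by linarith) zero_le_one]
        congr 1; ring

variable [μ.IsNegInvariant]

lemma rpow_lintegral_convolution_le_of_bounded (hk : AEStronglyMeasurable k μ)
    (hf : AEStronglyMeasurable f μ) {B : ℝ≥0∞} (hB : ∀ y, ‖k y‖ₑ ≤ B) {r : ℝ} (hr : 1 ≤ r) (x : G) :
    (∫⁻ y, ‖k y‖ₑ * ‖f (x - y)‖ₑ ∂μ) ^ r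
      ≤ (∫⁻ y, ‖k y‖ₑ ∂μ) ^ (r - 1) * (B * ∫⁻ y, ‖f y‖ₑ ^ r ∂μ) := by
  refine (rpow_lintegral_convolution_le hk hf hr x).trans ?_
  gcongr
  calc ∫⁻ y, ‖k y‖ₑ * ‖f (x - y)‖ₑ ^ r ∂μ ≤ ∫⁻ y, B * ‖f (x - y)‖ₑ ^ r ∂μ := by
        gcongr with y; exact hB y
    _ = B * ∫⁻ y, ‖f y‖ₑ ^ r ∂μ := by
        rw [lintegral_const_mul'' _
          ((aestronglyMeasurable_comp_sub_left hf x).enorm.pow_const r),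
          lintegral_sub_left_eq_self (fun y => ‖f y‖ₑ ^ r) x]

/-- Young's inequality for a kernel in `L¹ ∩ L^∞`, by interpolating the power `q` between `r` and the
supremum of `k ⋆ f`. -/
lemma eLpNorm_convolution_le (hk : AEStronglyMeasurable k μ) {A B : ℝ≥0∞}
    (hA : ∫⁻ y, ‖k y‖ₑ ∂μ ≤ A) (hB : ∀ y, ‖k y‖ₑ ≤ B) {r q : ℝ≥0∞} (hr : 1 ≤ r) (hrq : r ≤ q)
    (hq : q ≠ ⊤) (hf : AEStronglyMeasurable f μ) :
    eLpNorm (k ⋆[ContinuousLinearMap.mul ℝ ℝ, μ] f) q μ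
      ≤ A ^ (1 - (1 / r.toReal - 1 / q.toReal)) * B ^ (1 / r.toReal - 1 / q.toReal)
        * eLpNorm f r μ := by
  have hrtop : r ≠ ⊤ := ne_top_of_le_ne_top hq hrq
  have hr0 : r ≠ 0 := (zero_lt_one.trans_le hr).ne'
  have hq0 : q ≠ 0 := (zero_lt_one.trans_le (hr.trans hrq)).ne'
  rw [eLpNorm_eq_lintegral_rpow_enorm_toReal hr0 hrtop, eLpNorm_eq_lintegral_rpow_enorm_toReal hq0 hq]
  have hρ1 : 1 ≤ r.toReal := by
    rw [← ENNReal.toReal_one]; exact ENNReal.toReal_mono hrtop hr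
  have hρτ : r.toReal ≤ q.toReal := ENNReal.toReal_mono hq hrq
  set ρ := r.toReal
  set τ := q.toReal
  have hρ0 : 0 < ρ := by linarith
  have hτ0 : 0 < τ := by linarith
  set F := ∫⁻ y, ‖f y‖ₑ ^ ρ ∂μ
  set c : G → ℝ≥0∞ := fun x => ∫⁻ y, ‖k y‖ₑ * ‖f (x - y)‖ₑ ∂μ with hc
  have h1 : ∀ x, c x ^ (τ - ρ) ≤ (A ^ (ρ - 1) * (B * F)) ^ ((τ - ρ) / ρ) := by
    intro x
    have h2 : c x ^ (τ - ρ) = (c x ^ ρ) ^ ((τ - ρ) / ρ) := by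
      rw [← ENNReal.rpow_mul]; congr 1; field_simp
    rw [h2]
    have hexp : 0 ≤ (τ - ρ) / ρ := div_nonneg (by linarith) hρ0.le
    refine ENNReal.rpow_le_rpow ?_ hexp
    refine (rpow_lintegral_convolution_le_of_bounded hk hf hB hρ1 x).trans ?_
    gcongr
  have h3 : ∫⁻ x, ‖(k ⋆[ContinuousLinearMap.mul ℝ ℝ, μ] f) x‖ₑ ^ τ ∂μ
      ≤ (A ^ (ρ - 1) * (B * F)) ^ ((τ - ρ) / ρ) * (A ^ ρ * F) := by
    calc _ ≤ ∫⁻ x, (A ^ (ρ - 1) * (B * F)) ^ ((τ - ρ) / ρ) * c x ^ ρ ∂μ := by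
          refine lintegral_mono fun x => ?_
          calc _ ≤ c x ^ τ := ENNReal.rpow_le_rpow (enorm_convolution_le x) hτ0.le
            _ = c x ^ (τ - ρ) * c x ^ ρ := by
                rw [← ENNReal.rpow_add_of_nonneg _ _ (by linarith) hρ0.le]; congr 1; ring
            _ ≤ _ := by gcongr; exact h1 x
      _ ≤ (A ^ (ρ - 1) * (B * F)) ^ ((τ - ρ) / ρ) * ∫⁻ x, c x ^ ρ ∂μ := by
          refine (lintegral_const_mul'' _ ?_).le
          have hm : AEMeasurable (Function.uncurry fun x y => ‖k y‖ₑ * ‖f (x - y)‖ₑ) (μ.prod μ) := by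
            refine hk.comp_snd.enorm.mul (AEStronglyMeasurable.enorm
              (f := fun p : G × G => f (p.1 - p.2)) ?_)
            exact hf.comp_quasiMeasurePreserving (quasiMeasurePreserving_sub_of_right_invariant μ μ)
          exact hm.lintegral_prod_right'.pow_const ρ
      _ ≤ _ := by
          gcongr
          refine (lintegral_rpow_convolution_le hk hf hρ1).trans ?_
          gcongr
  have hθ : 0 ≤ (τ - ρ) / ρ := div_nonneg (by linarith) hρ0.le
  calc _ ≤ ((A ^ (ρ - 1) * (B * F)) ^ ((τ - ρ) / ρ) * (A ^ ρ * F)) ^ (1 / τ) := by gcongr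
    _ = (A ^ ((ρ - 1) * ((τ - ρ) / ρ) * (1 / τ)) * A ^ (ρ * (1 / τ)))
        * B ^ ((τ - ρ) / ρ * (1 / τ)) * (F ^ ((τ - ρ) / ρ * (1 / τ)) * F ^ (1 / τ)) := by
        rw [ENNReal.mul_rpow_of_nonneg _ _ hθ, ENNReal.mul_rpow_of_nonneg _ _ hθ,
          ENNReal.mul_rpow_of_nonneg _ _ (by positivity), ENNReal.mul_rpow_of_nonneg _ _ (by positivity),
          ENNReal.mul_rpow_of_nonneg _ _ (by positivity), ENNReal.mul_rpow_of_nonneg _ _ (by positivity)]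
        simp only [← ENNReal.rpow_mul]
        ring
    _ = _ := by
        rw [← ENNReal.rpow_add_of_nonneg _ _ (by
          have : 0 ≤ ρ - 1 := by linarith
          positivity) (by positivity),
          ← ENNReal.rpow_add_of_nonneg _ _ (by positivity) (by positivity)]
        congr 3
        · field_simp; ring
        · field_simp
        · field_simp; ring

lemma convolutionExistsAt_of_memLp (hk : Integrable k μ) {B : ℝ} (hB : ∀ y, |k y| ≤ B) {r : ℝ≥0∞}
    (hr : 1 ≤ r) (hrtop : r ≠ ⊤) (hf : MemLp f r μ) (x : G) :
    ConvolutionExistsAt k f x (ContinuousLinearMap.mul ℝ ℝ) μ := by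
  have hr0 : r ≠ 0 := (zero_lt_one.trans_le hr).ne'
  have hρ1 : 1 ≤ r.toReal := by
    rw [← ENNReal.toReal_one]; exact ENNReal.toReal_mono hrtop hr
  refine ⟨(hk.1.mul (aestronglyMeasurable_comp_sub_left hf.1 x)), ?_⟩
  have h := rpow_lintegral_convolution_le_of_bounded (B := ENNReal.ofReal B) hk.1 hf.1
    (fun y => by rw [Real.enorm_eq_ofReal_abs]; exact ENNReal.ofReal_le_ofReal (hB y)) hρ1 x
  have h2 : (∫⁻ y, ‖k y‖ₑ ∂μ) ^ (r.toReal - 1)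
      * (ENNReal.ofReal B * ∫⁻ y, ‖f y‖ₑ ^ r.toReal ∂μ) < ⊤ := by
    refine ENNReal.mul_lt_top (ENNReal.rpow_lt_top_of_nonneg (by linarith) hk.2.ne)
      (ENNReal.mul_lt_top ENNReal.ofReal_lt_top ?_)
    exact lintegral_rpow_enorm_lt_top_of_eLpNorm_lt_top hr0 hrtop hf.2
  have h3 := (ENNReal.rpow_lt_top_iff_of_pos (by linarith)).1 (h.trans_lt h2)
  refine lt_of_le_of_lt (le_of_eq (lintegral_congr fun y => ?_)) h3
  simp only [ContinuousLinearMap.mul_apply', enorm_mul]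

lemma memLp_convolution (hk : Integrable k μ) {B : ℝ} (hB : ∀ y, |k y| ≤ B) {r q : ℝ≥0∞}
    (hr : 1 ≤ r) (hrq : r ≤ q) (hq : q ≠ ⊤) (hf : MemLp f r μ) :
    MemLp (k ⋆[ContinuousLinearMap.mul ℝ ℝ, μ] f) q μ := by
  refine ⟨aestronglyMeasurable_convolution hk.1 hf.1, ?_⟩
  refine (eLpNorm_convolution_le (B := ENNReal.ofReal B) hk.1 le_rfl (fun y => by
    rw [Real.enorm_eq_ofReal_abs]; exact ENNReal.ofReal_le_ofReal (hB y)) hr hrq hq hf.1).trans_lt ?_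
  have hρ1 : 1 ≤ r.toReal := by
    rw [← ENNReal.toReal_one]; exact ENNReal.toReal_mono (ne_top_of_le_ne_top hq hrq) hr
  have hρτ : r.toReal ≤ q.toReal := ENNReal.toReal_mono hq hrq
  have h1 : 0 ≤ 1 / r.toReal - 1 / q.toReal := by
    rw [sub_nonneg]; gcongr
  have h2 : 1 / r.toReal ≤ 1 := by rw [div_le_one (by linarith)]; exact hρ1
  have h3 : 0 ≤ 1 / q.toReal := by positivity
  exact ENNReal.mul_lt_top (ENNReal.mul_lt_top
    (ENNReal.rpow_lt_top_of_nonneg (by linarith) hk.2.ne)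
    (ENNReal.rpow_lt_top_of_nonneg h1 ENNReal.ofReal_ne_top)) hf.2

/-- Associativity of convolution for two `L¹ ∩ L^∞` kernels acting on an `L^r` function. -/
lemma convolution_assoc_of_memLp {k' : G → ℝ} (hk : Integrable k μ) {B B' : ℝ}
    (hB : ∀ y, |k y| ≤ B) (hk' : Integrable k' μ) (hB' : ∀ y, |k' y| ≤ B') {r : ℝ≥0∞}
    (hr : 1 ≤ r) (hrtop : r ≠ ⊤) (hf : MemLp f r μ) :
    (k ⋆[ContinuousLinearMap.mul ℝ ℝ, μ] k') ⋆[ContinuousLinearMap.mul ℝ ℝ, μ] f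
      = k ⋆[ContinuousLinearMap.mul ℝ ℝ, μ] (k' ⋆[ContinuousLinearMap.mul ℝ ℝ, μ] f) := by
  have hk1' : MemLp k' 1 μ := memLp_one_iff_integrable.2 hk'
  have hBn : ∀ y, |‖k y‖| ≤ B := fun y => by rw [abs_norm]; exact hB y
  have hBn' : ∀ y, |‖k' y‖| ≤ B' := fun y => by rw [abs_norm]; exact hB' y
  ext x
  refine convolution_assoc _ _ _ _ (fun a b c => by simp [mul_assoc]) hk.1 hk'.1 hf.1
    (Eventually.of_forall fun y => convolutionExistsAt_of_memLp hk hB le_rfl ENNReal.one_ne_top hk1' y)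
    (Eventually.of_forall fun y => convolutionExistsAt_of_memLp hk'.norm hBn' hr hrtop hf.norm y) ?_
  exact convolutionExistsAt_of_memLp hk.norm hBn hr hrtop
    (memLp_convolution hk'.norm hBn' hr le_rfl hrtop hf.norm) x

end Young

/-! ### The semigroup on `L^q` -/

section ApproximateIdentity

variable {G : Type*} [AddCommGroup G] [MeasurableSpace G] [MeasurableAdd₂ G] [MeasurableNeg G]
  {μ : Measure G} [SFinite μ] [μ.IsAddLeftInvariant] [μ.IsNegInvariant] {k f : G → ℝ}

/-- For a kernel of integral one, `k ⋆ f - f` is controlled by the `L^r` moduli of continuity of `f`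
under translations, averaged against `|k|`. -/
lemma lintegral_rpow_convolution_sub_le (hk : Integrable k μ) (hk1 : ∫ y, k y ∂μ = 1) {B : ℝ}
    (hB : ∀ y, |k y| ≤ B) {r : ℝ≥0∞} (hr : 1 ≤ r) (hrtop : r ≠ ⊤) (hf : MemLp f r μ) :
    ∫⁻ x, ‖(k ⋆[ContinuousLinearMap.mul ℝ ℝ, μ] f) x - f x‖ₑ ^ r.toReal ∂μ
      ≤ (∫⁻ y, ‖k y‖ₑ ∂μ) ^ (r.toReal - 1)
        * ∫⁻ y, ‖k y‖ₑ * ∫⁻ x, ‖f (x - y) - f x‖ₑ ^ r.toReal ∂μ ∂μ := by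
  have hρ1 : 1 ≤ r.toReal := by
    rw [← ENNReal.toReal_one]; exact ENNReal.toReal_mono hrtop hr
  set ρ := r.toReal
  have hm2 : AEStronglyMeasurable (fun p : G × G => f (p.1 - p.2) - f p.1) (μ.prod μ) :=
    (hf.1.comp_quasiMeasurePreserving (quasiMeasurePreserving_sub_of_right_invariant μ μ)).sub
      hf.1.comp_fst
  have hm : AEMeasurable (Function.uncurry fun x y => ‖k y‖ₑ * ‖f (x - y) - f x‖ₑ ^ ρ) (μ.prod μ) :=
    hk.1.comp_snd.enorm.mul (hm2.enorm.pow_const ρ)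
  have hpt : ∀ x, ‖(k ⋆[ContinuousLinearMap.mul ℝ ℝ, μ] f) x - f x‖ₑ
      ≤ ∫⁻ y, ‖k y‖ₑ * ‖f (x - y) - f x‖ₑ ∂μ := by
    intro x
    have h1 : (k ⋆[ContinuousLinearMap.mul ℝ ℝ, μ] f) x - f x = ∫ y, k y * (f (x - y) - f x) ∂μ := by
      have h2 : f x = ∫ y, k y * f x ∂μ := by rw [integral_mul_const, hk1, one_mul]
      conv_lhs => rw [h2]
      rw [convolution_def, ← integral_sub (convolutionExistsAt_of_memLp hk hB hr hrtop hf x)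
        (hk.mul_const _)]
      refine integral_congr_ae (Eventually.of_forall fun y => ?_)
      simp only [ContinuousLinearMap.mul_apply']
      ring
    rw [h1]
    refine (enorm_integral_le_lintegral_enorm _).trans (le_of_eq (lintegral_congr fun y => ?_))
    rw [enorm_mul]
  have hm' : AEMeasurable (fun x => ∫⁻ y, ‖k y‖ₑ * ‖f (x - y) - f x‖ₑ ^ ρ ∂μ) μ :=
    hm.lintegral_prod_right'
  calc ∫⁻ x, ‖(k ⋆[ContinuousLinearMap.mul ℝ ℝ, μ] f) x - f x‖ₑ ^ ρ ∂μ
      ≤ ∫⁻ x, (∫⁻ y, ‖k y‖ₑ ∂μ) ^ (ρ - 1) * ∫⁻ y, ‖k y‖ₑ * ‖f (x - y) - f x‖ₑ ^ ρ ∂μ ∂μ := by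
        refine lintegral_mono fun x => ?_
        refine (ENNReal.rpow_le_rpow (hpt x) (by linarith)).trans ?_
        exact lintegral_mul_rpow_le hk.1.enorm
          ((aestronglyMeasurable_comp_sub_left hf.1 x).sub aestronglyMeasurable_const).enorm hρ1
    _ = _ := by
        rw [lintegral_const_mul'' _ hm', lintegral_lintegral_swap hm]
        congr 1
        refine lintegral_congr fun y => ?_
        rw [lintegral_const_mul' _ _ enorm_ne_top]

end ApproximateIdentity

/-- A bounded semigroup that is right-continuous at `0` is strongly continuous. -/
lemma continuousOn_of_semigroup {X : Type*} [NormedAddCommGroup X] [NormedSpace ℝ X]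
    {S : ℝ → X →L[ℝ] X} {M : ℝ} (h0 : S 0 = 1) (hM : ∀ t, 0 ≤ t → ‖S t‖ ≤ M)
    (hadd : ∀ a b x, 0 ≤ a → 0 ≤ b → S a (S b x) = S (a + b) x) {x : X}
    (hx : Tendsto (fun t => S t x) (𝓝[>] 0) (𝓝 x)) : ContinuousOn (fun t => S t x) (Ici 0) := by
  have hx' : Tendsto (fun t => S t x) (𝓝[≥] 0) (𝓝 x) := by
    have h : ContinuousWithinAt (fun t => S t x) (Ioi 0) 0 := by
      rw [ContinuousWithinAt, h0]; exact hx
    have h2 : ContinuousWithinAt (fun t => S t x) (Ici 0) 0 :=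
      continuousWithinAt_Ioi_iff_Ici.1 h
    rw [ContinuousWithinAt, h0] at h2
    exact h2
  intro t₀ ht₀
  have hb : ∀ t ∈ Ici (0 : ℝ), ‖S t x - S t₀ x‖ ≤ M * ‖S |t - t₀| x - x‖ := by
    intro t ht
    rcases le_total t₀ t with h | h
    · have : S t x = S t₀ (S (t - t₀) x) := by
        rw [hadd _ _ _ ht₀ (sub_nonneg.2 h), add_sub_cancel]
      rw [this, ← map_sub, abs_of_nonneg (sub_nonneg.2 h)]
      exact (S t₀).le_of_opNorm_le (hM _ ht₀) _
    · have : S t₀ x = S t (S (t₀ - t) x) := by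
        rw [hadd _ _ _ ht (sub_nonneg.2 h), add_sub_cancel]
      rw [this, ← map_sub, abs_sub_comm, abs_of_nonneg (sub_nonneg.2 h), norm_sub_rev _ x]
      exact (S t).le_of_opNorm_le (hM _ ht) _
  rw [ContinuousWithinAt, tendsto_iff_norm_sub_tendsto_zero]
  have habs : Tendsto (fun t => |t - t₀|) (𝓝[Ici 0] t₀) (𝓝[≥] 0) := by
    refine tendsto_nhdsWithin_iff.2 ⟨?_, Eventually.of_forall fun t => mem_Ici.2 (abs_nonneg _)⟩
    have : Continuous fun t : ℝ => |t - t₀| := by fun_prop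
    have h := this.tendsto t₀
    simp only [sub_self, abs_zero] at h
    exact h.mono_left nhdsWithin_le_nhds
  have h1 : Tendsto (fun t => M * ‖S |t - t₀| x - x‖) (𝓝[Ici 0] t₀) (𝓝 0) := by
    have := (tendsto_iff_norm_sub_tendsto_zero.1 (hx'.comp habs)).const_mul M
    simpa using this
  exact squeeze_zero' (Eventually.of_forall fun t => norm_nonneg _)
    (eventually_nhdsWithin_of_forall hb) h1

section HeatLp

variable {N : ℕ} {d : ℝ}

lemma polyHeat_of_pos {t : ℝ} (ht : 0 < t) (f : EuclideanSpace ℝ (Fin N) → ℝ) :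
    polyHeat d t f = polyHeatKernel N d t ⋆[ContinuousLinearMap.mul ℝ ℝ, volume] f := if_pos ht

lemma polyHeat_of_nonpos {t : ℝ} (ht : t ≤ 0) (f : EuclideanSpace ℝ (Fin N) → ℝ) :
    polyHeat d t f = f := if_neg (not_lt.2 ht)

lemma polyHeat_congr {t : ℝ} {f g : EuclideanSpace ℝ (Fin N) → ℝ} (h : f =ᵐ[volume] g) :
    polyHeat d t f =ᵐ[volume] polyHeat d t g := by
  rcases lt_or_ge 0 t with ht | ht
  · rw [polyHeat_of_pos ht, polyHeat_of_pos ht,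
      convolution_congr (ContinuousLinearMap.mul ℝ ℝ) EventuallyEq.rfl h]
  · rwa [polyHeat_of_nonpos ht, polyHeat_of_nonpos ht]

lemma polyHeat_smul {t : ℝ} (c : ℝ) (f : EuclideanSpace ℝ (Fin N) → ℝ) :
    polyHeat d t (c • f) = c • polyHeat d t f := by
  rcases lt_or_ge 0 t with ht | ht
  · rw [polyHeat_of_pos ht, polyHeat_of_pos ht, convolution_smul]
  · simp only [polyHeat_of_nonpos ht]

variable {q : ℝ≥0∞}

lemma polyHeatLp_eq_toLp {t : ℝ} {f : EuclideanSpace ℝ (Fin N) → ℝ}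
    (h : MemLp (polyHeat d t f) q volume) : polyHeatLp q d t f = h.toLp _ := dif_pos h

lemma coeFn_polyHeatLp {t : ℝ} {f : EuclideanSpace ℝ (Fin N) → ℝ}
    (h : MemLp (polyHeat d t f) q volume) : polyHeatLp q d t f =ᵐ[volume] polyHeat d t f := by
  rw [polyHeatLp_eq_toLp h]; exact h.coeFn_toLp

lemma polyHeatLp_of_nonpos {t : ℝ} (ht : t ≤ 0)
    (u : Lp ℝ q (volume : Measure (EuclideanSpace ℝ (Fin N)))) : polyHeatLp q d t u = u := by
  have h : MemLp (polyHeat d t u) q volume := by rw [polyHeat_of_nonpos ht]; exact Lp.memLp u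
  refine Lp.ext ((coeFn_polyHeatLp h).trans ?_)
  rw [polyHeat_of_nonpos ht]

variable [NeZero N]

lemma lintegral_enorm_polyHeatKernel (hd : 0 < d)
    (hK : ∀ t, 0 < t → Integrable (polyHeatKernel N d t)) {t : ℝ} (ht : 0 < t) :
    ∫⁻ x, ‖polyHeatKernel N d t x‖ₑ = ENNReal.ofReal (∫ x, |polyHeatKernel N d 1 x|) := by
  rw [← integral_abs_polyHeatKernel hd ht, ← ofReal_integral_norm_eq_lintegral_enorm (hK t ht)]
  rfl

lemma enorm_polyHeatKernel_le (hd : 0 < d) {t : ℝ} (ht : 0 < t) (x : EuclideanSpace ℝ (Fin N)) :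
    ‖polyHeatKernel N d t x‖ₑ
      ≤ ENNReal.ofReal ((∫ ξ, heatSymbol N d 1 ξ) * t ^ (-(N / (2 * d)))) := by
  rw [Real.enorm_eq_ofReal_abs]
  exact ENNReal.ofReal_le_ofReal (abs_polyHeatKernel_le_rpow hd ht x)

lemma memLp_polyHeat (hd : 0 < d) (hK : ∀ t, 0 < t → Integrable (polyHeatKernel N d t))
    {t : ℝ} (ht : 0 < t) {r q : ℝ≥0∞} (hr : 1 ≤ r) (hrq : r ≤ q) (hq : q ≠ ⊤)
    {f : EuclideanSpace ℝ (Fin N) → ℝ} (hf : MemLp f r volume) :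
    MemLp (polyHeat d t f) q volume := by
  rw [polyHeat_of_pos ht]
  exact memLp_convolution (hK t ht) (abs_polyHeatKernel_le hd ht) hr hrq hq hf

/-- The smoothing estimate `L^r → L^q`. -/
lemma exists_eLpNorm_polyHeat_le (hd : 0 < d)
    (hK : ∀ t, 0 < t → Integrable (polyHeatKernel N d t)) {r q : ℝ≥0∞} (hr : 1 ≤ r) (hrq : r ≤ q)
    (hq : q ≠ ⊤) :
    ∃ C : ℝ, 0 ≤ C ∧ ∀ t, 0 < t → ∀ f : EuclideanSpace ℝ (Fin N) → ℝ,
      AEStronglyMeasurable f volume →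
      eLpNorm (polyHeat d t f) q volume
        ≤ ENNReal.ofReal (C * t ^ (-(N / (2 * d) * (1 / r.toReal - 1 / q.toReal))))
          * eLpNorm f r volume := by
  have hρ1 : 1 ≤ r.toReal := by
    rw [← ENNReal.toReal_one]; exact ENNReal.toReal_mono (ne_top_of_le_ne_top hq hrq) hr
  have hρτ : r.toReal ≤ q.toReal := ENNReal.toReal_mono hq hrq
  have h1 : 0 ≤ 1 / r.toReal - 1 / q.toReal := by
    rw [sub_nonneg]; gcongr
  have h2 : 1 / r.toReal ≤ 1 := by rw [div_le_one (by linarith)]; exact hρ1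
  have h3 : 0 ≤ 1 / q.toReal := by positivity
  set θ := 1 / r.toReal - 1 / q.toReal
  have hA0 : 0 ≤ ∫ x, |polyHeatKernel N d 1 x| := integral_nonneg fun x => abs_nonneg _
  have hB0 : 0 ≤ ∫ ξ, heatSymbol N d 1 ξ := integral_nonneg fun x => (heatSymbol_pos x).le
  refine ⟨(∫ x, |polyHeatKernel N d 1 x|) ^ (1 - θ) * (∫ ξ, heatSymbol N d 1 ξ) ^ θ,
    by positivity, fun t ht f hf => ?_⟩
  rw [polyHeat_of_pos ht]
  refine (eLpNorm_convolution_le (hK t ht).1 (lintegral_enorm_polyHeatKernel hd hK ht).le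
    (enorm_polyHeatKernel_le hd ht) hr hrq hq hf).trans (le_of_eq ?_)
  congr 1
  rw [ENNReal.ofReal_rpow_of_nonneg hA0 (by linarith),
    ENNReal.ofReal_rpow_of_nonneg (by positivity) h1, ← ENNReal.ofReal_mul (by positivity),
    Real.mul_rpow hB0 (by positivity), ← Real.rpow_mul ht.le, mul_assoc]
  congr 4
  ring

lemma polyHeat_polyHeat (hd : 0 < d) (hK : ∀ t, 0 < t → Integrable (polyHeatKernel N d t))
    {a b : ℝ} (ha : 0 < a) (hb : 0 < b) {r : ℝ≥0∞} (hr : 1 ≤ r) (hrtop : r ≠ ⊤)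
    {f : EuclideanSpace ℝ (Fin N) → ℝ} (hf : MemLp f r volume) :
    polyHeat d a (polyHeat d b f) = polyHeat d (a + b) f := by
  rw [polyHeat_of_pos ha, polyHeat_of_pos hb, polyHeat_of_pos (add_pos ha hb),
    ← polyHeatKernel_convolution hd ha hb (hK a ha) (hK b hb)]
  exact (convolution_assoc_of_memLp (hK a ha) (abs_polyHeatKernel_le hd ha) (hK b hb)
    (abs_polyHeatKernel_le hd hb) hr hrtop hf).symm

lemma polyHeat_add (hd : 0 < d) (hK : ∀ t, 0 < t → Integrable (polyHeatKernel N d t))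
    {t : ℝ} {r r' : ℝ≥0∞} (hr : 1 ≤ r) (hrtop : r ≠ ⊤) (hr' : 1 ≤ r') (hrtop' : r' ≠ ⊤)
    {f g : EuclideanSpace ℝ (Fin N) → ℝ} (hf : MemLp f r volume) (hg : MemLp g r' volume) :
    polyHeat d t (f + g) = polyHeat d t f + polyHeat d t g := by
  rcases lt_or_ge 0 t with ht | ht
  · rw [polyHeat_of_pos ht, polyHeat_of_pos ht, polyHeat_of_pos ht]
    refine ConvolutionExists.distrib_add (fun x => ?_) fun x => ?_
    · exact convolutionExistsAt_of_memLp (hK t ht) (abs_polyHeatKernel_le hd ht) hr hrtop hf x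
    · exact convolutionExistsAt_of_memLp (hK t ht) (abs_polyHeatKernel_le hd ht) hr' hrtop' hg x
  · simp only [polyHeat_of_nonpos ht]

variable [Fact (1 ≤ q)]

lemma memLp_polyHeat_coeFn (hd : 0 < d) (hK : ∀ t, 0 < t → Integrable (polyHeatKernel N d t))
    (hq : q ≠ ⊤) (t : ℝ) (u : Lp ℝ q (volume : Measure (EuclideanSpace ℝ (Fin N)))) :
    MemLp (polyHeat d t u) q volume := by
  rcases lt_or_ge 0 t with ht | ht
  · exact memLp_polyHeat hd hK ht Fact.out le_rfl hq (Lp.memLp u)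
  · rw [polyHeat_of_nonpos ht]; exact Lp.memLp u

/-- The operators `e^{-t(-Δ)^d}` as bounded operators on `L^q`, with a common bound. -/
lemma exists_polyHeatCLM (hd : 0 < d) (hK : ∀ t, 0 < t → Integrable (polyHeatKernel N d t))
    (hq : q ≠ ⊤) :
    ∃ (S : ℝ → Lp ℝ q (volume : Measure (EuclideanSpace ℝ (Fin N))) →L[ℝ]
        Lp ℝ q (volume : Measure (EuclideanSpace ℝ (Fin N)))) (M : ℝ),
      (∀ t u, S t u = polyHeatLp q d t u) ∧ ∀ t, ‖S t‖ ≤ M := by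
  have hq1 : 1 ≤ q := Fact.out
  obtain ⟨C, hC, hCb⟩ := exists_eLpNorm_polyHeat_le hd hK hq1 le_rfl hq
  have hmem := memLp_polyHeat_coeFn (q := q) hd hK hq
  have hadd : ∀ t (u v : Lp ℝ q (volume : Measure (EuclideanSpace ℝ (Fin N)))),
      polyHeatLp q d t (u + v : Lp ℝ q _) = polyHeatLp q d t u + polyHeatLp q d t v := by
    intro t u v
    refine Lp.ext ((coeFn_polyHeatLp (hmem t _)).trans ?_)
    refine (polyHeat_congr (Lp.coeFn_add u v)).trans ?_
    rw [polyHeat_add hd hK hq1 hq hq1 hq (Lp.memLp u) (Lp.memLp v)]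
    exact ((coeFn_polyHeatLp (hmem t u)).symm.add (coeFn_polyHeatLp (hmem t v)).symm).trans
      (Lp.coeFn_add _ _).symm
  have hsmul : ∀ t (c : ℝ) (u : Lp ℝ q (volume : Measure (EuclideanSpace ℝ (Fin N)))),
      polyHeatLp q d t (c • u : Lp ℝ q _) = c • polyHeatLp q d t u := by
    intro t c u
    refine Lp.ext ((coeFn_polyHeatLp (hmem t _)).trans ?_)
    refine (polyHeat_congr (Lp.coeFn_smul c u)).trans ?_
    rw [polyHeat_smul]
    exact ((coeFn_polyHeatLp (hmem t u)).symm.const_smul c).trans (Lp.coeFn_smul _ _).symm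
  have hbd : ∀ t (u : Lp ℝ q (volume : Measure (EuclideanSpace ℝ (Fin N)))),
      ‖polyHeatLp q d t u‖ ≤ max C 1 * ‖u‖ := by
    intro t u
    rcases lt_or_ge 0 t with ht | ht
    · have h := hCb t ht u (Lp.memLp u).1
      rw [sub_self, mul_zero, neg_zero, Real.rpow_zero, mul_one] at h
      rw [polyHeatLp_eq_toLp (hmem t u), Lp.norm_toLp]
      refine (ENNReal.toReal_mono (ENNReal.mul_ne_top ENNReal.ofReal_ne_top
        (Lp.eLpNorm_ne_top u)) h).trans ?_
      rw [ENNReal.toReal_mul, ENNReal.toReal_ofReal hC, ← Lp.norm_def]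
      gcongr
      exact le_max_left _ _
    · rw [polyHeatLp_of_nonpos ht]
      exact le_mul_of_one_le_left (norm_nonneg _) (le_max_right _ _)
  refine ⟨fun t => LinearMap.mkContinuous ⟨⟨fun u => polyHeatLp q d t u, hadd t⟩, hsmul t⟩
    (max C 1) (hbd t), max C 1, fun t u => rfl, fun t => ?_⟩
  exact LinearMap.mkContinuous_norm_le _ (by positivity) _

lemma polyHeatLp_polyHeatLp (hd : 0 < d) (hK : ∀ t, 0 < t → Integrable (polyHeatKernel N d t))
    (hq : q ≠ ⊤) {a b : ℝ} (ha : 0 ≤ a) (hb : 0 ≤ b)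
    (u : Lp ℝ q (volume : Measure (EuclideanSpace ℝ (Fin N)))) :
    polyHeatLp q d a (polyHeatLp q d b u) = polyHeatLp q d (a + b) u := by
  rcases ha.eq_or_lt with rfl | ha
  · rw [polyHeatLp_of_nonpos le_rfl, zero_add]
  rcases hb.eq_or_lt with rfl | hb
  · rw [polyHeatLp_of_nonpos le_rfl u, add_zero]
  have hmem := memLp_polyHeat_coeFn (q := q) hd hK hq
  refine Lp.ext ((coeFn_polyHeatLp (hmem a _)).trans ?_)
  refine (polyHeat_congr (coeFn_polyHeatLp (hmem b u))).trans ?_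
  rw [polyHeat_polyHeat hd hK ha hb Fact.out hq (Lp.memLp u)]
  exact (coeFn_polyHeatLp (hmem _ u)).symm

lemma tendsto_polyHeatLp_zero (hd : 0 < d) (hK : ∀ t, 0 < t → Integrable (polyHeatKernel N d t))
    (hq : q ≠ ⊤) (u : Lp ℝ q (volume : Measure (EuclideanSpace ℝ (Fin N)))) :
    Tendsto (fun t => polyHeatLp q d t u) (𝓝[>] 0) (𝓝 u) := by
  have hq1 : 1 ≤ q := Fact.out
  have hq0 : q ≠ 0 := (zero_lt_one.trans_le hq1).ne'
  have hτ1 : 1 ≤ q.toReal := by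
    rw [← ENNReal.toReal_one]; exact ENNReal.toReal_mono hq hq1
  set τ := q.toReal with hτ
  have hτ0 : 0 < τ := by linarith
  have hmp := fun y : EuclideanSpace ℝ (Fin N) => measurePreserving_sub_right volume y
  set T : EuclideanSpace ℝ (Fin N) → Lp ℝ q (volume : Measure (EuclideanSpace ℝ (Fin N))) :=
    fun y => Lp.compMeasurePreserving (fun x => x - y) (hmp y) u with hT
  have hTc : Continuous T := by
    let g : C(EuclideanSpace ℝ (Fin N), C(EuclideanSpace ℝ (Fin N), EuclideanSpace ℝ (Fin N))) :=
      (ContinuousMap.mk (fun p : EuclideanSpace ℝ (Fin N) × EuclideanSpace ℝ (Fin N) => p.2 - p.1)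
        (by fun_prop)).curry
    exact Continuous.compMeasurePreservingLp (f := fun _ => u) (g := g) continuous_const g.continuous
      hmp hq
  have hTn : ∀ y, ‖T y‖ = ‖u‖ := fun y => Lp.norm_compMeasurePreserving u (hmp y)
  have hT0 : T 0 = u := by
    refine Lp.ext ((Lp.coeFn_compMeasurePreserving u (hmp 0)).trans ?_)
    simp [Function.comp_def]
  -- the translation modulus of `u`
  set W : EuclideanSpace ℝ (Fin N) → ℝ := fun y => ‖T y - u‖ ^ τ with hW
  have hWc : Continuous W := (hTc.sub continuous_const).norm.rpow_const fun _ => Or.inr hτ0.le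
  have hW0 : ∀ y, 0 ≤ W y := fun y => by positivity
  have hWb : ∀ y, W y ≤ (2 * ‖u‖) ^ τ := fun y => by
    refine Real.rpow_le_rpow (norm_nonneg _) ?_ hτ0.le
    refine (norm_sub_le _ _).trans ?_
    rw [hTn]; linarith
  have hWW : ∀ y, ∫⁻ x, ‖u (x - y) - u x‖ₑ ^ τ = ENNReal.ofReal (W y) := by
    intro y
    have h1 : ∫⁻ x, ‖u (x - y) - u x‖ₑ ^ τ = ∫⁻ x, ‖(T y - u) x‖ₑ ^ τ := by
      refine lintegral_congr_ae ?_
      filter_upwards [Lp.coeFn_sub (T y) u, Lp.coeFn_compMeasurePreserving u (hmp y)] with x h1 h2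
      rw [h1, Pi.sub_apply, h2]
      rfl
    have h2 : eLpNorm (T y - u) q volume ^ τ = ∫⁻ x, ‖(T y - u) x‖ₑ ^ τ := by
      rw [eLpNorm_eq_lintegral_rpow_enorm_toReal hq0 hq, ← ENNReal.rpow_mul,
        one_div_mul_cancel hτ0.ne', ENNReal.rpow_one]
    rw [h1, ← h2, hW, ← ENNReal.ofReal_rpow_of_nonneg (norm_nonneg _) hτ0.le, Lp.norm_def,
      ENNReal.ofReal_toReal (Lp.eLpNorm_ne_top _)]
  set A := ∫ x, |polyHeatKernel N d 1 x| with hA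
  have hA0 : 0 ≤ A := integral_nonneg fun x => abs_nonneg _
  have hmain : ∀ t, 0 < t → ‖polyHeatLp q d t u - u‖ ^ τ
      ≤ A ^ (τ - 1) * ∫ z, |polyHeatKernel N d 1 z| * W (t ^ (1 / (2 * d)) • z) := by
    intro t ht
    have h1 := lintegral_rpow_convolution_sub_le (hK t ht) (integral_polyHeatKernel hd ht (hK t ht))
      (abs_polyHeatKernel_le hd ht) hq1 hq (Lp.memLp u)
    simp only [← hτ, hWW, lintegral_enorm_polyHeatKernel hd hK ht] at h1
    have hi : Integrable (fun y => |polyHeatKernel N d t y| * W y) :=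
      (hK t ht).abs.mul_bdd (c := (2 * ‖u‖) ^ τ) hWc.aestronglyMeasurable
        (Eventually.of_forall fun y => by rw [Real.norm_of_nonneg (hW0 y)]; exact hWb y)
    have h2 : ∫⁻ y, ‖polyHeatKernel N d t y‖ₑ * ENNReal.ofReal (W y)
        = ENNReal.ofReal (∫ z, |polyHeatKernel N d 1 z| * W (t ^ (1 / (2 * d)) • z)) := by
      rw [← integral_comp_polyHeatKernel hd ht (fun a y => |a| * W y) (fun c a x hc => by
        simp only [abs_mul, abs_of_nonneg hc, mul_assoc]),
        ofReal_integral_eq_lintegral_ofReal hi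
          (Eventually.of_forall fun y => mul_nonneg (abs_nonneg _) (hW0 y))]
      refine lintegral_congr fun y => ?_
      rw [ENNReal.ofReal_mul (abs_nonneg _), Real.enorm_eq_ofReal_abs]
    have h3 : ∫⁻ x, ‖(polyHeatKernel N d t ⋆[ContinuousLinearMap.mul ℝ ℝ, volume] u) x - u x‖ₑ ^ τ
        = ENNReal.ofReal (‖polyHeatLp q d t u - u‖ ^ τ) := by
      rw [← ENNReal.ofReal_rpow_of_nonneg (norm_nonneg _) hτ0.le, Lp.norm_def,
        ENNReal.ofReal_toReal (Lp.eLpNorm_ne_top _),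
        eLpNorm_eq_lintegral_rpow_enorm_toReal hq0 hq, ← ENNReal.rpow_mul,
        one_div_mul_cancel hτ0.ne', ENNReal.rpow_one]
      refine lintegral_congr_ae ?_
      filter_upwards [Lp.coeFn_sub (polyHeatLp q d t u) u,
        coeFn_polyHeatLp (memLp_polyHeat_coeFn hd hK hq t u)] with x e1 e2
      rw [e1, Pi.sub_apply, e2, polyHeat_of_pos ht]
    rw [h3, h2, ENNReal.ofReal_rpow_of_nonneg hA0 (by linarith), ← ENNReal.ofReal_mul (by positivity)]
      at h1
    refine (ENNReal.ofReal_le_ofReal_iff (mul_nonneg (by positivity) ?_)).1 h1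
    exact integral_nonneg fun z => mul_nonneg (abs_nonneg _) (hW0 _)
  have hlim : Tendsto (fun t : ℝ => A ^ (τ - 1) *
      ∫ z, |polyHeatKernel N d 1 z| * W (t ^ (1 / (2 * d)) • z)) (𝓝[>] 0) (𝓝 0) := by
    have hpow : Tendsto (fun t : ℝ => t ^ (1 / (2 * d))) (𝓝[>] 0) (𝓝 0) := by
      have : ContinuousAt (fun t : ℝ => t ^ (1 / (2 * d))) 0 :=
        Real.continuousAt_rpow_const _ _ (Or.inr (by positivity))
      have h := this.tendsto
      rw [Real.zero_rpow (by positivity)] at h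
      exact h.mono_left nhdsWithin_le_nhds
    have h1 : Tendsto (fun t : ℝ => ∫ z, |polyHeatKernel N d 1 z| * W (t ^ (1 / (2 * d)) • z))
        (𝓝[>] 0) (𝓝 (∫ z : EuclideanSpace ℝ (Fin N), (0 : ℝ))) := by
      refine tendsto_integral_filter_of_dominated_convergence
        (fun z => |polyHeatKernel N d 1 z| * (2 * ‖u‖) ^ τ) ?_ ?_ ((hK 1 one_pos).abs.mul_const _) ?_
      · refine Eventually.of_forall fun t => (hK 1 one_pos).1.norm.mul ?_
        exact (hWc.comp (continuous_const_smul _)).aestronglyMeasurable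
      · refine Eventually.of_forall fun t => Eventually.of_forall fun z => ?_
        rw [norm_mul, Real.norm_of_nonneg (hW0 _), Real.norm_of_nonneg (abs_nonneg _)]
        exact mul_le_mul_of_nonneg_left (hWb _) (abs_nonneg _)
      · refine Eventually.of_forall fun z => ?_
        have h2 : Tendsto (fun t : ℝ => W (t ^ (1 / (2 * d)) • z)) (𝓝[>] 0) (𝓝 (W 0)) := by
          have h3 := (hpow.smul_const z)
          rw [zero_smul] at h3
          exact (hWc.tendsto 0).comp h3
        have hW00 : W 0 = 0 := by
          simp only [hW, hT0, sub_self, norm_zero, Real.zero_rpow hτ0.ne']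
        rw [hW00] at h2
        simpa using h2.const_mul (|polyHeatKernel N d 1 z|)
    rw [integral_zero] at h1
    simpa using h1.const_mul (A ^ (τ - 1))
  rw [tendsto_iff_norm_sub_tendsto_zero]
  have h1 : Tendsto (fun t => ‖polyHeatLp q d t u - u‖ ^ τ) (𝓝[>] 0) (𝓝 0) :=
    squeeze_zero' (Eventually.of_forall fun t => by positivity)
      (eventually_nhdsWithin_of_forall fun t ht => hmain t ht) hlim
  have h2 := h1.rpow_const (p := 1 / τ) (Or.inr (by positivity))
  rw [Real.zero_rpow (by positivity)] at h2
  refine h2.congr fun t => ?_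
  rw [← Real.rpow_mul (norm_nonneg _), mul_one_div_cancel hτ0.ne', Real.rpow_one]

end HeatLp

/-! ### Weighted power nonlinearities -/

lemma rpow_sub_rpow_le_mul {p : ℝ} (hp : 1 ≤ p) {a b : ℝ} (hb : 0 ≤ b) (hab : b ≤ a) :
    a ^ p - b ^ p ≤ p * a ^ (p - 1) * (a - b) := by
  rcases (hb.trans hab).eq_or_lt with rfl | ha
  · rw [le_antisymm hab hb]; simp
  have h := one_add_mul_self_le_rpow_one_add (s := b / a - 1)
    (by have := div_nonneg hb ha.le; linarith) hp
  rw [add_sub_cancel, Real.div_rpow hb ha.le, le_div_iff₀ (by positivity)] at h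
  have h2 : a ^ p = a ^ (p - 1) * a := by
    rw [← Real.rpow_add_one ha.ne', sub_add_cancel]
  have h3 : (1 + p * (b / a - 1)) * a ^ p = a ^ p - p * a ^ (p - 1) * (a - b) := by
    rw [h2]; field_simp; ring
  linarith

lemma abs_abs_rpow_sub_le {p : ℝ} (hp : 1 ≤ p) (a b : ℝ) :
    |(|a| ^ p - |b| ^ p)| ≤ p * ((|a| + |b|) ^ (p - 1) * |a - b|) := by
  wlog h : |b| ≤ |a| generalizing a b
  · have := this b a (le_of_not_ge h)
    rwa [abs_sub_comm, add_comm, abs_sub_comm b a] at this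
  have h0 := abs_nonneg b
  rw [abs_of_nonneg (sub_nonneg.2 (Real.rpow_le_rpow h0 h (by linarith)))]
  refine (rpow_sub_rpow_le_mul hp h0 h).trans ?_
  rw [mul_assoc]
  have h1 : |a| ^ (p - 1) ≤ (|a| + |b|) ^ (p - 1) :=
    Real.rpow_le_rpow (abs_nonneg a) (by linarith) (by linarith)
  exact mul_le_mul_of_nonneg_left (mul_le_mul h1 (abs_sub_abs_le_abs_sub a b) (by linarith)
    (by positivity)) (by linarith)

/-- The nonlinearity `x ↦ w x |u x|^p` with a general weight `w`. -/
noncomputable def weightedPower {V : Type*} (w : V → ℝ) (p : ℝ) (u : V → ℝ) : V → ℝ :=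
  fun x => w x * |u x| ^ p

section WeightedPower

variable {V : Type*} [MeasurableSpace V] {μ : Measure V} {q : ℝ≥0∞} [Fact (1 ≤ q)]

/-- Lipschitz estimate by Hölder's inequality: for a weight in `L^{1/s}`, the map `u ↦ w |u|^p` is
locally Lipschitz from `L^q` to `L^r`, `1/r = s + p/q`. Here `s = 0` stands for bounded weights. -/
lemma eLpNorm_weightedPower_sub_le (hq : q ≠ ⊤) {p s : ℝ} (hp : 1 < p) (hs : 0 ≤ s) {w : V → ℝ}
    (hw : AEStronglyMeasurable w μ) (u v : Lp ℝ q μ) :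
    eLpNorm (weightedPower w p u - weightedPower w p v) (ENNReal.ofReal (s + p / q.toReal))⁻¹ μ
      ≤ ENNReal.ofReal p * (eLpNorm w (ENNReal.ofReal s)⁻¹ μ *
        ENNReal.ofReal ((‖u‖ + ‖v‖) ^ (p - 1) * ‖u - v‖)) := by
  have hq1 : 1 ≤ q := Fact.out
  have hτ0 : 0 < q.toReal := ENNReal.toReal_pos (zero_lt_one.trans_le hq1).ne' hq
  set τ := q.toReal with hτ
  have hqτ : q = ENNReal.ofReal τ := (ENNReal.ofReal_toReal hq).symm
  set F : V → ℝ := fun x => |u x| + |v x| with hF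
  have hFm : AEStronglyMeasurable F μ := (Lp.memLp u).1.norm.add (Lp.memLp v).1.norm
  have hF0 : ∀ x, 0 ≤ F x := fun x => by positivity
  set P : V → ℝ := fun x => ‖F x‖ ^ (p - 1) with hP
  have hPm : AEStronglyMeasurable P μ := (hFm.norm.aemeasurable.pow_const _).aestronglyMeasurable
  have hDm : AEStronglyMeasurable (u - v : V → ℝ) μ := (Lp.memLp u).1.sub (Lp.memLp v).1
  have i1 : ENNReal.HolderTriple (ENNReal.ofReal s)⁻¹ (ENNReal.ofReal (p / τ))⁻¹
      (ENNReal.ofReal (s + p / τ))⁻¹ := ⟨by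
    rw [inv_inv, inv_inv, inv_inv, ENNReal.ofReal_add hs (by positivity)]⟩
  have i2 : ENNReal.HolderTriple (ENNReal.ofReal ((p - 1) / τ))⁻¹ q (ENNReal.ofReal (p / τ))⁻¹ := ⟨by
    rw [inv_inv, inv_inv, hqτ, ← ENNReal.ofReal_inv_of_pos hτ0,
      ← ENNReal.ofReal_add (div_nonneg (by linarith) hτ0.le) (by positivity)]
    congr 1; field_simp; ring⟩
  have e1 : eLpNorm P (ENNReal.ofReal ((p - 1) / τ))⁻¹ μ = eLpNorm F q μ ^ (p - 1) := by
    rw [hP, eLpNorm_norm_rpow F (by linarith)]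
    congr 2
    rw [← ENNReal.ofReal_inv_of_pos (div_pos (by linarith) hτ0), ← ENNReal.ofReal_mul
      (inv_nonneg.2 (div_nonneg (by linarith) hτ0.le)), hqτ]
    congr 1
    have : p - 1 ≠ 0 := by linarith
    field_simp
  have e2 : eLpNorm F q μ ≤ ENNReal.ofReal (‖u‖ + ‖v‖) := by
    have h := eLpNorm_add_le (Lp.memLp u).1.norm (Lp.memLp v).1.norm hq1
    rw [eLpNorm_norm, eLpNorm_norm] at h
    rw [ENNReal.ofReal_add (norm_nonneg _) (norm_nonneg _), Lp.norm_def, Lp.norm_def,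
      ENNReal.ofReal_toReal (Lp.eLpNorm_ne_top _), ENNReal.ofReal_toReal (Lp.eLpNorm_ne_top _)]
    exact h
  have e3 : eLpNorm (u - v : V → ℝ) q μ = ENNReal.ofReal ‖u - v‖ := by
    rw [Lp.norm_def, ENNReal.ofReal_toReal (Lp.eLpNorm_ne_top _)]
    exact eLpNorm_congr_ae (Lp.coeFn_sub u v).symm
  have h1 : eLpNorm (weightedPower w p u - weightedPower w p v)
      (ENNReal.ofReal (s + p / τ))⁻¹ μ
      ≤ ENNReal.ofReal p * eLpNorm (w • (P • (u - v : V → ℝ))) (ENNReal.ofReal (s + p / τ))⁻¹ μ := by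
    refine eLpNorm_le_mul_eLpNorm_of_ae_le_mul (Eventually.of_forall fun x => ?_) _
    simp only [weightedPower, Pi.sub_apply, smul_eq_mul, Pi.mul_apply, hP, norm_mul, ← mul_sub,
      Real.norm_of_nonneg (hF0 x)]
    rw [Real.norm_of_nonneg (Real.rpow_nonneg (hF0 x) (p - 1)), mul_left_comm p]
    exact mul_le_mul_of_nonneg_left (abs_abs_rpow_sub_le hp.le _ _) (norm_nonneg _)
  refine h1.trans ?_
  gcongr
  refine (eLpNorm_smul_le_mul_eLpNorm (p := (ENNReal.ofReal s)⁻¹) (q := (ENNReal.ofReal (p / τ))⁻¹)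
    (hPm.smul hDm) hw).trans ?_
  gcongr
  refine (eLpNorm_smul_le_mul_eLpNorm (p := (ENNReal.ofReal ((p - 1) / τ))⁻¹) (q := q)
    hDm hPm).trans ?_
  rw [e1, e3, ENNReal.ofReal_mul (by positivity),
    ← ENNReal.ofReal_rpow_of_nonneg (by positivity) (by linarith)]
  gcongr

lemma memLp_weightedPower (hq : q ≠ ⊤) {p s : ℝ} (hp : 1 < p) (hs : 0 ≤ s) {w : V → ℝ}
    (hw : MemLp w (ENNReal.ofReal s)⁻¹ μ) (u : Lp ℝ q μ) :
    MemLp (weightedPower w p u) (ENNReal.ofReal (s + p / q.toReal))⁻¹ μ := by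
  have hm : AEStronglyMeasurable (weightedPower w p u) μ :=
    hw.1.mul ((Lp.memLp u).1.norm.aemeasurable.pow_const p).aestronglyMeasurable
  refine ⟨hm, ?_⟩
  have h := eLpNorm_weightedPower_sub_le hq hp hs hw.1 u 0
  have h0 : weightedPower w p u - weightedPower w p (0 : Lp ℝ q μ) =ᵐ[μ] weightedPower w p u := by
    filter_upwards [Lp.coeFn_zero ℝ q μ] with x hx
    simp only [Pi.sub_apply, weightedPower, hx, Pi.zero_apply, abs_zero,
      Real.zero_rpow (by linarith : p ≠ 0), mul_zero, sub_zero]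
  rw [eLpNorm_congr_ae h0] at h
  exact h.trans_lt (ENNReal.mul_lt_top ENNReal.ofReal_lt_top
    (ENNReal.mul_lt_top hw.2 ENNReal.ofReal_lt_top))

end WeightedPower

section Smoothing

variable {N : ℕ} {d : ℝ} {q : ℝ≥0∞}

lemma memLp_indicator_compl_ball_rpow {α : ℝ} (hα : α ≤ 0) :
    MemLp ((Metric.ball (0 : EuclideanSpace ℝ (Fin N)) 1)ᶜ.indicator fun x => ‖x‖ ^ α)
      (ENNReal.ofReal 0)⁻¹ volume := by
  rw [ENNReal.ofReal_zero, ENNReal.inv_zero]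
  refine memLp_top_of_bound (C := 1) (Measurable.indicator (by fun_prop)
    measurableSet_ball.compl).aestronglyMeasurable (Eventually.of_forall fun x => ?_)
  by_cases hx : x ∈ (Metric.ball (0 : EuclideanSpace ℝ (Fin N)) 1)ᶜ
  · rw [indicator_of_mem hx, Real.norm_of_nonneg (by positivity)]
    have h1 : 1 ≤ ‖x‖ := by simpa using hx
    exact Real.rpow_le_one_of_one_le_of_nonpos h1 hα
  · rw [indicator_of_notMem hx]; simp

lemma hardyHenon_eq_add (α p : ℝ) (u : EuclideanSpace ℝ (Fin N) → ℝ) :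
    hardyHenon α p u
      = weightedPower ((Metric.ball 0 1).indicator fun x => ‖x‖ ^ α) p u
        + weightedPower ((Metric.ball 0 1)ᶜ.indicator fun x => ‖x‖ ^ α) p u := by
  ext x
  simp only [hardyHenon, weightedPower, Pi.add_apply, ← add_mul]
  rw [← Pi.add_apply, indicator_self_add_compl]

/-- An exponent `s` slightly above `-α/N` for which both the integrability and the singularity of the
singular part of the nonlinearity are admissible. -/
lemma exists_weight_exponent {α p τ : ℝ} (hN : 0 < (N : ℝ)) (hd : 0 < d) (hp : 1 < p) (hα : 0 < -α)
    (hα' : -α < min (2 * d) N)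
    (hτ : max (N * (p - 1) / (2 * d + α)) (N * p / (N + α)) < τ) :
    ∃ s, 0 < s ∧ -α < N * s ∧ s + p / τ ≤ 1 ∧ N / (2 * d) * (s + (p - 1) / τ) < 1 := by
  have h2d : 0 < 2 * d + α := by linarith [hα'.trans_le (min_le_left _ _)]
  have hNα : 0 < N + α := by linarith [hα'.trans_le (min_le_right _ _)]
  have hτ1 := (le_max_left _ _).trans_lt hτ
  have hτ2 := (le_max_right _ _).trans_lt hτ
  have hτ0 : 0 < τ := lt_of_le_of_lt (div_nonneg (by positivity) hNα.le) hτ2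
  rw [div_lt_iff₀ h2d] at hτ1
  rw [div_lt_iff₀ hNα] at hτ2
  have k1 : -α / N < 1 - p / τ := by
    rw [div_lt_iff₀ hN, sub_mul, lt_sub_iff_add_lt, div_mul_eq_mul_div, one_mul,
      ← lt_sub_iff_add_lt', div_lt_iff₀ hτ0]
    nlinarith
  have k2 : -α / N < 2 * d / N - (p - 1) / τ := by
    rw [lt_sub_iff_add_lt, div_add_div _ _ hN.ne' hτ0.ne', div_lt_div_iff₀ (by positivity) hN]
    nlinarith
  obtain ⟨s, hs1, hs2⟩ := exists_between (lt_min k1 k2)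
  refine ⟨s, (div_pos hα hN).trans hs1, ?_, ?_, ?_⟩
  · rwa [div_lt_iff₀ hN, mul_comm] at hs1
  · linarith [hs2.trans_le (min_le_left _ _)]
  · have h := hs2.trans_le (min_le_right _ _)
    rw [lt_sub_iff_add_lt] at h
    have h' : N / (2 * d) * (s + (p - 1) / τ) < N / (2 * d) * (2 * d / N) := by gcongr
    have h1 : (N : ℝ) / (2 * d) * (2 * d / N) = 1 := by field_simp
    linarith

variable [NeZero N] [Fact (1 ≤ q)]

lemma one_le_inv_ofReal {s : ℝ} (hs1 : s ≤ 1) : 1 ≤ (ENNReal.ofReal s)⁻¹ := by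
  rw [ENNReal.one_le_inv]
  exact ENNReal.ofReal_le_one.2 hs1

lemma inv_ofReal_ne_top {s : ℝ} (hs : 0 < s) : (ENNReal.ofReal s)⁻¹ ≠ ⊤ := by
  rw [ENNReal.inv_ne_top]
  exact (ENNReal.ofReal_pos.2 hs).ne'

lemma inv_ofReal_le (hq : q ≠ ⊤) {s : ℝ} (hs : 1 / q.toReal ≤ s) : (ENNReal.ofReal s)⁻¹ ≤ q := by
  have hτ0 : 0 < q.toReal :=
    ENNReal.toReal_pos (zero_lt_one.trans_le (Fact.out : 1 ≤ q)).ne' hq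
  rw [ENNReal.inv_le_iff_inv_le, ← ENNReal.ofReal_toReal hq, ← ENNReal.ofReal_inv_of_pos hτ0]
  rw [← one_div]
  exact ENNReal.ofReal_le_ofReal hs

lemma polyHeat_sub (hd : 0 < d) (hK : ∀ t, 0 < t → Integrable (polyHeatKernel N d t))
    {t : ℝ} {r : ℝ≥0∞} (hr : 1 ≤ r) (hrtop : r ≠ ⊤)
    {f g : EuclideanSpace ℝ (Fin N) → ℝ} (hf : MemLp f r volume) (hg : MemLp g r volume) :
    polyHeat d t (f - g) = polyHeat d t f - polyHeat d t g := by
  have h := polyHeat_add (t := t) hd hK hr hrtop hr hrtop hf (hg.const_smul (-1 : ℝ))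
  rw [polyHeat_smul, neg_one_smul, neg_one_smul, ← sub_eq_add_neg, ← sub_eq_add_neg] at h
  exact h

/-- Smoothing estimate for a weighted power, with singularity `t^{-(N/2d)(s + (p-1)/q)}`. -/
lemma exists_eLpNorm_polyHeat_weightedPower_sub_le (hd : 0 < d)
    (hK : ∀ t, 0 < t → Integrable (polyHeatKernel N d t)) (hq : q ≠ ⊤) {p s : ℝ} (hp : 1 < p)
    (hs : 0 ≤ s) (hs1 : s + p / q.toReal ≤ 1) {w : EuclideanSpace ℝ (Fin N) → ℝ}
    (hw : MemLp w (ENNReal.ofReal s)⁻¹ volume) :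
    ∃ C : ℝ, 0 ≤ C ∧ ∀ t, 0 < t → ∀ u v : Lp ℝ q (volume : Measure (EuclideanSpace ℝ (Fin N))),
      eLpNorm (polyHeat d t (weightedPower w p u) - polyHeat d t (weightedPower w p v)) q volume
        ≤ ENNReal.ofReal (C * t ^ (-(N / (2 * d) * (s + (p - 1) / q.toReal))) *
          ((‖u‖ + ‖v‖) ^ (p - 1) * ‖u - v‖)) := by
  have hτ0 : 0 < q.toReal :=
    ENNReal.toReal_pos (zero_lt_one.trans_le (Fact.out : 1 ≤ q)).ne' hq
  have hpτ : 1 / q.toReal ≤ s + p / q.toReal := by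
    have : 1 / q.toReal ≤ p / q.toReal := by gcongr
    linarith
  have hpos : 0 < s + p / q.toReal := by positivity
  have hr1 := one_le_inv_ofReal hs1
  have hrq := inv_ofReal_le hq hpτ
  obtain ⟨C, hC, hCb⟩ := exists_eLpNorm_polyHeat_le hd hK hr1 hrq hq
  refine ⟨C * (p * (eLpNorm w (ENNReal.ofReal s)⁻¹ volume).toReal), by positivity,
    fun t ht u v => ?_⟩
  have hu := memLp_weightedPower hq hp hs hw u
  have hv := memLp_weightedPower hq hp hs hw v
  rw [← polyHeat_sub hd hK hr1 (inv_ofReal_ne_top hpos) hu hv]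
  refine (hCb t ht _ (hu.1.sub hv.1)).trans ?_
  have hexp : 1 / (ENNReal.ofReal (s + p / q.toReal))⁻¹.toReal - 1 / q.toReal
      = s + (p - 1) / q.toReal := by
    rw [ENNReal.toReal_inv, ENNReal.toReal_ofReal hpos.le, one_div, inv_inv]
    ring
  rw [hexp]
  calc _ ≤ ENNReal.ofReal (C * t ^ (-(N / (2 * d) * (s + (p - 1) / q.toReal))))
        * (ENNReal.ofReal p * (eLpNorm w (ENNReal.ofReal s)⁻¹ volume *
          ENNReal.ofReal ((‖u‖ + ‖v‖) ^ (p - 1) * ‖u - v‖))) := by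
        gcongr
        exact eLpNorm_weightedPower_sub_le hq hp hs hw.1 u v
    _ = _ := by
        rw [← ENNReal.ofReal_toReal hw.2.ne, ← ENNReal.ofReal_mul (by positivity),
          ← ENNReal.ofReal_mul (by linarith), ← ENNReal.ofReal_mul (by positivity),
          ENNReal.toReal_ofReal (by positivity)]
        congr 1
        ring

/-- The singular part `|x|^α 1_{|x|<1}` of the weight lies in `L^{1/s}` when `-α < N s`. -/
lemma memLp_indicator_ball_rpow {α s : ℝ} (hs : 0 < s) (hαs : -α < N * s) :
    MemLp ((Metric.ball (0 : EuclideanSpace ℝ (Fin N)) 1).indicator fun x => ‖x‖ ^ α)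
      (ENNReal.ofReal s)⁻¹ volume := by
  have hm : Measurable ((Metric.ball (0 : EuclideanSpace ℝ (Fin N)) 1).indicator
      fun x => ‖x‖ ^ α) := Measurable.indicator (by fun_prop) measurableSet_ball
  have htop := inv_ofReal_ne_top hs
  have h0 : (ENNReal.ofReal s)⁻¹ ≠ 0 := ENNReal.inv_ne_zero.2 ENNReal.ofReal_ne_top
  rw [← integrable_norm_rpow_iff hm.aestronglyMeasurable h0 htop, ENNReal.toReal_inv,
    ENNReal.toReal_ofReal hs.le]
  have h1 : (fun x => ‖(Metric.ball (0 : EuclideanSpace ℝ (Fin N)) 1).indicator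
      (fun x => ‖x‖ ^ α) x‖ ^ s⁻¹)
      = (Metric.ball 0 1).indicator fun x => ‖x‖ ^ (α * s⁻¹) := by
    ext x
    by_cases hx : x ∈ Metric.ball (0 : EuclideanSpace ℝ (Fin N)) 1
    · rw [indicator_of_mem hx, indicator_of_mem hx, Real.norm_of_nonneg (by positivity),
        Real.rpow_mul (norm_nonneg _)]
    · rw [indicator_of_notMem hx, indicator_of_notMem hx, norm_zero,
        Real.zero_rpow (inv_pos.2 hs).ne']
  rw [h1, integrable_indicator_iff measurableSet_ball]
  refine (integrableOn_fun_norm_addHaar volume (f := fun r : ℝ => r ^ (α * s⁻¹))).2 ?_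
  simp only [finrank_euclideanSpace, Fintype.card_fin, smul_eq_mul]
  have hN1 : ((N - 1 : ℕ) : ℝ) = N - 1 := by
    rw [Nat.cast_sub NeZero.one_le, Nat.cast_one]
  have h2 : IntegrableOn (fun r : ℝ => r ^ ((N - 1 : ℕ) + α * s⁻¹ : ℝ)) (Ioo 0 1) := by
    rw [← intervalIntegrable_iff_integrableOn_Ioo_of_le zero_le_one]
    refine intervalIntegral.intervalIntegrable_rpow' ?_
    have h3 : -α * s⁻¹ < N := by
      rw [← div_eq_mul_inv, div_lt_iff₀ hs]; exact hαs
    rw [hN1]; linarith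
  refine h2.congr_fun (fun r hr => ?_) measurableSet_Ioo
  simp only
  rw [Real.rpow_add hr.1, Real.rpow_natCast]

end Smoothing

/-! ### The Hardy–Hénon nonlinearity as a Volterra kernel -/

/-- A kernel that is shifted by a strongly continuous family is jointly continuous as soon as it is
Lipschitz in the second variable, locally uniformly in the first. -/
lemma IsShiftSemigroup.volterraKernel {X : Type*} [NormedAddCommGroup X] [NormedSpace ℝ X]
    {Nl : ℝ → X → X} {S : ℝ → X →L[ℝ] X} {M : ℝ} {κ L : ℝ → ℝ} (hS : IsShiftSemigroup Nl S M)
    (hκ : ContinuousOn κ (Ioi 0)) (hκi : ∀ T, 0 ≤ T → IntervalIntegrable κ volume 0 T)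
    (hκ0 : ∀ s, 0 < s → 0 ≤ κ s) (hL : ∀ R, 0 ≤ R → 0 ≤ L R)
    (hlip : ∀ R s u v, 0 < s → ‖u‖ ≤ R → ‖v‖ ≤ R → ‖Nl s u - Nl s v‖ ≤ L R * κ s * ‖u - v‖)
    (h0 : ∀ s, 0 < s → Nl s 0 = 0) : VolterraKernel Nl κ L := by
  refine ⟨?_, hκi, hκ0, hL, hlip, h0⟩
  rintro ⟨t₀, u₀⟩ ⟨ht₀ : 0 < t₀, -⟩
  refine ContinuousAt.continuousWithinAt ?_
  have hpos : ∀ᶠ z : ℝ × X in 𝓝 (t₀, u₀), t₀ / 2 < z.1 :=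
    continuousAt_fst.eventually (lt_mem_nhds (half_lt_self ht₀))
  have hball : ∀ᶠ z : ℝ × X in 𝓝 (t₀, u₀), ‖z.2‖ < ‖u₀‖ + 1 :=
    (continuous_snd.norm.continuousAt (x := (t₀, u₀))).eventually (gt_mem_nhds (lt_add_one ‖u₀‖))
  have htime : ContinuousAt (fun t => Nl t u₀) t₀ := by
    have h1 : ContinuousAt (fun t => S (t - t₀ / 2) (Nl (t₀ / 2) u₀)) t₀ := by
      have h2 : ContinuousAt (fun r => S r (Nl (t₀ / 2) u₀)) (t₀ - t₀ / 2) :=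
        (hS.continuousOn _).continuousAt (Ici_mem_nhds (by linarith))
      exact ContinuousAt.comp (f := fun t => t - t₀ / 2) h2 (by fun_prop)
    refine h1.congr ?_
    filter_upwards [lt_mem_nhds (half_lt_self ht₀)] with t ht
    rw [hS.map_kernel _ _ _ (by linarith) (by linarith), sub_add_cancel]
  rw [ContinuousAt, tendsto_iff_norm_sub_tendsto_zero]
  have hlim : Tendsto (fun z : ℝ × X => L (‖u₀‖ + 1) * κ z.1 * ‖z.2 - u₀‖ + ‖Nl z.1 u₀ - Nl t₀ u₀‖)
      (𝓝 (t₀, u₀)) (𝓝 0) := by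
    have hκc : ContinuousAt (fun z : ℝ × X => κ z.1) (t₀, u₀) :=
      ContinuousAt.comp (f := Prod.fst) (hκ.continuousAt (Ioi_mem_nhds ht₀)) continuousAt_fst
    have hNc : ContinuousAt (fun z : ℝ × X => Nl z.1 u₀) (t₀, u₀) :=
      ContinuousAt.comp (f := Prod.fst) (g := fun t => Nl t u₀) htime continuousAt_fst
    have h1 : ContinuousAt (fun z : ℝ × X =>
        L (‖u₀‖ + 1) * κ z.1 * ‖z.2 - u₀‖ + ‖Nl z.1 u₀ - Nl t₀ u₀‖) (t₀, u₀) :=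
      ((continuousAt_const.mul hκc).mul (continuousAt_snd.sub continuousAt_const).norm).add
        (hNc.sub continuousAt_const).norm
    simpa [ContinuousAt] using h1
  refine squeeze_zero' (Eventually.of_forall fun _ => norm_nonneg _) ?_ hlim
  filter_upwards [hpos, hball] with z hz1 hz2
  calc ‖Nl z.1 z.2 - Nl t₀ u₀‖ ≤ ‖Nl z.1 z.2 - Nl z.1 u₀‖ + ‖Nl z.1 u₀ - Nl t₀ u₀‖ :=
        norm_sub_le_norm_sub_add_norm_sub _ _ _
    _ ≤ _ := by
        gcongr
        exact hlip _ _ _ _ (by linarith) hz2.le (by linarith)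

section HardyHenon

variable {N : ℕ} {d : ℝ} {q : ℝ≥0∞} [Fact (1 ≤ q)] {α p s : ℝ}

lemma memLp_bounded_part (hq : q ≠ ⊤) (hp : 1 < p) (hα : α ≤ 0)
    (u : Lp ℝ q (volume : Measure (EuclideanSpace ℝ (Fin N)))) :
    MemLp (weightedPower ((Metric.ball 0 1)ᶜ.indicator fun x => ‖x‖ ^ α) p u)
      (ENNReal.ofReal (0 + p / q.toReal))⁻¹ volume :=
  memLp_weightedPower hq hp le_rfl (memLp_indicator_compl_ball_rpow hα) u

variable [NeZero N]

lemma memLp_singular_part (hq : q ≠ ⊤) (hp : 1 < p) (hs : 0 < s) (hαs : -α < N * s)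
    (u : Lp ℝ q (volume : Measure (EuclideanSpace ℝ (Fin N)))) :
    MemLp (weightedPower ((Metric.ball 0 1).indicator fun x => ‖x‖ ^ α) p u)
      (ENNReal.ofReal (s + p / q.toReal))⁻¹ volume :=
  memLp_weightedPower hq hp hs.le (memLp_indicator_ball_rpow hs hαs) u

lemma polyHeat_hardyHenon (hd : 0 < d) (hK : ∀ t, 0 < t → Integrable (polyHeatKernel N d t))
    (hq : q ≠ ⊤) (hp : 1 < p) (hα : α ≤ 0) (hs : 0 < s) (hαs : -α < N * s)
    (hs1 : s + p / q.toReal ≤ 1) (t : ℝ)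
    (u : Lp ℝ q (volume : Measure (EuclideanSpace ℝ (Fin N)))) :
    polyHeat d t (hardyHenon α p u)
      = polyHeat d t (weightedPower ((Metric.ball 0 1).indicator fun x => ‖x‖ ^ α) p u)
        + polyHeat d t (weightedPower ((Metric.ball 0 1)ᶜ.indicator fun x => ‖x‖ ^ α) p u) := by
  have hτ0 : 0 < q.toReal :=
    ENNReal.toReal_pos (zero_lt_one.trans_le (Fact.out : 1 ≤ q)).ne' hq
  have hpτ : 0 < p / q.toReal := by positivity
  rw [hardyHenon_eq_add]
  exact polyHeat_add hd hK (one_le_inv_ofReal hs1) (inv_ofReal_ne_top (by positivity))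
    (one_le_inv_ofReal (by linarith)) (inv_ofReal_ne_top (by linarith))
    (memLp_singular_part hq hp hs hαs u) (memLp_bounded_part hq hp hα u)

lemma memLp_polyHeat_hardyHenon (hd : 0 < d)
    (hK : ∀ t, 0 < t → Integrable (polyHeatKernel N d t))
    (hq : q ≠ ⊤) (hp : 1 < p) (hα : α ≤ 0) (hs : 0 < s) (hαs : -α < N * s)
    (hs1 : s + p / q.toReal ≤ 1) {t : ℝ} (ht : 0 < t)
    (u : Lp ℝ q (volume : Measure (EuclideanSpace ℝ (Fin N)))) :
    MemLp (polyHeat d t (hardyHenon α p u)) q volume := by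
  have hτ0 : 0 < q.toReal :=
    ENNReal.toReal_pos (zero_lt_one.trans_le (Fact.out : 1 ≤ q)).ne' hq
  have hpτ : 1 / q.toReal ≤ p / q.toReal := by gcongr
  rw [polyHeat_hardyHenon hd hK hq hp hα hs hαs hs1]
  exact (memLp_polyHeat hd hK ht (one_le_inv_ofReal hs1) (inv_ofReal_le hq (by linarith)) hq
    (memLp_singular_part hq hp hs hαs u)).add
    (memLp_polyHeat hd hK ht (one_le_inv_ofReal (by linarith)) (inv_ofReal_le hq (by linarith)) hq
      (memLp_bounded_part hq hp hα u))

lemma polyHeatLp_polyHeatLp_hardyHenon (hd : 0 < d)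
    (hK : ∀ t, 0 < t → Integrable (polyHeatKernel N d t))
    (hq : q ≠ ⊤) (hp : 1 < p) (hα : α ≤ 0) (hs : 0 < s) (hαs : -α < N * s)
    (hs1 : s + p / q.toReal ≤ 1) {a b : ℝ} (ha : 0 ≤ a) (hb : 0 < b)
    (u : Lp ℝ q (volume : Measure (EuclideanSpace ℝ (Fin N)))) :
    polyHeatLp q d a (polyHeatLp q d b (hardyHenon α p u))
      = polyHeatLp q d (a + b) (hardyHenon α p u) := by
  rcases ha.eq_or_lt with rfl | ha
  · rw [polyHeatLp_of_nonpos le_rfl, zero_add]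
  have hτ0 : 0 < q.toReal :=
    ENNReal.toReal_pos (zero_lt_one.trans_le (Fact.out : 1 ≤ q)).ne' hq
  have hpτ : 1 / q.toReal ≤ p / q.toReal := by gcongr
  have hpτ0 : 0 < p / q.toReal := by positivity
  have hm := fun {t : ℝ} (ht : 0 < t) =>
    memLp_polyHeat_hardyHenon hd hK hq hp hα hs hαs hs1 ht u
  refine Lp.ext ((coeFn_polyHeatLp (memLp_polyHeat_coeFn hd hK hq a _)).trans ?_)
  refine (polyHeat_congr (coeFn_polyHeatLp (hm hb))).trans ?_
  refine EventuallyEq.trans (EventuallyEq.of_eq ?_) (coeFn_polyHeatLp (hm (add_pos ha hb))).symm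
  have h1 := one_le_inv_ofReal hs1
  have h2 : 1 ≤ (ENNReal.ofReal (0 + p / q.toReal))⁻¹ := one_le_inv_ofReal (by linarith)
  have m1 := memLp_singular_part (α := α) hq hp hs hαs u
  have m2 := memLp_bounded_part hq hp hα u
  rw [polyHeat_hardyHenon hd hK hq hp hα hs hαs hs1, polyHeat_hardyHenon hd hK hq hp hα hs hαs hs1,
    polyHeat_add hd hK Fact.out hq Fact.out hq
      (memLp_polyHeat hd hK hb h1 (inv_ofReal_le hq (by linarith)) hq m1)
      (memLp_polyHeat hd hK hb h2 (inv_ofReal_le hq (by linarith)) hq m2),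
    polyHeat_polyHeat hd hK ha hb h1 (inv_ofReal_ne_top (by positivity)) m1,
    polyHeat_polyHeat hd hK ha hb h2 (inv_ofReal_ne_top (by linarith)) m2]

/-- The Lipschitz estimate behind the Volterra kernel: one power of `t` for each part of the weight. -/
lemma exists_norm_polyHeatLp_hardyHenon_sub_le (hd : 0 < d)
    (hK : ∀ t, 0 < t → Integrable (polyHeatKernel N d t))
    (hq : q ≠ ⊤) (hp : 1 < p) (hα : α ≤ 0) (hs : 0 < s) (hαs : -α < N * s)
    (hs1 : s + p / q.toReal ≤ 1) :
    ∃ C : ℝ, 0 ≤ C ∧ ∀ t, 0 < t → ∀ u v : Lp ℝ q (volume : Measure (EuclideanSpace ℝ (Fin N))),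
      ‖polyHeatLp q d t (hardyHenon α p u) - polyHeatLp q d t (hardyHenon α p v)‖
        ≤ C * (‖u‖ + ‖v‖) ^ (p - 1) * (t ^ (-(N / (2 * d) * (s + (p - 1) / q.toReal)))
          + t ^ (-(N / (2 * d) * (0 + (p - 1) / q.toReal)))) * ‖u - v‖ := by
  obtain ⟨C₁, h1, hC₁⟩ := exists_eLpNorm_polyHeat_weightedPower_sub_le hd hK hq hp hs.le hs1
    (memLp_indicator_ball_rpow hs hαs)
  obtain ⟨C₂, h2, hC₂⟩ := exists_eLpNorm_polyHeat_weightedPower_sub_le hd hK hq hp le_rfl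
    (by linarith) (memLp_indicator_compl_ball_rpow (N := N) hα)
  refine ⟨max C₁ C₂, le_max_of_le_left h1, fun t ht u v => ?_⟩
  have hm := memLp_polyHeat_hardyHenon (d := d) (t := t) hd hK hq hp hα hs hαs hs1 ht
  have hq1 : 1 ≤ q := Fact.out
  have hτ0 : 0 < q.toReal := ENNReal.toReal_pos (zero_lt_one.trans_le hq1).ne' hq
  have hpτ : 1 / q.toReal ≤ p / q.toReal := by gcongr
  have hh : ∀ u : Lp ℝ q (volume : Measure (EuclideanSpace ℝ (Fin N))),
      AEStronglyMeasurable (polyHeat d t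
        (weightedPower ((Metric.ball 0 1).indicator fun x => ‖x‖ ^ α) p u)) volume ∧
      AEStronglyMeasurable (polyHeat d t
        (weightedPower ((Metric.ball 0 1)ᶜ.indicator fun x => ‖x‖ ^ α) p u)) volume := fun u =>
    ⟨(memLp_polyHeat hd hK ht (one_le_inv_ofReal hs1) (inv_ofReal_le hq (by linarith)) hq
      (memLp_singular_part hq hp hs hαs u)).1,
     (memLp_polyHeat hd hK ht (one_le_inv_ofReal (by linarith)) (inv_ofReal_le hq (by linarith)) hq
      (memLp_bounded_part hq hp hα u)).1⟩
  have key : eLpNorm (polyHeat d t (hardyHenon α p u) - polyHeat d t (hardyHenon α p v)) q volume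
      ≤ ENNReal.ofReal (C₁ * t ^ (-(N / (2 * d) * (s + (p - 1) / q.toReal))) *
          ((‖u‖ + ‖v‖) ^ (p - 1) * ‖u - v‖)
        + C₂ * t ^ (-(N / (2 * d) * (0 + (p - 1) / q.toReal))) *
          ((‖u‖ + ‖v‖) ^ (p - 1) * ‖u - v‖)) := by
    rw [polyHeat_hardyHenon hd hK hq hp hα hs hαs hs1, polyHeat_hardyHenon hd hK hq hp hα hs hαs hs1,
      add_sub_add_comm, ENNReal.ofReal_add (by positivity) (by positivity)]
    exact (eLpNorm_add_le ((hh u).1.sub (hh v).1) ((hh u).2.sub (hh v).2) hq1).trans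
      (add_le_add (hC₁ t ht u v) (hC₂ t ht u v))
  rw [polyHeatLp_eq_toLp (hm u), polyHeatLp_eq_toLp (hm v), ← MemLp.toLp_sub, Lp.norm_toLp]
  refine (ENNReal.toReal_le_of_le_ofReal (by positivity) key).trans ?_
  have e : ∀ a b c : ℝ, max C₁ C₂ * a * (b + c) * ‖u - v‖
      = max C₁ C₂ * b * (a * ‖u - v‖) + max C₁ C₂ * c * (a * ‖u - v‖) := fun a b c => by ring
  rw [e]
  gcongr
  · exact le_max_left _ _
  · exact le_max_right _ _

/-- In the admissible range of exponents, `e^{-t(-Δ)^d} (|x|^α |u|^p)` is a Volterra kernel on `L^q`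
which the semigroup shifts. -/
lemma exists_volterraKernel_hardyHenon (hd : 0 < d)
    (hK : ∀ t, 0 < t → Integrable (polyHeatKernel N d t))
    (hq : q ≠ ⊤) (hp : 1 < p) (hα : α ≤ 0) (hs : 0 < s) (hαs : -α < N * s)
    (hs1 : s + p / q.toReal ≤ 1) (hs2 : N / (2 * d) * (s + (p - 1) / q.toReal) < 1) :
    ∃ (S : ℝ → Lp ℝ q (volume : Measure (EuclideanSpace ℝ (Fin N))) →L[ℝ]
        Lp ℝ q (volume : Measure (EuclideanSpace ℝ (Fin N)))) (M : ℝ) (κ L : ℝ → ℝ),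
      (∀ t u, S t u = polyHeatLp q d t u) ∧
      IsShiftSemigroup (fun t (u : Lp ℝ q (volume : Measure (EuclideanSpace ℝ (Fin N)))) =>
        polyHeatLp q d t (hardyHenon α p u)) S M ∧
      VolterraKernel (fun t (u : Lp ℝ q (volume : Measure (EuclideanSpace ℝ (Fin N)))) =>
        polyHeatLp q d t (hardyHenon α p u)) κ L := by
  obtain ⟨S, M, hS, hM⟩ := exists_polyHeatCLM (q := q) hd hK hq
  have hS0 : S 0 = 1 := by
    ext1 u
    rw [hS, polyHeatLp_of_nonpos le_rfl]; rfl
  have hshift : IsShiftSemigroup (fun t (u : Lp ℝ q (volume : Measure (EuclideanSpace ℝ (Fin N)))) =>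
      polyHeatLp q d t (hardyHenon α p u)) S M := by
    refine ⟨hS0, fun t _ => hM t, fun u => ?_, fun t r u ht hr => ?_⟩
    · refine continuousOn_of_semigroup hS0 (fun t _ => hM t) (fun a b x ha hb => ?_) ?_
      · rw [hS, hS, hS, polyHeatLp_polyHeatLp hd hK hq ha hb]
      · simp only [hS]
        exact tendsto_polyHeatLp_zero hd hK hq u
    · rw [hS]
      exact polyHeatLp_polyHeatLp_hardyHenon hd hK hq hp hα hs hαs hs1 ht hr u
  obtain ⟨C, hC0, hC⟩ := exists_norm_polyHeatLp_hardyHenon_sub_le hd hK hq hp hα hs hαs hs1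
  have hθ : N / (2 * d) * (0 + (p - 1) / q.toReal) < 1 := by
    refine lt_of_le_of_lt ?_ hs2
    gcongr
  refine ⟨S, M, _, fun R => C * (R + R) ^ (p - 1), hS, hshift, hshift.volterraKernel
    (κ := fun t => t ^ (-(N / (2 * d) * (s + (p - 1) / q.toReal)))
      + t ^ (-(N / (2 * d) * (0 + (p - 1) / q.toReal)))) ?_ ?_ ?_ ?_ ?_ ?_⟩
  · intro t ht
    exact ((Real.continuousAt_rpow_const t _ (Or.inl (ne_of_gt ht))).add
      (Real.continuousAt_rpow_const t _ (Or.inl (ne_of_gt ht)))).continuousWithinAt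
  · exact fun T _ => (intervalIntegral.intervalIntegrable_rpow' (by linarith)).add
      (intervalIntegral.intervalIntegrable_rpow' (by linarith))
  · intro t ht; positivity
  · intro R hR; positivity
  · intro R t u v ht hu hv
    refine (hC t ht u v).trans ?_
    gcongr
  · intro t ht
    have h0 : hardyHenon α p (0 : Lp ℝ q (volume : Measure (EuclideanSpace ℝ (Fin N))))
        =ᵐ[volume] (0 : ℝ) • (0 : EuclideanSpace ℝ (Fin N) → ℝ) := by
      filter_upwards [Lp.coeFn_zero ℝ q (volume : Measure (EuclideanSpace ℝ (Fin N)))] with x hx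
      simp [hardyHenon, Real.zero_rpow (by linarith : p ≠ 0)]
    refine Lp.ext ((coeFn_polyHeatLp
      (memLp_polyHeat_hardyHenon hd hK hq hp hα hs hαs hs1 ht 0)).trans ?_)
    refine (polyHeat_congr h0).trans ?_
    rw [polyHeat_smul, zero_smul]
    exact (Lp.coeFn_zero _ _ _).symm

end HardyHenon

/-! ### The forcing term -/

lemma ForcingCoefficient.intervalIntegrable {ζ : ℝ → ℝ} (hζ : ForcingCoefficient ζ) {T : ℝ}
    (hT : 0 ≤ T) : IntervalIntegrable ζ volume 0 T := by
  obtain ⟨σ, hσ, hequiv⟩ := hζ.equiv_zero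
  obtain ⟨C, hC⟩ := hequiv.isBigO.bound
  obtain ⟨ε, hε : 0 < ε, hb⟩ := (nhdsGT_basis (0 : ℝ)).eventually_iff.1 hC
  have hmeas : ∀ b : ℝ, AEStronglyMeasurable ζ (volume.restrict (Ioc 0 b)) := fun b =>
    (hζ.continuousOn.mono Ioc_subset_Ioi_self).aestronglyMeasurable measurableSet_Ioc
  have h1 : IntervalIntegrable ζ volume 0 (ε / 2) := by
    have hp : IntervalIntegrable (fun t : ℝ => C * t ^ σ) volume 0 (ε / 2) :=
      (intervalIntegral.intervalIntegrable_rpow' hσ).const_mul C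
    refine hp.mono_fun' (by rw [uIoc_of_le (by linarith)]; exact hmeas _) ?_
    rw [uIoc_of_le (by linarith)]
    refine (ae_restrict_iff' measurableSet_Ioc).2 (Eventually.of_forall fun t ht => ?_)
    have h := hb (x := t) ⟨ht.1, by linarith [ht.2]⟩
    rwa [Real.norm_of_nonneg (Real.rpow_nonneg ht.1.le σ)] at h
  rcases hT.eq_or_lt with rfl | hT
  · exact IntervalIntegrable.refl
  refine h1.trans (ContinuousOn.intervalIntegrable (hζ.continuousOn.mono fun t ht => ?_))
  exact (lt_min (by linarith : 0 < ε / 2) hT).trans_le ht.1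

/-- Multiplication by the forcing coefficient is a (linear) Volterra kernel. -/
lemma ForcingCoefficient.volterraKernel {X : Type*} [NormedAddCommGroup X] [NormedSpace ℝ X]
    {ζ : ℝ → ℝ} (hζ : ForcingCoefficient ζ) :
    VolterraKernel (fun s (x : X) => ζ s • x) ζ (fun _ => 1) where
  continuousOn := (hζ.continuousOn.comp continuousOn_fst fun _ hz => hz.1).smul continuousOn_snd
  intervalIntegrable _ hT := hζ.intervalIntegrable hT
  nonneg s hs := (hζ.pos s hs).le
  lip_nonneg _ _ := zero_le_one
  lipschitz R s u v hs _ _ := by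
    rw [← smul_sub, norm_smul, one_mul, Real.norm_of_nonneg (hζ.pos s hs).le]
  map_zero s _ := smul_zero _

section Forcing

variable {X : Type*} [NormedAddCommGroup X] [NormedSpace ℝ X] {ζ : ℝ → ℝ} {v : ℝ → X}

lemma ForcingCoefficient.intervalIntegrable_smul (hζ : ForcingCoefficient ζ)
    (hv : ContinuousOn v (Ici 0)) {t : ℝ} (ht : 0 ≤ t) :
    IntervalIntegrable (fun s => ζ s • v (t - s)) volume 0 t := by
  have h := (hζ.volterraKernel (X := X)).intervalIntegrable_duhamel le_rfl ht le_rfl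
    (hv.mono Icc_subset_Ici_self)
  have h' := (h.comp_sub_left (c := t)).symm
  simpa using h'

lemma ForcingCoefficient.continuousOn_integral (hζ : ForcingCoefficient ζ)
    (hv : ContinuousOn v (Ici 0)) :
    ContinuousOn (fun t => ∫ s in (0 : ℝ)..t, ζ s • v (t - s)) (Ici 0) := by
  have heq : ∀ t : ℝ, ∫ s in (0 : ℝ)..t, ζ s • v (t - s) = ∫ s in (0 : ℝ)..t, ζ (t - s) • v s := by
    intro t
    have h := intervalIntegral.integral_comp_sub_left (a := 0) (b := t)
      (fun s => ζ (t - s) • v s) t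
    simpa using h
  simp only [heq]
  intro t (ht : 0 ≤ t)
  have h := (hζ.volterraKernel (X := X)).continuousOn_duhamel (T := t + 1)
    (hv.mono Icc_subset_Ici_self) t ⟨ht, by linarith⟩
  refine h.mono_of_mem_nhdsWithin ?_
  filter_upwards [self_mem_nhdsWithin, mem_nhdsWithin_of_mem_nhds (gt_mem_nhds (lt_add_one t))]
    with r hr hr' using ⟨hr, le_of_lt hr'⟩

end Forcing

/-! ### Well-posedness -/

/-- Mild solutions are the solutions of a Volterra equation, whose inhomogeneity collects the initial
value and the forcing. All integrability requirements in the definition of a mild solution hold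
automatically. -/
lemma isMildSolution_iff_isVolterraSolution {N : ℕ} [NeZero N] {d : ℝ} (hd : 0 < d)
    (hK : ∀ t, 0 < t → Integrable (polyHeatKernel N d t)) {q : ℝ≥0∞} [Fact (1 ≤ q)] (hq : q ≠ ⊤)
    {α p : ℝ} {ζ κ L : ℝ → ℝ} (hζ : ForcingCoefficient ζ)
    (hmem : ∀ t, 0 < t → ∀ u : Lp ℝ q (volume : Measure (EuclideanSpace ℝ (Fin N))),
      MemLp (polyHeat d t (hardyHenon α p u)) q volume)
    (hN : VolterraKernel (fun t (u : Lp ℝ q (volume : Measure (EuclideanSpace ℝ (Fin N)))) =>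
        polyHeatLp q d t (hardyHenon α p u)) κ L)
    {u₀ w : Lp ℝ q (volume : Measure (EuclideanSpace ℝ (Fin N)))}
    (hw : ContinuousOn (fun t => polyHeatLp q d t w) (Ici 0)) {I : Set ℝ} (hI0 : I ⊆ Ici 0)
    (hI : ∀ t ∈ I, Icc 0 t ⊆ I) {u : ℝ → Lp ℝ q (volume : Measure (EuclideanSpace ℝ (Fin N)))} :
    IsMildSolution d α p ζ w u₀ I u ↔
      IsVolterraSolution (fun t (u : Lp ℝ q (volume : Measure (EuclideanSpace ℝ (Fin N)))) =>
        polyHeatLp q d t (hardyHenon α p u))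
        (fun t => polyHeatLp q d t u₀ + ∫ s in (0 : ℝ)..t, ζ s • polyHeatLp q d (t - s) w) I u := by
  refine ⟨fun h => ⟨h.continuousOn, fun t ht => ?_⟩, fun h => ?_⟩
  · rw [h.duhamel t ht, add_right_comm]
  · exact
      { continuousOn := h.1
        memLp_init := fun t _ => memLp_polyHeat_coeFn hd hK hq t u₀
        memLp_nonlin := fun t _ s hs => hmem _ (sub_pos.2 hs.2) _
        memLp_forcing := fun t _ s _ => memLp_polyHeat_coeFn hd hK hq _ w
        integrable_nonlin := fun t ht =>
          hN.intervalIntegrable_duhamel le_rfl (hI0 ht) le_rfl (h.1.mono (hI t ht))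
        integrable_forcing := fun t ht => hζ.intervalIntegrable_smul hw (hI0 ht)
        duhamel := fun t ht => by rw [h.2 t ht, add_right_comm] }

theorem mainTheorem4
    (N : ℕ) (hN : 2 ≤ N)
    (d : ℝ) (hd : (0 < d ∧ d < 1) ∨ ∃ k : ℕ, 1 ≤ k ∧ d = k)
    (p : ℝ) (hp : 1 < p)
    (α : ℝ) (hα : 0 < -α) (hα' : -α < min (2 * d) N)
    (q : ℝ≥0∞) [Fact (1 ≤ q)] (hq_one : 1 < q) (hq_top : q ≠ ⊤)
    (hq : max (N * (p - 1) / (2 * d + α)) (N * p / (N + α)) < q.toReal)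
    (ζ : ℝ → ℝ) (hζ : ForcingCoefficient ζ)
    (u₀ w : Lp ℝ q (volume : Measure (EuclideanSpace ℝ (Fin N)))) :
    -- local existence and uniqueness in `C([0,T]; L^q)`
    (∃ T : ℝ, 0 < T ∧ ∃ u, IsMildSolution d α p ζ w u₀ (Icc 0 T) u ∧
      ∀ v, IsMildSolution d α p ζ w u₀ (Icc 0 T) v → EqOn v u (Icc 0 T)) ∧
    -- the maximal solution, on `[0, T_max)`, and the blow-up alternative
    (∃ u, IsMildSolution d α p ζ w u₀
        {t : ℝ | 0 ≤ t ∧ (t : EReal) < maximalTime d α p ζ w u₀} u ∧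
      (∀ T : ℝ, 0 < T → ∀ v, IsMildSolution d α p ζ w u₀ (Icc 0 T) v →
        (T : EReal) < maximalTime d α p ζ w u₀ ∧ EqOn v u (Icc 0 T)) ∧
      (maximalTime d α p ζ w u₀ < ⊤ →
        Tendsto (fun t => ‖u t‖) (𝓝[<] (maximalTime d α p ζ w u₀).toReal) atTop)) := by
  have : NeZero N := ⟨by lia⟩
  have hd0 : 0 < d := by
    rcases hd with hd | ⟨k, hk, rfl⟩
    · exact hd.1
    · exact_mod_cast hk
  have hK : ∀ t, 0 < t → Integrable (polyHeatKernel N d t) :=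
    fun t ht => integrable_polyHeatKernel hd ht
  obtain ⟨s, hs, hαs, hs1, hs2⟩ :=
    exists_weight_exponent (Nat.cast_pos.2 (NeZero.pos N)) hd0 hp hα hα' hq
  have hα0 : α ≤ 0 := by linarith
  obtain ⟨S, M, κ, L, hS, hshift, hker⟩ :=
    exists_volterraKernel_hardyHenon hd0 hK hq_top hp hα0 hs hαs hs1 hs2
  have hcont : ∀ x : Lp ℝ q (volume : Measure (EuclideanSpace ℝ (Fin N))),
      ContinuousOn (fun t => polyHeatLp q d t x) (Ici 0) := fun x => by
    simpa only [hS] using hshift.continuousOn x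
  have hiff := fun I hI0 hI u => isMildSolution_iff_isVolterraSolution (u₀ := u₀) (I := I) (u := u) hd0 hK hq_top
    hζ (fun _ => memLp_polyHeat_hardyHenon hd0 hK hq_top hp hα0 hs hαs hs1) hker (hcont w)
    hI0 hI
  have hIcc := fun T : ℝ => hiff (Icc 0 T) Icc_subset_Ici_self
    fun t ht => Icc_subset_Icc_right ht.2
  obtain ⟨⟨T, hT, u, hu⟩, U, hU, hUmax, hblow⟩ := hker.maximal_solution hshift
    ((hcont u₀).add (hζ.continuousOn_integral (hcont w)))
    (maximalTime d α p ζ w u₀) (by simp only [maximalTime, hIcc]; rfl)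
  refine ⟨⟨T, hT, u, (hIcc T u).2 hu, fun v hv => hker.solution_unique ((hIcc T v).1 hv) hu⟩, U, ?_,
    fun T hT v hv => hUmax T hT v ((hIcc T v).1 hv), hblow⟩
  exact (hiff {t : ℝ | 0 ≤ t ∧ (t : EReal) < maximalTime d α p ζ w u₀} (fun t ht => ht.1)
    (fun t ht r hr => ⟨hr.1, (EReal.coe_le_coe hr.2).trans_lt ht.2⟩) U).2 hU
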